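/- Let the service times have a probability distribution on $[0,\infty)$ with mean $b$ and Laplace–Stieltjes transform $B^*(s)=\mathbb E[e^{-sX}]$, and let $-R_{B^*}$ be the abscissa of convergence of $B^*$ ($R_{B^*}=\infty$ if $B^*$ is entire). Assume that the service times are of type 1: $R_{B^*}>0$ and $B^*(s)\to\infty$ as $s\downarrow -R_{B^*}$. Let $\lambda_1,\lambda_2,\nu>0$, $\lambda=\lambda_1+\lambda_2$ and $\rho=\lambda b<1$. A number $R>0$ is called the dominant singularity of a function $f$ analytic at $0$ if $f$ extends analytically to the disc $|z|<R$, and $R$ is the only point of the circle $|z|=R$ to a neighbourhood of which this extension cannot be continued analytically. A $\Delta$-domain at $R$ is a set $\{z: |z|<S,\ z\ne R,\ |\arg(z-R)|>\varphi\}$ with $S>R$ and $0<\varphi<\pi/2$. For $|z|<1$ let $h(z)$ be the root $w$ in $|w|<1$ of $w=B^*(\lambda_1(1-w)+\lambda_2(1-z))$, and extend $h$ by its Taylor series at $0$. Put $$f_1(z)=\frac{1-h(z)}{h(z)-z},\qquad f_2(z)=-\frac{\lambda}{\nu}\int_z^1 f_1(x)\,dx,\qquad Q(z)=(1-\rho)\,e^{f_2(z)}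 .$$ ($Q$ is the partial generating function of the orbit size when the server is idle.) Theorem. The root $h(z)$ exists and is unique for $|z|<1$, and $h$, $f_1$ and $Q$ have dominant singularities $R_h$, $R_{f_1}$ and $R_Q$, with $R_Q=R_{f_1}$. The function $Q$ continues analytically to a $\Delta$-domain at $R_Q$. Let $R^*$ denote the smallest zero of $h(x)-x$ with $1<x\le R_h$, if there is one. Then, as $z\to R_Q$ in this $\Delta$-domain (with principal branches of the powers, and $u\sim v$ meaning $u=v+o(v)$): 1. If $R^*$ exists and $R^*<R_h$, then $R_Q=R^*$ and $$Q(z)\sim c_Q^{(1)}(R_Q-z)^{-\frac{\lambda}{\nu}c_{f_1}^{(1)}} .$$ 2. If $R^*$ does not exist, then $R_Q=R_h$ and $$Q(z)-\Big(Q(R_Q)-(1-\rho)e^{f_2(R_Q)}\tfrac{\lambda}{\nu}f_1(R_Q)(R_Q-z)\Big)\sim c_Q^{(2)}(R_Q-z)^{3/2} .$$ 3. If $R^*$ exists and $R^*=R_h$, then $R_Q=R^*=R_h$ and $$Q(z)-Q(R_Q)\sim -c_Q^{(3)}(R_Q-z)^{1/2} .$$ Here $$c_Q^{(1)}=(1-\rho)(R_Q-1)^{\frac{\lambda}{\nu}c_{f_1}^{(1)}}\exp\Big(-\frac{\lambda}{\nu}\int_{R_Q}^1\Big(f_1(x)-\frac{c_{f_1}^{(1)}}{R_Q-x}\Big)dx\Big),$$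 $$c_Q^{(2)}=(1-\rho)e^{f_2(R_Q)}\frac{2\lambda}{3\nu}c_{f_1}^{(2)},\qquad c_Q^{(3)}=(1-\rho)e^{f_2(R_Q)}\frac{2\lambda}{\nu}c_{f_1}^{(3)},$$ $$c_{f_1}^{(1)}=\frac{(1-R_{f_1})\big(1+\lambda_1 {B^*}'(\lambda(1-R_{f_1}))\big)}{1+\lambda {B^*}'(\lambda(1-R_{f_1}))},\qquad c_{f_1}^{(2)}=\frac{R_{f_1}-1}{(h(R_{f_1})-R_{f_1})^2}\,c_h,\qquad c_{f_1}^{(3)}=\frac{R_{f_1}-1}{c_h},$$ $$c_h=\sqrt{\frac{2\lambda_2}{\lambda_1^3\,{B^*}''\big(\lambda_1(1-h(R_h))+\lambda_2(1-R_h)\big)}} .$$ -/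

import Mathlib

open Real Set Filter Topology MeasureTheory ProbabilityTheory Asymptotics

noncomputable section

namespace PriorityRetrial

/-! ### Service times -/

/-- The Laplace-Stieltjes transform `B*(s) = ∫ exp (-s x) dB(x)` of the service-time
distribution `μ`, for complex `s`. -/
def LST (μ : Measure ℝ) (s : ℂ) : ℂ := complexMGF id μ (-s)

/-- The Laplace-Stieltjes transform at a real argument. -/
def realLST (μ : Measure ℝ) (s : ℝ) : ℝ := mgf id μ (-s)

/-- The number `R_{B*} ∈ [0, ∞]` such that `-R_{B*}` is the abscissa of convergence of the
Laplace-Stieltjes transform, i.e. its dominant singularity (`R_{B*} = ∞` if it is entire). -/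
def RB (μ : Measure ℝ) : EReal := sSup ((fun θ : ℝ => (θ : EReal)) '' integrableExpSet id μ)

/-- Type-1 service times: `R_{B*} > 0` and `B*(s) → ∞` as the real variable `s`
decreases to `-R_{B*}` (which may be `-∞`). -/
def IsType1 (μ : Measure ℝ) : Prop :=
  0 < RB μ ∧
    Tendsto (realLST μ) (comap (fun s : ℝ => (s : EReal)) (𝓝[>] (-RB μ))) atTop

/-- The load `ρ = (λ₁ + λ₂) b` with `b` the mean service time. -/
def load (μ : Measure ℝ) (lam₁ lam₂ : ℝ) : ℝ := (lam₁ + lam₂) * ∫ x, x ∂μ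

/-! ### Singularities -/

/-- `g`, given on `U`, has an analytic continuation to a neighbourhood of `ζ`. -/
def ContinuableAt (g : ℂ → ℂ) (U : Set ℂ) (ζ : ℂ) : Prop :=
  ∃ k : ℂ → ℂ, AnalyticAt ℂ k ζ ∧ k =ᶠ[𝓝[U] ζ] g

/-- The positive number `R` is the (unique) dominant singularity of `f`: the germ of `f` at `0`
extends analytically to the disc of radius `R`, and `R` is the only point of the circle of
radius `R` at which this extension cannot be continued analytically. -/
def IsDominantSingularity (f : ℂ → ℂ) (R : ℝ) : Prop :=
  0 < R ∧ ∃ g : ℂ → ℂ, AnalyticOnNhd ℂ g (Metric.ball 0 R) ∧ g =ᶠ[𝓝 0] f ∧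
    ∀ ζ ∈ Metric.sphere (0 : ℂ) R, ContinuableAt g (Metric.ball 0 R) ζ ↔ ζ ≠ (R : ℂ)

/-- The Delta-domain at `R` with outer radius `S` and angle `φ`. -/
def DeltaDomain (R S φ : ℝ) : Set ℂ :=
  {z : ℂ | ‖z‖ < S ∧ z ≠ (R : ℂ) ∧ φ < |Complex.arg (z - (R : ℂ))|}

/-! ### The functions `h`, `f₁`, `f₂` and `Q` -/

/-- `w` is a root in the open unit disc of `w = B*(λ₁ (1 - w) + λ₂ (1 - z))`. -/
def IsRoot (μ : Measure ℝ) (lam₁ lam₂ : ℝ) (z w : ℂ) : Prop :=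
  ‖w‖ < 1 ∧ w = LST μ ((lam₁ : ℂ) * (1 - w) + (lam₂ : ℂ) * (1 - z))

/-- The root as a function of `z` in the open unit disc. -/
def hRoot (μ : Measure ℝ) (lam₁ lam₂ : ℝ) (z : ℂ) : ℂ :=
  Classical.epsilon (IsRoot μ lam₁ lam₂ z)

/-- The function `h`: the sum of the Taylor series at `0` of the root function. On the open unit
disc it is the root function; elsewhere, where the series converges, it extends the latter. -/
def h (μ : Measure ℝ) (lam₁ lam₂ : ℝ) (z : ℂ) : ℂ :=
  ∑' n : ℕ, iteratedDeriv n (hRoot μ lam₁ lam₂) 0 / (n.factorial : ℂ) * z ^ n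

/-- `f₁(z) = (1 - h(z)) / (h(z) - z)`. -/
def f₁ (μ : Measure ℝ) (lam₁ lam₂ : ℝ) (z : ℂ) : ℂ :=
  (1 - h μ lam₁ lam₂ z) / (h μ lam₁ lam₂ z - z)

/-- `f₂(z) = -(λ/ν) ∫_z^1 f₁(x) dx`, with `λ = λ₁ + λ₂`, integrated along the segment
from `z` to `1`. -/
def f₂ (μ : Measure ℝ) (lam₁ lam₂ ν : ℝ) (z : ℂ) : ℂ :=
  -(((lam₁ + lam₂) / ν : ℝ) : ℂ) *
    ((1 - z) * ∫ t in (0 : ℝ)..1, f₁ μ lam₁ lam₂ (z + (t : ℂ) * (1 - z)))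

/-- `Q(z) = (1 - ρ) exp (-(λ/ν) ∫_z^1 (1 - h(x)) / (h(x) - x) dx)`. -/
def Q (μ : Measure ℝ) (lam₁ lam₂ ν : ℝ) (z : ℂ) : ℂ :=
  ((1 - load μ lam₁ lam₂ : ℝ) : ℂ) * Complex.exp (f₂ μ lam₁ lam₂ ν z)

/-- `r` is the number `R*`: the smallest zero larger than `1` of `h(x) - x`, where `h` is
considered up to and including its dominant singularity `Rh`. -/
def IsRstar (μ : Measure ℝ) (lam₁ lam₂ Rh r : ℝ) : Prop :=
  IsLeast {x : ℝ | 1 < x ∧ x ≤ Rh ∧ h μ lam₁ lam₂ (x : ℂ) = (x : ℂ)} r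

/-! ### The constants

The values of `h`, `f₁`, `f₂` at real points up to the singularity are real numbers, so that
taking their real parts below only changes the type. -/

/-- The constant `c_h`, as a function of the dominant singularity `Rh` of `h`. -/
def cH (μ : Measure ℝ) (lam₁ lam₂ Rh : ℝ) : ℝ :=
  √(2 * lam₂ / (lam₁ ^ 3 *
    iteratedDeriv 2 (realLST μ)
      (lam₁ * (1 - (h μ lam₁ lam₂ (Rh : ℂ)).re) + lam₂ * (1 - Rh))))

/-- The constant `c_{f₁}^{(1)}`, as a function of the dominant singularity `R` of `f₁`. -/
def cF1 (μ : Measure ℝ) (lam₁ lam₂ R : ℝ) : ℝ :=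
  (1 - R) * (1 + lam₁ * deriv (realLST μ) ((lam₁ + lam₂) * (1 - R))) /
    (1 + (lam₁ + lam₂) * deriv (realLST μ) ((lam₁ + lam₂) * (1 - R)))

/-- The constant `c_{f₁}^{(2)}`, in the case that `R` is the dominant singularity of both
`h` and `f₁`. -/
def cF2 (μ : Measure ℝ) (lam₁ lam₂ R : ℝ) : ℝ :=
  (R - 1) / ((h μ lam₁ lam₂ (R : ℂ)).re - R) ^ 2 * cH μ lam₁ lam₂ R

/-- The constant `c_{f₁}^{(3)}`, in the case that `R` is the dominant singularity of both
`h` and `f₁`. -/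
def cF3 (μ : Measure ℝ) (lam₁ lam₂ R : ℝ) : ℝ :=
  (R - 1) / cH μ lam₁ lam₂ R

/-- The constant `c_Q^{(1)}`. -/
def cQ1 (μ : Measure ℝ) (lam₁ lam₂ ν R : ℝ) : ℝ :=
  (1 - load μ lam₁ lam₂) * (R - 1) ^ ((lam₁ + lam₂) / ν * cF1 μ lam₁ lam₂ R) *
    Real.exp (-((lam₁ + lam₂) / ν) *
      ∫ x in R..1, ((f₁ μ lam₁ lam₂ (x : ℂ)).re - cF1 μ lam₁ lam₂ R / (R - x)))

/-- The constant `c_Q^{(2)}`. -/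
def cQ2 (μ : Measure ℝ) (lam₁ lam₂ ν R : ℝ) : ℝ :=
  (1 - load μ lam₁ lam₂) * Real.exp (f₂ μ lam₁ lam₂ ν (R : ℂ)).re *
    (2 * (lam₁ + lam₂) / (3 * ν)) * cF2 μ lam₁ lam₂ R

/-- The constant `c_Q^{(3)}`. -/
def cQ3 (μ : Measure ℝ) (lam₁ lam₂ ν R : ℝ) : ℝ :=
  (1 - load μ lam₁ lam₂) * Real.exp (f₂ μ lam₁ lam₂ ν (R : ℂ)).re *
    (2 * (lam₁ + lam₂) / ν) * cF3 μ lam₁ lam₂ R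

/-- The coefficient `(1 - ρ) exp (f₂(R)) (λ/ν) f₁(R)` of the linear term. -/
def cQlin (μ : Measure ℝ) (lam₁ lam₂ ν R : ℝ) : ℝ :=
  (1 - load μ lam₁ lam₂) * Real.exp (f₂ μ lam₁ lam₂ ν (R : ℂ)).re *
    ((lam₁ + lam₂) / ν) * (f₁ μ lam₁ lam₂ (R : ℂ)).re

end PriorityRetrial

end

open PriorityRetrial

open PriorityRetrial

namespace PriorityRetrial

/-! Write `a = λ₁`, `b = λ₂`, `M₀(u) = 𝔼[e^{uX}]` and substitute `u = a (h(z) - 1) + b (z - 1)`. The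
equation defining `h` becomes `h = M₀(u)`, so that `z = Z(u) = 1 + (u + a (1 - M₀(u))) / b` is
explicit and `h = M₀ ∘ Z⁻¹`. All singularities are read off from `Z`.

Let `u₀` be the critical point, `a M₀'(u₀) = 1`, and `us` the positive root of `(a + b) (M₀(u) - 1)
= u`. Type 1 and `ρ < 1` place both strictly inside the half-plane of convergence
(`exists_critical_points`). Since `X ≥ 0`, `|M₀'(u)| ≤ M₀'(Re u)`; hence `Z` is injective on `Re u <
u₀` and covers `Re z < Z(u₀)` (`injOn_zMap`, `exists_zMap_eq`). So `h` continues to a half-plane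
that contains every point of the circle `|z| = Z(u₀)` except the positive one, and `R_h = Z(u₀)`.
There `Z` has a nondegenerate maximum along the reals, which makes `Z⁻¹` analytic in `t = (R_h -
z)^{1/2}` (`exists_sqrt_param`). The Taylor coefficients of `h` are nonnegative, so its series also
represents it at `R_h` (`tsum_taylor_coeff`).

In the variable `u`, `h - z = -u κ(u) / b` and `f₁ = b N(u) / κ(u)`, with `N(u) = (M₀(u) - 1) / u`
and `κ = 1 - (a + b) N`. The function `κ` has no zero in `Re u < us` and a simple zero at `us`
(`kap_ne_zero`, `hasDerivAt_kap_us`). Therefore `R*` exists exactly when `us ≤ u₀`, it is then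
`Z(us)`, and `R_{f₁} = Z(min u₀ us)`.

The three cases compare `us` with `u₀`. If `us < u₀`, `f₁` has a simple pole, its primitive a
logarithm, and `Q` a power singularity. If `u₀ < us`, `f₁` is analytic in `t`; since `dz = -2t dt`,
the primitive has no linear term in `t`, and the first nonanalytic term is of order `t³`. If `us =
u₀`, `f₁` behaves like `1/t`, the factor `-2t` cancels this, and the primitive is linear in `t` to
first order. In each case the local form holds on a slit disc about the singularity; gluing it to
the half-plane gives the Delta-domain (`exists_deltaDomain_extension`). -/

/-- The functions `M k z = 𝔼[X ^ k e ^ (z X)]` on the half-plane `Re z < A`, with their restrictions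
`m k` to the real axis, abstracted to the properties that the analysis uses. -/
structure IsMomentFamily (M : ℕ → ℂ → ℂ) (m : ℕ → ℝ → ℝ) (A : ℝ) : Prop where
  hasDerivAt : ∀ k z, z.re < A → HasDerivAt (M k) (M (k + 1) z) z
  ofReal : ∀ k (x : ℝ), x < A → M k x = m k x
  norm_le : ∀ k z, z.re < A → ‖M k z‖ ≤ m k z.re
  pos : ∀ k x, x < A → 0 < m k x
  zero : m 0 0 = 1
  pos_bound : 0 < A

/-! ### Moments of the service time and existence of the critical points -/

/-- The complex moment `∫ x ^ k e ^ (z x) dμ`. -/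
noncomputable def cMoment (μ : Measure ℝ) (k : ℕ) (z : ℂ) : ℂ :=
  ∫ x, ((id x : ℝ) : ℂ) ^ k * Complex.exp (z * (id x : ℝ)) ∂μ

/-- The real moment `∫ x ^ k e ^ (t x) dμ`. -/
noncomputable def rMoment (μ : Measure ℝ) (k : ℕ) (t : ℝ) : ℝ :=
  ∫ x, (id x) ^ k * Real.exp (t * id x) ∂μ

lemma ae_nonneg_of_measure_Iio {μ : Measure ℝ} (hμ : μ (Set.Iio 0) = 0) : ∀ᵐ x ∂μ, 0 ≤ x := by
  rw [ae_iff]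
  convert hμ using 2
  ext x; simp

/-- For `X ≥ 0` the function `e^{tX}` is monotone in `t`, so integrability at one exponent gives it
at all smaller ones. -/
lemma mem_interior_integrableExpSet {μ : Measure ℝ} [IsProbabilityMeasure μ]
    (hμ : μ (Set.Iio 0) = 0) {t : ℝ} (ht : (t : EReal) < RB μ) :
    t ∈ interior (integrableExpSet id μ) := by
  obtain ⟨_, ⟨s, hs, rfl⟩, hts⟩ := lt_sSup_iff.1 ht
  have hts : t < s := EReal.coe_lt_coe_iff.1 hts
  refine mem_interior.2 ⟨Iio s, fun r hr => ?_, isOpen_Iio, hts⟩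
  have hs' : Integrable (fun x : ℝ => rexp (s * id x)) μ := hs
  refine Integrable.mono' hs' (by fun_prop) ?_
  filter_upwards [ae_nonneg_of_measure_Iio hμ] with x hx
  simp only [id, norm_eq_abs, abs_exp, exp_le_exp]
  exact mul_le_mul_of_nonneg_right (le_of_lt hr) hx

/-- The blow-up in `IsType1`, with the sign of the argument reversed. Working in `EReal` treats a
finite and an infinite abscissa at once. -/
lemma exists_realLST_gt {μ : Measure ℝ} (hType : IsType1 μ) (C : ℝ) {v₀ : ℝ}
    (hv₀ : (v₀ : EReal) < RB μ) :
    ∃ v : ℝ, v₀ < v ∧ (v : EReal) < RB μ ∧ C < rMoment μ 0 v := by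
  have h := hType.2.eventually (eventually_gt_atTop C)
  rw [eventually_comap] at h
  have hlt : -RB μ < ((-v₀ : ℝ) : EReal) := by
    rw [EReal.coe_neg]; exact EReal.neg_lt_neg_iff.2 hv₀
  obtain ⟨b, hb, hb'⟩ := (mem_nhdsGT_iff_exists_Ioo_subset' hlt).1 h
  obtain ⟨s, hs1, hs2⟩ := EReal.lt_iff_exists_real_btwn.1 (lt_min hlt hb)
  have := hb' ⟨hs1, hs2.trans_le (min_le_right _ _)⟩ s rfl
  have h2 : s < -v₀ := by exact_mod_cast hs2.trans_le (min_le_left _ _)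
  refine ⟨-s, by linarith, ?_, ?_⟩
  · rw [EReal.coe_neg]; exact EReal.neg_lt_comm.1 hs1
  · simpa [realLST, mgf, rMoment] using this

/-- If `X = 0` almost surely the transform is constantly `1` and cannot blow up. This makes all
moments strictly positive. -/
lemma measure_Ioi_pos {μ : Measure ℝ} [IsProbabilityMeasure μ] (hμ : μ (Set.Iio 0) = 0)
    (hType : IsType1 μ) : 0 < μ (Set.Ioi 0) := by
  rw [pos_iff_ne_zero]
  intro h0
  have hz : ∀ᵐ x ∂μ, x = 0 := by
    have h1 : ∀ᵐ x ∂μ, ¬ (0 < x) := by rw [ae_iff]; simpa [Set.Ioi] using h0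
    filter_upwards [h1, ae_nonneg_of_measure_Iio hμ] with x hx hx'
    linarith
  obtain ⟨v, -, -, hv⟩ := exists_realLST_gt hType 2 (v₀ := 0) hType.1
  have : rMoment μ 0 v = ∫ _, (1 : ℝ) ∂μ := by
    refine integral_congr_ae ?_
    filter_upwards [hz] with x hx
    simp [hx]
  simp at this
  linarith

lemma integrable_rMoment {μ : Measure ℝ} [IsProbabilityMeasure μ] (hμ : μ (Set.Iio 0) = 0)
    (k : ℕ) {t : ℝ} (ht : (t : EReal) < RB μ) :
    Integrable (fun x : ℝ => (id x) ^ k * Real.exp (t * id x)) μ :=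
  integrable_pow_mul_exp_of_mem_interior_integrableExpSet (mem_interior_integrableExpSet hμ ht) k

lemma isMomentFamily_moments {μ : Measure ℝ} [IsProbabilityMeasure μ] (hμ : μ (Set.Iio 0) = 0)
    (hType : IsType1 μ) {A : ℝ} (hA : 0 < A) (hAR : (A : EReal) < RB μ) :
    IsMomentFamily (cMoment μ) (rMoment μ) A where
  hasDerivAt k z hz := by
    refine hasDerivAt_integral_pow_mul_exp (mem_interior_integrableExpSet hμ ?_) k
    exact lt_trans (by exact_mod_cast hz) hAR
  ofReal k x _ := by
    rw [cMoment, rMoment, ← integral_complex_ofReal]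
    congr 1 with y
    push_cast
    rfl
  norm_le k z _ := by
    refine (norm_integral_le_integral_norm _).trans (le_of_eq (integral_congr_ae ?_))
    filter_upwards [ae_nonneg_of_measure_Iio hμ] with x hx
    simp [Complex.norm_exp, abs_of_nonneg hx]
  pos k x hx := by
    have hxR : (x : EReal) < RB μ := lt_trans (by exact_mod_cast hx) hAR
    rw [rMoment, integral_pos_iff_support_of_nonneg_ae _ (integrable_rMoment hμ k hxR)]
    · refine (measure_Ioi_pos hμ hType).trans_le (measure_mono fun y hy => ?_)
      have : (0 : ℝ) < y := hy
      simp only [Function.mem_support, id]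
      positivity
    · filter_upwards [ae_nonneg_of_measure_Iio hμ] with y hy
      simp only [id, Pi.zero_apply]; positivity
  zero := by simp [rMoment]
  pos_bound := hA

namespace IsMomentFamily

variable {M : ℕ → ℂ → ℂ} {m : ℕ → ℝ → ℝ} {A : ℝ}

lemma hasDerivAt_real (H : IsMomentFamily M m A) (k : ℕ) {x : ℝ} (hx : x < A) :
    HasDerivAt (m k) (m (k + 1) x) x := by
  have h := (H.hasDerivAt k (x : ℂ) (by simpa using hx)).real_of_complex
  rw [H.ofReal _ _ hx, Complex.ofReal_re] at h
  refine h.congr_of_eventuallyEq ?_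
  filter_upwards [isOpen_Iio.mem_nhds hx] with y hy
  rw [H.ofReal _ _ hy, Complex.ofReal_re]

lemma continuousOn_real (H : IsMomentFamily M m A) (k : ℕ) : ContinuousOn (m k) (Iio A) :=
  fun _ hx => (H.hasDerivAt_real k hx).continuousAt.continuousWithinAt

lemma strictMonoOn (H : IsMomentFamily M m A) (k : ℕ) : StrictMonoOn (m k) (Iio A) := by
  refine strictMonoOn_of_deriv_pos (convex_Iio A) (H.continuousOn_real k) fun x hx => ?_
  rw [interior_Iio] at hx
  rw [(H.hasDerivAt_real k hx).deriv]
  exact H.pos _ _ hx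

end IsMomentFamily

/-- With a finite abscissa the line is bounded while the transform blows up; with an infinite one
the transform grows at least quadratically. -/
lemma exists_rMoment_zero_gt_linear {μ : Measure ℝ} [IsProbabilityMeasure μ]
    (hμ : μ (Set.Iio 0) = 0) (hType : IsType1 μ) {C : ℝ} (hC : 0 < C) :
    ∃ v : ℝ, 0 < v ∧ (v : EReal) < RB μ ∧ 1 + C * v < rMoment μ 0 v := by
  rcases eq_or_ne (RB μ) ⊤ with htop | htop
  · have hlt : ∀ x : ℝ, (x : EReal) < RB μ := fun x => htop ▸ EReal.coe_lt_top x
    have hF := isMomentFamily_moments hμ hType one_pos (hlt 1)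
    have hpos := hF.pos 2 0 one_pos
    set e := rMoment μ 2 0
    have hv : 0 < 2 * (C + 1) / e + 1 := by positivity
    -- Chosen so that `v² e / 2 = v (C + 1 + e / 2)` exceeds `C v`.
    set v := 2 * (C + 1) / e + 1 with hvdef
    refine ⟨v, hv, hlt _, ?_⟩
    have hle : 1 + v ^ 2 / 2 * e ≤ rMoment μ 0 v := by
      have h1 : 1 + v ^ 2 / 2 * e =
          ∫ x, (1 + v ^ 2 / 2 * ((id x) ^ 2 * Real.exp (0 * id x))) ∂μ := by
        rw [integral_add (integrable_const _) ((integrable_rMoment hμ 2 (hlt 0)).const_mul _),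
          integral_const_mul]
        simp [e, rMoment]
      rw [h1]
      refine integral_mono_ae ((integrable_const _).add
        ((integrable_rMoment hμ 2 (hlt 0)).const_mul _)) (integrable_rMoment hμ 0 (hlt v)) ?_
      filter_upwards [ae_nonneg_of_measure_Iio hμ] with x hx
      have := Real.quadratic_le_exp_of_nonneg (mul_nonneg hv.le hx)
      simp only [id, zero_mul, Real.exp_zero, pow_zero, one_mul, mul_one]
      nlinarith [mul_nonneg hv.le hx]
    have h2 : v ^ 2 / 2 * e = v * (C + 1 + e / 2) := by rw [hvdef]; field_simp
    nlinarith [mul_pos hv hpos]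
  · obtain ⟨r, hr⟩ : ∃ r : ℝ, (r : EReal) = RB μ :=
      ⟨_, EReal.coe_toReal htop (ne_bot_of_gt hType.1)⟩
    obtain ⟨v, h1, h2, h3⟩ := exists_realLST_gt hType (1 + C * r) (v₀ := 0) hType.1
    refine ⟨v, h1, h2, lt_of_le_of_lt ?_ h3⟩
    rw [← hr] at h2
    have : v < r := by exact_mod_cast h2
    nlinarith

/-- At some `v` the transform lies above the line of slope `1 / lam₁` through `(0, 1)`. The mean
value theorem then gives a point with `lam₁ M₀' > 1`, and the intermediate value theorem gives `u₀`.
For `us`, the function `lam (M₀(x) - 1) - x` has slope `ρ - 1 < 0` at `0` and is positive at `v`. -/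
lemma exists_critical_points {μ : Measure ℝ} [IsProbabilityMeasure μ]
    (hμ : μ (Set.Iio 0) = 0) (hType : IsType1 μ) {lam₁ lam : ℝ} (h₁ : 0 < lam₁)
    (hlam : lam₁ < lam) (hload : lam * ∫ x, x ∂μ < 1) :
    ∃ A u₀ us : ℝ, (A : EReal) < RB μ ∧ 0 < u₀ ∧ u₀ < A ∧ 0 < us ∧ us < A ∧
      lam₁ * rMoment μ 1 u₀ = 1 ∧ lam * (rMoment μ 0 us - 1) = us := by
  have hlam0 : 0 < lam := h₁.trans hlam
  obtain ⟨v, hv0, hvR, hv⟩ := exists_rMoment_zero_gt_linear hμ hType (one_div_pos.2 h₁)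
  -- Taking `A` beyond `v` leaves room to the right of both `u₀` and `us`, so that `M₀` is analytic
  -- around them.
  obtain ⟨A, hvA, hAR⟩ := EReal.lt_iff_exists_real_btwn.1 hvR
  have hvA : v < A := by exact_mod_cast hvA
  have H := isMomentFamily_moments hμ hType (hv0.trans hvA) hAR
  have hb : lam * rMoment μ 1 0 < 1 := by simpa [rMoment] using hload
  have hb0 := H.pos 1 0 H.pos_bound
  have hsub : Icc 0 v ⊆ Iio A := fun x hx => hx.2.trans_lt hvA
  obtain ⟨ξ, hξ, hξ'⟩ := exists_hasDerivAt_eq_slope (rMoment μ 0) (rMoment μ 1) hv0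
    ((H.continuousOn_real 0).mono hsub) fun x hx => H.hasDerivAt_real 0 (hx.2.trans hvA)
  rw [H.zero, sub_zero] at hξ'
  have hξ1 : 1 < lam₁ * rMoment μ 1 ξ := by
    have : 1 / lam₁ < rMoment μ 1 ξ := by
      rw [hξ', lt_div_iff₀ hv0]; linarith
    rwa [div_lt_iff₀' h₁] at this
  have hsub' : Icc 0 ξ ⊆ Iio A := fun x hx => (hx.2.trans hξ.2.le).trans_lt hvA
  obtain ⟨u₀, hu₀, hu₀'⟩ := intermediate_value_Ioo hξ.1.le
    ((continuousOn_const (c := lam₁)).mul ((H.continuousOn_real 1).mono hsub'))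
    (show (1 : ℝ) ∈ Ioo _ _ from ⟨show lam₁ * rMoment μ 1 0 < 1 by nlinarith, hξ1⟩)
  have hd : HasDerivAt (fun x => lam * (rMoment μ 0 x - 1) - x) (lam * rMoment μ 1 0 - 1) 0 :=
    (((H.hasDerivAt_real 0 H.pos_bound).sub_const 1).const_mul lam).sub (hasDerivAt_id 0)
  obtain ⟨w, hw0, hw, hwv⟩ : ∃ w, 0 < w ∧ lam * (rMoment μ 0 w - 1) - w < 0 ∧ w < v := by
    have h1 := hd.tendsto_slope.eventually
      (gt_mem_nhds (show lam * rMoment μ 1 0 - 1 < 0 by linarith))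
    have h2 : ∀ᶠ w in 𝓝[>] (0 : ℝ), slope (fun x => lam * (rMoment μ 0 x - 1) - x) 0 w < 0 :=
      h1.filter_mono (nhdsWithin_mono _ fun x hx => ne_of_gt hx)
    obtain ⟨w, hw1, hw2⟩ := (h2.and (Ioo_mem_nhdsGT hv0)).exists
    refine ⟨w, hw2.1, ?_, hw2.2⟩
    rw [slope_def_field, H.zero] at hw1
    have := (div_neg_iff.1 hw1).resolve_left (fun h => by linarith [h.2, hw2.1])
    linarith [this.1]
  have hvd : 0 < lam * (rMoment μ 0 v - 1) - v := by
    have h3 : lam₁ * (rMoment μ 0 v - 1) > v := by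
      have : 1 / lam₁ * v < rMoment μ 0 v - 1 := by linarith
      rwa [one_div_mul_eq_div, div_lt_iff₀' h₁] at this
    nlinarith
  have hsubw : Icc w v ⊆ Iio A := fun x hx => hx.2.trans_lt hvA
  obtain ⟨us, hus, hus'⟩ := intermediate_value_Ioo hwv.le
    (((continuousOn_const (c := lam)).mul
      (((H.continuousOn_real 0).mono hsubw).sub continuousOn_const)).sub continuousOn_id)
    (show (0 : ℝ) ∈ Ioo _ _ from ⟨hw, hvd⟩)
  exact ⟨A, u₀, us, hAR, hu₀.1, (hu₀.2.trans hξ.2).trans hvA, hw0.trans hus.1, hus.2.trans hvA,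
    hu₀', by simpa [sub_eq_zero] using hus'⟩

lemma LST_eq_cMoment (μ : Measure ℝ) (s : ℂ) : LST μ s = cMoment μ 0 (-s) := by
  simp [LST, complexMGF, cMoment]

lemma realLST_eq_rMoment (μ : Measure ℝ) (s : ℝ) : realLST μ s = rMoment μ 0 (-s) := by
  simp [realLST, mgf, rMoment]

lemma deriv_realLST {μ : Measure ℝ} {A : ℝ} (H : IsMomentFamily (cMoment μ) (rMoment μ) A) {u : ℝ}
    (hu : u < A) : deriv (realLST μ) (-u) = -rMoment μ 1 u := by
  have h1 : HasDerivAt (rMoment μ 0) (rMoment μ 1 u) (-(-u)) := by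
    rw [neg_neg]; exact H.hasDerivAt_real 0 hu
  rw [funext (realLST_eq_rMoment μ)]
  exact (h1.comp (-u) (hasDerivAt_neg (-u))).deriv.trans (by ring)

lemma iteratedDeriv_two_realLST {μ : Measure ℝ} {A : ℝ}
    (H : IsMomentFamily (cMoment μ) (rMoment μ) A) {u : ℝ}
    (hu : u < A) : iteratedDeriv 2 (realLST μ) (-u) = rMoment μ 2 u := by
  have h1 : HasDerivAt (rMoment μ 1) (rMoment μ 2 u) (-(-u)) := by
    rw [neg_neg]; exact H.hasDerivAt_real 1 hu
  rw [iteratedDeriv_succ, iteratedDeriv_one]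
  have : deriv (realLST μ) =ᶠ[𝓝 (-u)] fun s => -rMoment μ 1 (-s) := by
    filter_upwards [isOpen_Ioi.mem_nhds (show -A < -u by linarith)] with s hs
    have : -s < A := by have : -A < s := hs; linarith
    simpa using deriv_realLST H this
  rw [this.deriv_eq]
  exact (h1.comp (-u) (hasDerivAt_neg (-u))).neg.deriv.trans (by ring)

/-! ### The map `Z` and its inverse on a half-plane -/

/-- A moment family together with arrival rates `a`, `b`, the critical point `u₀` of the map
`u ↦ 1 + (u + a (1 - M₀ u)) / b` and the positive root `us` of `(a + b) (M₀ u - 1) = u`. -/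
structure IsRetrialModel (M : ℕ → ℂ → ℂ) (m : ℕ → ℝ → ℝ) (A a b u₀ us : ℝ) : Prop
    extends IsMomentFamily M m A where
  ha : 0 < a
  hb : 0 < b
  u₀_pos : 0 < u₀
  u₀_lt : u₀ < A
  us_pos : 0 < us
  us_lt : us < A
  crit : a * m 1 u₀ = 1
  star : (a + b) * (m 0 us - 1) = us
  subcritical : (a + b) * m 1 0 < 1

/-- The inverse of `z ↦ u(z) = a (h(z) - 1) + b (z - 1)`. -/
noncomputable def zMap (M : ℕ → ℂ → ℂ) (a b : ℝ) (u : ℂ) : ℂ := 1 + (u + a * (1 - M 0 u)) / b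

/-- The restriction of `zMap` to the real axis. -/
noncomputable def zMapReal (m : ℕ → ℝ → ℝ) (a b : ℝ) (x : ℝ) : ℝ := 1 + (x + a * (1 - m 0 x)) / b

/-- The inverse of `zMap` with values in the half-plane to the left of the critical point. -/
noncomputable def uInv (M : ℕ → ℂ → ℂ) (a b u₀ : ℝ) (z : ℂ) : ℂ :=
  Function.invFunOn (zMap M a b) {u | u.re < u₀} z

lemma isOpen_re_lt (c : ℝ) : IsOpen {z : ℂ | z.re < c} :=
  isOpen_lt Complex.continuous_re continuous_const

lemma convex_re_le (c : ℝ) : Convex ℝ {z : ℂ | z.re ≤ c} := convex_halfSpace_re_le c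

lemma convex_re_lt (c : ℝ) : Convex ℝ {z : ℂ | z.re < c} := convex_halfSpace_re_lt c

namespace IsMomentFamily

variable {M : ℕ → ℂ → ℂ} {m : ℕ → ℝ → ℝ} {A : ℝ}

lemma monotone_le (H : IsMomentFamily M m A) (k : ℕ) {x c : ℝ} (hx : x ≤ c) (hc : c < A) :
    m k x ≤ m k c :=
  (H.strictMonoOn k).monotoneOn (hx.trans_lt hc) hc hx

lemma norm_sub_le (H : IsMomentFamily M m A) (k : ℕ) {c : ℝ} (hc : c < A) {u v : ℂ}
    (hu : u.re ≤ c) (hv : v.re ≤ c) : ‖M k u - M k v‖ ≤ m (k + 1) c * ‖u - v‖ := by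
  refine (convex_re_le c).norm_image_sub_le_of_norm_hasDerivWithin_le
    (f := M k) (f' := M (k + 1)) (fun z hz => ?_) (fun z hz => ?_) hv hu
  · exact (H.hasDerivAt k z (lt_of_le_of_lt hz hc)).hasDerivWithinAt
  · exact (H.norm_le _ _ (lt_of_le_of_lt hz hc)).trans (H.monotone_le _ hz hc)

lemma differentiableOn (H : IsMomentFamily M m A) (k : ℕ) :
    DifferentiableOn ℂ (M k) {z | z.re < A} := fun z hz =>
  (H.hasDerivAt k z hz).differentiableAt.differentiableWithinAt

lemma analyticAt (H : IsMomentFamily M m A) (k : ℕ) {z : ℂ} (hz : z.re < A) :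
    AnalyticAt ℂ (M k) z :=
  (H.differentiableOn k).analyticAt ((isOpen_re_lt A).mem_nhds hz)

lemma zero_eq_one (H : IsMomentFamily M m A) : M 0 0 = 1 := by
  have := H.ofReal 0 0 H.pos_bound
  rw [H.zero] at this
  simpa using this

end IsMomentFamily

namespace IsRetrialModel

variable {M : ℕ → ℂ → ℂ} {m : ℕ → ℝ → ℝ} {A a b u₀ us : ℝ}

lemma zMap_ofReal (H : IsRetrialModel M m A a b u₀ us) {x : ℝ} (hx : x < A) :
    zMap M a b x = zMapReal m a b x := by
  simp [zMap, zMapReal, H.ofReal 0 x hx]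

lemma mul_moment_lt_one (H : IsRetrialModel M m A a b u₀ us) {c : ℝ} (hc : c < u₀) :
    a * m 1 c < 1 := by
  rw [← H.crit]
  exact mul_lt_mul_of_pos_left (H.strictMonoOn 1 (hc.trans H.u₀_lt) H.u₀_lt hc) H.ha

lemma hasDerivAt_zMap (H : IsRetrialModel M m A a b u₀ us) {u : ℂ} (hu : u.re < A) :
    HasDerivAt (zMap M a b) ((1 - a * M 1 u) / b) u := by
  have := (((hasDerivAt_id u).add (((H.hasDerivAt 0 u hu).const_sub 1).const_mul (a : ℂ))).div_const
    (b : ℂ)).const_add 1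
  refine this.congr_deriv ?_
  ring

lemma hasDerivAt_zMapReal (H : IsRetrialModel M m A a b u₀ us) {x : ℝ} (hx : x < A) :
    HasDerivAt (zMapReal m a b) ((1 - a * m 1 x) / b) x := by
  have := (((hasDerivAt_id x).add (((H.hasDerivAt_real 0 hx).const_sub 1).const_mul a)).div_const
    b).const_add 1
  refine this.congr_deriv ?_
  ring

lemma strictMonoOn_zMapReal (H : IsRetrialModel M m A a b u₀ us) :
    StrictMonoOn (zMapReal m a b) (Iic u₀) := by
  refine strictMonoOn_of_deriv_pos (convex_Iic u₀) (fun x hx => ?_) fun x hx => ?_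
  · exact (H.hasDerivAt_zMapReal (lt_of_le_of_lt hx H.u₀_lt)).continuousAt.continuousWithinAt
  · rw [interior_Iic] at hx
    rw [(H.hasDerivAt_zMapReal (lt_trans hx H.u₀_lt)).deriv]
    exact div_pos (by linarith [H.mul_moment_lt_one hx]) H.hb

lemma zMapReal_zero (H : IsRetrialModel M m A a b u₀ us) : zMapReal m a b 0 = 1 := by
  simp [zMapReal, H.zero]

lemma zMap_sub_zMap (H : IsRetrialModel M m A a b u₀ us) (u v : ℂ) :
    b * (zMap M a b u - zMap M a b v) = (u - v) - a * (M 0 u - M 0 v) := by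
  have : (b : ℂ) ≠ 0 := by exact_mod_cast H.hb.ne'
  simp only [zMap]; field_simp; ring

/-- `b Z` is the identity minus `a M₀`, and `a M₀` has Lipschitz constant `a m₁(c)` on `Re u ≤ c`.
For `c < u₀` this constant is below `1`, which yields injectivity and continuity of the inverse. -/
lemma antilipschitz_zMap (H : IsRetrialModel M m A a b u₀ us) {c : ℝ} (hc : c < A) {u v : ℂ}
    (hu : u.re ≤ c) (hv : v.re ≤ c) :
    (1 - a * m 1 c) * ‖u - v‖ ≤ b * ‖zMap M a b u - zMap M a b v‖ := by
  have h1 : ‖(b : ℂ) * (zMap M a b u - zMap M a b v)‖ = b * ‖zMap M a b u - zMap M a b v‖ := by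
    rw [norm_mul, Complex.norm_real, norm_of_nonneg H.hb.le]
  rw [← h1, H.zMap_sub_zMap]
  have h2 := norm_sub_norm_le (u - v) (a * (M 0 u - M 0 v))
  rw [norm_mul, Complex.norm_real, norm_of_nonneg H.ha.le] at h2
  have h3 := mul_le_mul_of_nonneg_left (H.norm_sub_le 0 hc hu hv) H.ha.le
  simp only [zero_add] at h3
  linarith

lemma injOn_zMap (H : IsRetrialModel M m A a b u₀ us) :
    InjOn (zMap M a b) {u | u.re < u₀} := by
  intro u hu v hv huv
  have hlt : max u.re v.re < u₀ := max_lt hu hv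
  have h1 := H.antilipschitz_zMap (hlt.trans H.u₀_lt) (le_max_left u.re v.re) (le_max_right _ _)
  rw [huv, sub_self, norm_zero, mul_zero] at h1
  have h2 := H.mul_moment_lt_one hlt
  have h3 : ‖u - v‖ ≤ 0 := by
    by_contra! h
    nlinarith
  exact sub_eq_zero.1 (norm_le_zero_iff.1 h3)

/-- `Z(u) = z` is the fixed-point equation `u = b (z - 1) + a (M₀(u) - 1)`, solved by Banach's
theorem on `Re u ≤ c`. The bound on `Re z` is exactly what makes this half-plane invariant. -/
lemma exists_zMap_eq (H : IsRetrialModel M m A a b u₀ us) {c : ℝ} (hc : c < u₀) {z : ℂ}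
    (hz : z.re ≤ zMapReal m a b c) : ∃ u : ℂ, u.re ≤ c ∧ zMap M a b u = z := by
  have hcA := hc.trans H.u₀_lt
  set T : ℂ → ℂ := fun u => b * (z - 1) + a * (M 0 u - 1) with hT
  have hmaps : MapsTo T {u | u.re ≤ c} {u | u.re ≤ c} := by
    intro u hu
    have h1 : (M 0 u).re ≤ m 0 c := (Complex.re_le_norm _).trans
      ((H.norm_le 0 u (lt_of_le_of_lt hu hcA)).trans (H.monotone_le 0 hu hcA))
    have h2 : b * (z.re - 1) ≤ c + a * (1 - m 0 c) := by
      rw [← le_div_iff₀' H.hb]; simp only [zMapReal] at hz; linarith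
    have h3 : (T u).re = b * (z.re - 1) + a * ((M 0 u).re - 1) := by simp [hT]
    show (T u).re ≤ c
    rw [h3]
    nlinarith [mul_le_mul_of_nonneg_left h1 H.ha.le]
  have hK0 : 0 ≤ a * m 1 c := mul_nonneg H.ha.le (H.pos 1 c hcA).le
  have hcontr : ContractingWith (a * m 1 c).toNNReal (hmaps.restrict T _ _) := by
    refine ⟨by rw [Real.toNNReal_lt_one]; exact H.mul_moment_lt_one hc, ?_⟩
    refine LipschitzWith.of_dist_le_mul fun u v => ?_
    simp only [Subtype.dist_eq, MapsTo.val_restrict_apply, dist_eq_norm,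
      Real.coe_toNNReal _ hK0]
    have h1 : T u - T v = a * (M 0 u - M 0 v) := by simp only [hT]; ring
    rw [h1, norm_mul, Complex.norm_real, norm_of_nonneg H.ha.le, mul_assoc]
    exact mul_le_mul_of_nonneg_left (H.norm_sub_le 0 hcA u.2 v.2) H.ha.le
  have hclosed : IsClosed {u : ℂ | u.re ≤ c} := isClosed_le Complex.continuous_re continuous_const
  obtain ⟨u, hu, hfix, -⟩ := hcontr.exists_fixedPoint' hclosed.isComplete hmaps
    (x := (c : ℂ)) (by simp) (edist_ne_top _ _)
  refine ⟨u, hu, ?_⟩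
  have hbne : (b : ℂ) ≠ 0 := by exact_mod_cast H.hb.ne'
  have h4 : T u = u := hfix
  have h5 : zMap M a b u = 1 + (T u + a * (1 - M 0 u)) / b := by rw [h4]; rfl
  rw [h5]; simp only [hT]; field_simp; ring

lemma exists_lt_le_zMapReal (H : IsRetrialModel M m A a b u₀ us) {c : ℝ} (hc : c ≤ u₀) {r : ℝ}
    (hr : r < zMapReal m a b c) : ∃ c' < c, r < zMapReal m a b c' := by
  have hcont := (H.hasDerivAt_zMapReal (hc.trans_lt H.u₀_lt)).continuousAt
  have h1 := (hcont.eventually (lt_mem_nhds hr)).filter_mono (nhdsWithin_le_nhds (s := Iio c))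
  obtain ⟨c', h2, h3⟩ := (h1.and self_mem_nhdsWithin).exists
  exact ⟨c', h3, h2⟩

lemma uInv_spec (H : IsRetrialModel M m A a b u₀ us) {z : ℂ} (hz : z.re < zMapReal m a b u₀) :
    (uInv M a b u₀ z).re < u₀ ∧ zMap M a b (uInv M a b u₀ z) = z := by
  obtain ⟨c, hc, hcz⟩ := H.exists_lt_le_zMapReal le_rfl hz
  obtain ⟨u, hu, huz⟩ := H.exists_zMap_eq hc hcz.le
  have hu' : ∃ u ∈ {u : ℂ | u.re < u₀}, zMap M a b u = z := ⟨u, lt_of_le_of_lt hu hc, huz⟩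
  exact Function.invFunOn_pos hu'

lemma uInv_eq (H : IsRetrialModel M m A a b u₀ us) {u z : ℂ} (hu : u.re < u₀)
    (hz : zMap M a b u = z) : uInv M a b u₀ z = u := by
  have hu' : ∃ u ∈ {u : ℂ | u.re < u₀}, zMap M a b u = z := ⟨u, hu, hz⟩
  have := Function.invFunOn_pos hu'
  exact H.injOn_zMap this.1 hu (this.2.trans hz.symm)

lemma uInv_re_le (H : IsRetrialModel M m A a b u₀ us) {c : ℝ} (hc : c < u₀) {z : ℂ}
    (hz : z.re ≤ zMapReal m a b c) : (uInv M a b u₀ z).re ≤ c := by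
  obtain ⟨u, hu, huz⟩ := H.exists_zMap_eq hc hz
  rwa [H.uInv_eq (lt_of_le_of_lt hu hc) huz]

lemma uInv_re_lt (H : IsRetrialModel M m A a b u₀ us) {c : ℝ} (hc : c ≤ u₀) {z : ℂ}
    (hz : z.re < zMapReal m a b c) : (uInv M a b u₀ z).re < c := by
  obtain ⟨c', hc', hz'⟩ := H.exists_lt_le_zMapReal hc hz
  exact (H.uInv_re_le (hc'.trans_le hc) hz'.le).trans_lt hc'

lemma uInv_ofReal (H : IsRetrialModel M m A a b u₀ us) {x : ℝ} (hx : x < u₀) :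
    uInv M a b u₀ (zMapReal m a b x) = x :=
  H.uInv_eq (by simpa using hx) (H.zMap_ofReal (hx.trans H.u₀_lt))

/-- Every real number below the critical value is a value of `zMapReal` below `u₀`. -/
lemma exists_zMapReal_eq (H : IsRetrialModel M m A a b u₀ us) {x : ℝ}
    (hx : x < zMapReal m a b u₀) : ∃ y < u₀, zMapReal m a b y = x := by
  -- As `m₀ > 0`, `Z(y) < 1 + (y + a) / b`, which is at most `x` for this `y`; the intermediate
  -- value theorem applies between `y` and `u₀`.
  set y := min 0 (b * (x - 1) - a)
  have hy0 : y ≤ 0 := min_le_left _ _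
  have hyu : y < u₀ := hy0.trans_lt H.u₀_pos
  have hle : zMapReal m a b y ≤ x := by
    have h1 := H.pos 0 y (hyu.trans H.u₀_lt)
    have h2 : y ≤ b * (x - 1) - a := min_le_right _ _
    have h3 : (y + a * (1 - m 0 y)) / b ≤ x - 1 := by
      rw [div_le_iff₀' H.hb]; nlinarith [H.ha]
    simp only [zMapReal]; linarith
  obtain ⟨w, hw, hwx⟩ := intermediate_value_Ico hyu.le (f := zMapReal m a b)
    (fun w hw => (H.hasDerivAt_zMapReal
      (lt_of_le_of_lt hw.2 H.u₀_lt)).continuousAt.continuousWithinAt) ⟨hle, hx⟩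
  exact ⟨w, hw.2, hwx⟩

lemma continuousAt_uInv (H : IsRetrialModel M m A a b u₀ us) {z : ℂ}
    (hz : z.re < zMapReal m a b u₀) : ContinuousAt (uInv M a b u₀) z := by
  obtain ⟨c, hc, hcz⟩ := H.exists_lt_le_zMapReal le_rfl hz
  have hK : 0 < 1 - a * m 1 c := by linarith [H.mul_moment_lt_one hc]
  have hev : ∀ᶠ w in 𝓝 z, dist (uInv M a b u₀ w) (uInv M a b u₀ z) ≤
      b / (1 - a * m 1 c) * dist w z := by
    filter_upwards [(isOpen_re_lt _).mem_nhds hcz] with w hw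
    have hw : w.re < zMapReal m a b c := hw
    have h1 := H.antilipschitz_zMap (hc.trans H.u₀_lt) (H.uInv_re_le hc hw.le)
      (H.uInv_re_le hc hcz.le)
    have hlt := H.strictMonoOn_zMapReal (mem_Iic.2 hc.le) (mem_Iic.2 le_rfl) hc
    rw [(H.uInv_spec (hw.trans hlt)).2, (H.uInv_spec hz).2] at h1
    rw [dist_eq_norm, dist_eq_norm, div_mul_eq_mul_div, le_div_iff₀ hK]
    linarith
  rw [ContinuousAt, tendsto_iff_dist_tendsto_zero]
  refine squeeze_zero' (.of_forall fun _ => dist_nonneg) hev ?_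
  have : Tendsto (fun w => b / (1 - a * m 1 c) * dist w z) (𝓝 z)
      (𝓝 (b / (1 - a * m 1 c) * dist z z)) := Continuous.tendsto (by fun_prop) z
  simpa using this

/-- `|a M₁(u)| ≤ a m₁(Re u) < a m₁(u₀) = 1`. -/
lemma one_sub_moment_ne_zero (H : IsRetrialModel M m A a b u₀ us) {u : ℂ} (hu : u.re < u₀) :
    1 - a * M 1 u ≠ 0 := by
  intro h
  have h1 : ‖(a : ℂ) * M 1 u‖ = 1 := by rw [← sub_eq_zero.1 h, norm_one]
  rw [norm_mul, Complex.norm_real, norm_of_nonneg H.ha.le] at h1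
  have h2 := mul_le_mul_of_nonneg_left (H.norm_le 1 u (hu.trans H.u₀_lt)) H.ha.le
  linarith [H.mul_moment_lt_one hu]

lemma hasDerivAt_uInv (H : IsRetrialModel M m A a b u₀ us) {z : ℂ}
    (hz : z.re < zMapReal m a b u₀) :
    HasDerivAt (uInv M a b u₀) (b / (1 - a * M 1 (uInv M a b u₀ z))) z := by
  have hs := H.uInv_spec hz
  have hbne : (b : ℂ) ≠ 0 := by exact_mod_cast H.hb.ne'
  have h1 := HasDerivAt.of_local_left_inverse (H.continuousAt_uInv hz)
    (H.hasDerivAt_zMap (hs.1.trans H.u₀_lt))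
    (div_ne_zero (H.one_sub_moment_ne_zero hs.1) hbne) ?_
  · rwa [inv_div] at h1
  · filter_upwards [(isOpen_re_lt _).mem_nhds hz] with w hw using (H.uInv_spec hw).2

lemma differentiableOn_uInv (H : IsRetrialModel M m A a b u₀ us) :
    DifferentiableOn ℂ (uInv M a b u₀) {z | z.re < zMapReal m a b u₀} := fun _ hz =>
  (H.hasDerivAt_uInv hz).differentiableAt.differentiableWithinAt

lemma one_lt_zMapReal (H : IsRetrialModel M m A a b u₀ us) : 1 < zMapReal m a b u₀ := by
  rw [← H.zMapReal_zero]
  exact H.strictMonoOn_zMapReal (mem_Iic.2 H.u₀_pos.le) (mem_Iic.2 le_rfl) H.u₀_pos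

end IsRetrialModel

/-! ### The complex square root -/

lemma cpow_half_sq (z : ℂ) : (z ^ (1 / 2 : ℂ)) ^ 2 = z := by
  rw [one_div]; exact Complex.cpow_ofNat_inv_pow z 2

lemma norm_cpow_half (z : ℂ) : ‖z ^ (1 / 2 : ℂ)‖ ^ 2 = ‖z‖ := by
  rw [← norm_pow, cpow_half_sq]

/-- Halving an argument in `(-π, π)` puts it where the cosine is positive. This positivity later
singles out the branch of the inverse. -/
lemma re_cpow_half_pos {z : ℂ} (hz : z ∈ Complex.slitPlane) : 0 < (z ^ (1 / 2 : ℂ)).re := by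
  rw [Complex.cpow_def_of_ne_zero (Complex.slitPlane_ne_zero hz), Complex.exp_re]
  have harg := Complex.mem_slitPlane_iff_arg.1 hz
  have him : (Complex.log z * (1 / 2)).im = z.arg / 2 := by
    have : (1 / 2 : ℂ) = ((1 / 2 : ℝ) : ℂ) := by norm_num
    rw [this, Complex.im_mul_ofReal, Complex.log_im]; ring
  rw [him]
  refine mul_pos (Real.exp_pos _) (Real.cos_pos_of_mem_Ioo ⟨?_, ?_⟩)
  · linarith [Complex.neg_pi_lt_arg z]
  · have := lt_of_le_of_ne (Complex.arg_le_pi z) harg.1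
    linarith

lemma tendsto_cpow_half_sub (R : ℂ) :
    Tendsto (fun z : ℂ => (R - z) ^ (1 / 2 : ℂ)) (𝓝 R) (𝓝 0) := by
  rw [tendsto_zero_iff_norm_tendsto_zero]
  have h1 : ∀ z : ℂ, ‖(R - z) ^ (1 / 2 : ℂ)‖ = √‖R - z‖ := fun z => by
    rw [← norm_cpow_half (R - z), Real.sqrt_sq (norm_nonneg _)]
  simp only [h1]
  have : Tendsto (fun z : ℂ => √‖R - z‖) (𝓝 R) (𝓝 √‖R - R‖) := Continuous.tendsto (by fun_prop) R
  simpa using this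

lemma hasDerivAt_cpow_half_sub {R z : ℂ} (hz : R - z ∈ Complex.slitPlane) :
    HasDerivAt (fun z : ℂ => (R - z) ^ (1 / 2 : ℂ)) (-1 / (2 * (R - z) ^ (1 / 2 : ℂ))) z := by
  have h1 := ((hasDerivAt_id z).const_sub R).cpow_const (c := (1 / 2 : ℂ)) hz
  refine h1.congr_deriv ?_
  have hne : R - z ≠ 0 := Complex.slitPlane_ne_zero hz
  have h2 : (R - z) ^ (1 / 2 - 1 : ℂ) = ((R - z) ^ (1 / 2 : ℂ))⁻¹ := by
    rw [← Complex.cpow_neg]; norm_num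
  simp only [id, h2]
  field_simp

/-! ### Local inversion at a quadratic critical point -/

lemma analyticAt_dslope {f : ℂ → ℂ} {c : ℂ} (hf : AnalyticAt ℂ f c) :
    AnalyticAt ℂ (dslope f c) c := by
  obtain ⟨s, hs, hd⟩ := hf.exists_mem_nhds_analyticOnNhd
  exact ((Complex.differentiableOn_dslope hs).2 hd.differentiableOn).analyticAt hs

/-- Near a nondegenerate critical point, the solutions of `f u = r` are an analytic function of
the square root of `f c - r`. -/
lemma exists_analyticAt_inverse_sqrt {f f' : ℂ → ℂ} {c : ℂ} {g : ℝ}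
    (hf : ∀ᶠ u in 𝓝 c, HasDerivAt f (f' u) u) (hc : f' c = 0)
    (hf' : HasDerivAt f' (-2 * g) c) (hg : 0 < g) :
    ∃ ψ : ℂ → ℂ, AnalyticAt ℂ ψ 0 ∧ ψ 0 = c ∧ HasDerivAt ψ (-1 / (√g : ℂ)) 0 ∧
      ∀ᶠ t in 𝓝 0, f (ψ t) = f c - t ^ 2 := by
  have hfa : AnalyticAt ℂ f c := Complex.analyticAt_iff_eventually_differentiableAt.2
    (hf.mono fun u hu => hu.differentiableAt)
  have hq₁ := analyticAt_dslope hfa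
  set q₁ := dslope f c with hq₁def
  have hq := analyticAt_dslope hq₁
  set q := dslope q₁ c with hqdef
  have hq₁c : q₁ c = 0 := by rw [hq₁def, dslope_same, hf.self_of_nhds.deriv, hc]
  -- Dividing twice by `u - c` gives `f = f(c) + (u - c)² q`; the value `q(c) = -g` follows by
  -- differentiating this and comparing with `f'`.
  have hfq : ∀ u, f u = f c + (u - c) ^ 2 * q u := fun u => by
    have h1 := sub_smul_dslope f c u
    have h2 := sub_smul_dslope q₁ c u
    simp only [smul_eq_mul] at h1 h2
    rw [hq₁c, sub_zero] at h2
    linear_combination -h1 - (u - c) * h2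
  have hqc : q c = -g := by
    have h1 : f' =ᶠ[𝓝 c] fun u => 2 * (u - c) * q u + (u - c) ^ 2 * deriv q u := by
      filter_upwards [hf, hq.eventually_analyticAt] with u hu hqu
      have h2 : HasDerivAt f (2 * (u - c) * q u + (u - c) ^ 2 * deriv q u) u := by
        rw [funext hfq]
        refine ((((hasDerivAt_id u).sub_const c).pow 2).mul
          hqu.differentiableAt.hasDerivAt).const_add (f c) |>.congr_deriv ?_
        simp
      exact hu.unique h2
    have h3 : HasDerivAt (fun u => 2 * (u - c) * q u + (u - c) ^ 2 * deriv q u) (2 * q c) c := by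
      refine (((((hasDerivAt_id c).sub_const c).const_mul 2).mul
        hq.differentiableAt.hasDerivAt).add ((((hasDerivAt_id c).sub_const c).pow 2).mul
        hq.deriv.differentiableAt.hasDerivAt)).congr_deriv ?_
      simp
    have h4 := (hf'.congr_of_eventuallyEq h1.symm).unique h3
    linear_combination -h4 / 2
  have hslit : -q c ∈ Complex.slitPlane := by
    rw [hqc, neg_neg]; exact Complex.ofReal_mem_slitPlane.2 hg
  -- An analytic square root of `f(c) - f(u)`, with the sign for which `k'(c) = -√g`. Its local
  -- inverse is `ψ`, so small positive `t` lead to the left of `c`.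
  set k : ℂ → ℂ := fun u => (c - u) * (-q u) ^ (1 / 2 : ℂ) with hk
  have hka : AnalyticAt ℂ k c :=
    (analyticAt_const.sub analyticAt_id).mul (hq.neg.cpow analyticAt_const hslit)
  have hkc : k c = 0 := by simp [hk]
  have hsq : (-q c) ^ (1 / 2 : ℂ) = (√g : ℂ) := by
    rw [hqc, neg_neg, Real.sqrt_eq_rpow, Complex.ofReal_cpow hg.le]; norm_num
  have hkd : HasDerivAt k (-(√g : ℂ)) c := by
    have h1 : DifferentiableAt ℂ (fun u => (-q u) ^ (1 / 2 : ℂ)) c :=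
      (hq.neg.cpow analyticAt_const hslit).differentiableAt
    refine (((hasDerivAt_id c).const_sub c).mul h1.hasDerivAt).congr_deriv ?_
    simp only [hsq, id, sub_self, zero_mul, add_zero]; ring
  have hgne : (√g : ℂ) ≠ 0 := by exact_mod_cast (Real.sqrt_pos.2 hg).ne'
  have hkd' : deriv k c ≠ 0 := by rw [hkd.deriv]; exact neg_ne_zero.2 hgne
  set ψ := hka.hasStrictDerivAt.localInverse _ _ _ hkd' with hψ
  have hψa : AnalyticAt ℂ ψ 0 := hkc ▸ hka.analyticAt_localInverse hkd'
  have hψ0 : ψ 0 = c := by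
    rw [← hkc]; exact HasStrictFDerivAt.localInverse_apply_image ..
  have hright : ∀ᶠ t in 𝓝 (0 : ℂ), k (ψ t) = t := by
    rw [← hkc]; exact HasStrictDerivAt.eventually_right_inverse ..
  refine ⟨ψ, hψa, hψ0, ?_, ?_⟩
  · have h1 : HasDerivAt (fun t => k (ψ t)) (deriv k c * deriv ψ 0) 0 :=
      HasDerivAt.comp (h₂ := k) 0 (by rw [hψ0]; exact hka.differentiableAt.hasDerivAt)
        hψa.differentiableAt.hasDerivAt
    have h2 := h1.unique ((hasDerivAt_id (0 : ℂ)).congr_of_eventuallyEq hright)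
    rw [hkd.deriv] at h2
    have h3 : deriv ψ 0 = -1 / (√g : ℂ) := by
      rw [eq_div_iff hgne]; linear_combination -h2
    rw [← h3]; exact hψa.differentiableAt.hasDerivAt
  · filter_upwards [hright] with t ht
    rw [hfq (ψ t)]
    have h1 : k (ψ t) ^ 2 = (c - ψ t) ^ 2 * (-q (ψ t)) := by
      rw [hk]; simp only [mul_pow, cpow_half_sq]
    rw [ht] at h1
    linear_combination h1

namespace IsRetrialModel

variable {M : ℕ → ℂ → ℂ} {m : ℕ → ℝ → ℝ} {A a b u₀ us : ℝ}

/-- The parametrization of the inverse function near the critical value by the square root of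
the distance to it. -/
lemma exists_sqrt_param (H : IsRetrialModel M m A a b u₀ us) :
    ∃ ψ : ℂ → ℂ, AnalyticAt ℂ ψ 0 ∧ ψ 0 = u₀ ∧
      HasDerivAt ψ (-1 / (√(a * m 2 u₀ / (2 * b)) : ℂ)) 0 ∧
      (∀ᶠ t in 𝓝 0, zMap M a b (ψ t) = zMapReal m a b u₀ - t ^ 2) ∧
      ∀ᶠ z in 𝓝[{z : ℂ | z.re < zMapReal m a b u₀}] (zMapReal m a b u₀ : ℂ),
        uInv M a b u₀ z = ψ ((zMapReal m a b u₀ - z) ^ (1 / 2 : ℂ)) := by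
  have hu₀ : ((u₀ : ℂ)).re < A := by simpa using H.u₀_lt
  have hm2 := H.pos 2 u₀ H.u₀_lt
  have ha := H.ha
  have hb := H.hb
  set g := a * m 2 u₀ / (2 * b) with hgdef
  have hg : 0 < g := by positivity
  have hbne : (b : ℂ) ≠ 0 := by exact_mod_cast hb.ne'
  obtain ⟨ψ, hψa, hψ0, hψd, hψ⟩ := exists_analyticAt_inverse_sqrt (f := zMap M a b)
    (f' := fun u => (1 - a * M 1 u) / b) (c := (u₀ : ℂ)) (g := g)
    (((isOpen_re_lt A).eventually_mem hu₀).mono fun u hu => H.hasDerivAt_zMap hu)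
    (by
      have h1 : (a : ℂ) * m 1 u₀ = 1 := by exact_mod_cast H.crit
      rw [H.ofReal 1 u₀ H.u₀_lt, h1]; simp)
    (by
      refine ((((H.hasDerivAt 1 u₀ hu₀).const_mul (a : ℂ)).const_sub 1).div_const
        (b : ℂ)).congr_deriv ?_
      rw [H.ofReal 2 u₀ H.u₀_lt, hgdef]; push_cast; field_simp) hg
  rw [H.zMap_ofReal H.u₀_lt] at hψ
  refine ⟨ψ, hψa, hψ0, hψd, hψ, ?_⟩
  set R := zMapReal m a b u₀
  have hsg : 0 < √g := Real.sqrt_pos.2 hg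
  have hlin := hasDerivAt_iff_isLittleO.1 hψd
  -- The error of the linear approximation is kept below half the size of the linear term.
  have hlin' : ∀ᶠ t in 𝓝 (0 : ℂ), ‖ψ t - u₀ + t / √g‖ ≤ 1 / (2 * √g) * ‖t‖ := by
    filter_upwards [hlin.def (show 0 < 1 / (2 * √g) by positivity)] with t ht
    simp only [sub_zero, hψ0, smul_eq_mul] at ht
    refine le_of_eq_of_le ?_ ht
    congr 1; ring
  have ht := tendsto_cpow_half_sub (R : ℂ)
  filter_upwards [(ht.eventually hψ).filter_mono nhdsWithin_le_nhds,
    (ht.eventually hlin').filter_mono nhdsWithin_le_nhds, self_mem_nhdsWithin] with z h1 h2 h3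
  have h3 : z.re < R := h3
  have hre : 0 < (R - z : ℂ).re := by simpa using h3
  have hslit : (R - z : ℂ) ∈ Complex.slitPlane := Or.inl hre
  have hpos := re_cpow_half_pos hslit
  have hsq := cpow_half_sq (R - z : ℂ)
  set t := (R - z : ℂ) ^ (1 / 2 : ℂ)
  refine H.uInv_eq ?_ (by rw [h1, hsq]; ring)
  have h4 : (ψ t - u₀ + t / √g).re ≤ 1 / (2 * √g) * ‖t‖ := (Complex.re_le_norm _).trans h2
  have h5 : (ψ t - u₀ + t / √g).re = (ψ t).re - u₀ + t.re / √g := by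
    simp [Complex.div_ofReal_re]
  rw [h5] at h4
  -- Since `Re t² = Re (R - z) > 0`, `|t|² < 2 (Re t)²`. Hence the linear term `-Re t / √g`
  -- outweighs the error, `Re ψ(t) < u₀`, and `ψ(t)` is the preimage selected by `uInv`.
  have h6 : ‖t‖ < 2 * t.re := by
    have h7 : (t ^ 2).re = t.re ^ 2 - t.im ^ 2 := by rw [sq, Complex.mul_re]; ring
    rw [hsq] at h7
    have h8 : ‖t‖ ^ 2 = t.re ^ 2 + t.im ^ 2 := by
      rw [← Complex.normSq_eq_norm_sq, Complex.normSq_apply]; ring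
    nlinarith [norm_nonneg t]
  have h9 : 1 / (2 * √g) * ‖t‖ < t.re / √g := by
    rw [div_mul_eq_mul_div, div_lt_div_iff₀ (by positivity) hsg]
    nlinarith
  linarith

lemma tendsto_uInv (H : IsRetrialModel M m A a b u₀ us) :
    Tendsto (uInv M a b u₀) (𝓝[{z : ℂ | z.re < zMapReal m a b u₀}] (zMapReal m a b u₀ : ℂ))
      (𝓝 u₀) := by
  obtain ⟨ψ, hψa, hψ0, -, -, hψ⟩ := H.exists_sqrt_param
  have h1 : Tendsto ψ (𝓝 0) (𝓝 u₀) := hψ0 ▸ hψa.continuousAt.tendsto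
  exact (h1.comp ((tendsto_cpow_half_sub _).mono_left nhdsWithin_le_nhds)).congr'
    (hψ.mono fun z hz => hz.symm)

end IsRetrialModel

/-! ### Nonnegativity of the Taylor coefficients of `h` -/

/-- The cone of functions generated by the moments and the derivative of `uInv`, as a function of
`uInv`. -/
inductive IsPositiveFun (M : ℕ → ℂ → ℂ) (a b : ℝ) : (ℂ → ℂ) → Prop
  | moment (k : ℕ) : IsPositiveFun M a b (M k)
  | resolvent : IsPositiveFun M a b fun u => b / (1 - a * M 1 u)
  | smul (r : ℝ) (hr : 0 ≤ r) {F : ℂ → ℂ} (hF : IsPositiveFun M a b F) :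
      IsPositiveFun M a b fun u => r * F u
  | add {F G : ℂ → ℂ} (hF : IsPositiveFun M a b F) (hG : IsPositiveFun M a b G) :
      IsPositiveFun M a b fun u => F u + G u
  | mul {F G : ℂ → ℂ} (hF : IsPositiveFun M a b F) (hG : IsPositiveFun M a b G) :
      IsPositiveFun M a b fun u => F u * G u

namespace IsRetrialModel

variable {M : ℕ → ℂ → ℂ} {m : ℕ → ℝ → ℝ} {A a b u₀ us : ℝ}

lemma exists_nonneg_of_isPositiveFun (H : IsRetrialModel M m A a b u₀ us) {F : ℂ → ℂ}
    (hF : IsPositiveFun M a b F) {x : ℝ} (hx : x < u₀) : ∃ r : ℝ, 0 ≤ r ∧ F x = r := by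
  induction hF with
  | moment k => exact ⟨m k x, (H.pos k x (hx.trans H.u₀_lt)).le, H.ofReal k x (hx.trans H.u₀_lt)⟩
  | resolvent =>
    refine ⟨b / (1 - a * m 1 x), div_nonneg H.hb.le ?_, ?_⟩
    · linarith [H.mul_moment_lt_one hx]
    · simp [H.ofReal 1 x (hx.trans H.u₀_lt)]
  | smul r hr _ ih =>
    obtain ⟨s, hs, h⟩ := ih
    exact ⟨r * s, mul_nonneg hr hs, by simp [h]⟩
  | add _ _ ih₁ ih₂ =>
    obtain ⟨r, hr, h₁⟩ := ih₁
    obtain ⟨s, hs, h₂⟩ := ih₂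
    exact ⟨r + s, add_nonneg hr hs, by simp [h₁, h₂]⟩
  | mul _ _ ih₁ ih₂ =>
    obtain ⟨r, hr, h₁⟩ := ih₁
    obtain ⟨s, hs, h₂⟩ := ih₂
    exact ⟨r * s, mul_nonneg hr hs, by simp [h₁, h₂]⟩

/-- The only generator that needs work is the resolvent `r = b / (1 - a M₁)`, for which `r' = (a /
b) r² M₂`. -/
lemma exists_hasDerivAt_of_isPositiveFun (H : IsRetrialModel M m A a b u₀ us) {F : ℂ → ℂ}
    (hF : IsPositiveFun M a b F) :
    ∃ F', IsPositiveFun M a b F' ∧ ∀ u : ℂ, u.re < u₀ → HasDerivAt F (F' u) u := by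
  induction hF with
  | moment k => exact ⟨_, .moment (k + 1), fun u hu => H.hasDerivAt k u (hu.trans H.u₀_lt)⟩
  | resolvent =>
    refine ⟨_, .smul (a / b) (div_nonneg H.ha.le H.hb.le)
      (.mul (.mul .resolvent .resolvent) (.moment 2)), fun u hu => ?_⟩
    have hne := H.one_sub_moment_ne_zero hu
    have hbne : (b : ℂ) ≠ 0 := by exact_mod_cast H.hb.ne'
    refine ((hasDerivAt_const u (b : ℂ)).div
      (((H.hasDerivAt 1 u (hu.trans H.u₀_lt)).const_mul (a : ℂ)).const_sub 1) hne).congr_deriv ?_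
    push_cast
    field_simp
    ring
  | smul r hr _ ih =>
    obtain ⟨F', hF', h⟩ := ih
    exact ⟨_, .smul r hr hF', fun u hu => (h u hu).const_mul _⟩
  | add _ _ ih₁ ih₂ =>
    obtain ⟨F', hF', h₁⟩ := ih₁
    obtain ⟨G', hG', h₂⟩ := ih₂
    exact ⟨_, .add hF' hG', fun u hu => (h₁ u hu).add (h₂ u hu)⟩
  | mul hF hG ih₁ ih₂ =>
    obtain ⟨F', hF', h₁⟩ := ih₁
    obtain ⟨G', hG', h₂⟩ := ih₂
    exact ⟨_, .add (.mul hF' hG) (.mul hF hG'), fun u hu => (h₁ u hu).mul (h₂ u hu)⟩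

/-- Each differentiation in `z` differentiates within the cone and multiplies by the derivative of
`uInv`, which is the resolvent evaluated at `uInv`. -/
lemma exists_iteratedDeriv_comp_uInv (H : IsRetrialModel M m A a b u₀ us) {F : ℂ → ℂ}
    (hF : IsPositiveFun M a b F) (n : ℕ) :
    ∃ G, IsPositiveFun M a b G ∧ ∀ z : ℂ, z.re < zMapReal m a b u₀ →
      iteratedDeriv n (fun z => F (uInv M a b u₀ z)) z = G (uInv M a b u₀ z) := by
  induction n with
  | zero => exact ⟨F, hF, fun z _ => by simp⟩
  | succ n ih =>
    obtain ⟨G, hG, h⟩ := ih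
    obtain ⟨G', hG', h'⟩ := H.exists_hasDerivAt_of_isPositiveFun hG
    refine ⟨_, .mul hG' .resolvent, fun z hz => ?_⟩
    have hev : iteratedDeriv n (fun z => F (uInv M a b u₀ z)) =ᶠ[𝓝 z]
        fun z => G (uInv M a b u₀ z) := by
      filter_upwards [(isOpen_re_lt _).mem_nhds hz] with w hw using h w hw
    rw [iteratedDeriv_succ, hev.deriv_eq]
    exact ((h' _ (H.uInv_spec hz).1).comp z (H.hasDerivAt_uInv hz)).deriv

/-- The Taylor coefficients at `0` of the continuation `M 0 ∘ uInv` of `h` are nonnegative. -/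
lemma exists_taylor_coeff (H : IsRetrialModel M m A a b u₀ us) :
    ∃ c : ℕ → ℝ, (∀ n, 0 ≤ c n) ∧
      ∀ n, iteratedDeriv n (fun z => M 0 (uInv M a b u₀ z)) 0 / (n.factorial : ℂ) = c n := by
  have hR : (0 : ℝ) < zMapReal m a b u₀ := one_pos.trans H.one_lt_zMapReal
  have key : ∀ n, ∃ r : ℝ, 0 ≤ r ∧
      iteratedDeriv n (fun z => M 0 (uInv M a b u₀ z)) 0 / (n.factorial : ℂ) = r := fun n => by
    obtain ⟨G, hG, h⟩ := H.exists_iteratedDeriv_comp_uInv (.moment 0) n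
    -- The expansion point `z = 0` corresponds to a real `y < u₀`, where every member of the cone is
    -- nonnegative.
    obtain ⟨y, hy, hy0⟩ := H.exists_zMapReal_eq hR
    have h1 := H.uInv_ofReal hy
    rw [hy0, Complex.ofReal_zero] at h1
    obtain ⟨r, hr, h2⟩ := H.exists_nonneg_of_isPositiveFun hG hy
    refine ⟨r / n.factorial, by positivity, ?_⟩
    rw [h 0 (by simpa using hR), h1, h2]
    push_cast; rfl
  choose c hc hc' using key
  exact ⟨c, hc, hc'⟩

lemma differentiableOn_moment_uInv (H : IsRetrialModel M m A a b u₀ us) (k : ℕ) :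
    DifferentiableOn ℂ (fun z => M k (uInv M a b u₀ z)) {z | z.re < zMapReal m a b u₀} := by
  intro z hz
  exact ((H.hasDerivAt k _ ((H.uInv_spec hz).1.trans H.u₀_lt)).comp z
    (H.hasDerivAt_uInv hz)).differentiableAt.differentiableWithinAt

lemma ball_subset_re_lt (R : ℝ) : Metric.ball (0 : ℂ) R ⊆ {z | z.re < R} := fun z hz =>
  (Complex.re_le_norm z).trans_lt (by simpa using hz)

lemma hasSum_moment_uInv (H : IsRetrialModel M m A a b u₀ us) {c : ℕ → ℝ}
    (hc : ∀ n, iteratedDeriv n (fun z => M 0 (uInv M a b u₀ z)) 0 / (n.factorial : ℂ) = c n)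
    {z : ℂ} (hz : ‖z‖ < zMapReal m a b u₀) :
    HasSum (fun n => (c n : ℂ) * z ^ n) (M 0 (uInv M a b u₀ z)) := by
  have := Complex.hasSum_taylorSeries_on_ball ((H.differentiableOn_moment_uInv 0).mono
    (ball_subset_re_lt _)) (z := z) (by simpa using hz)
  have heq : (fun n => (c n : ℂ) * z ^ n) = fun n => ((n.factorial : ℂ))⁻¹ • (z - 0) ^ n •
      iteratedDeriv n (fun z => M 0 (uInv M a b u₀ z)) 0 := by
    funext n
    rw [← hc n, sub_zero]
    simp only [smul_eq_mul]; ring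
  rw [heq]; exact this

lemma moment_uInv_ofReal (H : IsRetrialModel M m A a b u₀ us) {x : ℝ}
    (hx : x < zMapReal m a b u₀) :
    ∃ y < u₀, zMapReal m a b y = x ∧ uInv M a b u₀ x = y ∧ M 0 (uInv M a b u₀ x) = m 0 y := by
  obtain ⟨y, hy, rfl⟩ := H.exists_zMapReal_eq hx
  have h := H.uInv_ofReal hy
  exact ⟨y, hy, rfl, h, by rw [h, H.ofReal 0 y (hy.trans H.u₀_lt)]⟩

lemma tendsto_ofReal_nhdsLT (R : ℝ) :
    Tendsto (fun x : ℝ => (x : ℂ)) (𝓝[<] R) (𝓝[{z : ℂ | z.re < R}] (R : ℂ)) := by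
  refine tendsto_nhdsWithin_iff.2 ⟨?_, ?_⟩
  · exact (Complex.continuous_ofReal.tendsto R).mono_left nhdsWithin_le_nhds
  · filter_upwards [self_mem_nhdsWithin] with x hx using by simpa using hx

/-- The Taylor series of `M 0 ∘ uInv` converges at the critical value, to the limit. -/
lemma tsum_taylor_coeff (H : IsRetrialModel M m A a b u₀ us) {c : ℕ → ℝ} (hc0 : ∀ n, 0 ≤ c n)
    (hc : ∀ n, iteratedDeriv n (fun z => M 0 (uInv M a b u₀ z)) 0 / (n.factorial : ℂ) = c n) :
    ∑' n, (c n : ℂ) * (zMapReal m a b u₀ : ℂ) ^ n = m 0 u₀ := by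
  set R := zMapReal m a b u₀ with hRdef
  have hR : 0 < R := one_pos.trans H.one_lt_zMapReal
  -- Partial sums at `x < R` are at most the full sum, which is at most `m₀(u₀)`; letting `x ↑ R`
  -- bounds them at `R`. Absolute convergence there makes the series continuous on the closed disc.
  have hbound : ∀ s : Finset ℕ, ∑ n ∈ s, c n * R ^ n ≤ m 0 u₀ := fun s => by
    have h1 : Tendsto (fun x : ℝ => ∑ n ∈ s, c n * x ^ n) (𝓝[<] R) (𝓝 (∑ n ∈ s, c n * R ^ n)) :=
      (Continuous.tendsto (by fun_prop) R).mono_left nhdsWithin_le_nhds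
    refine le_of_tendsto h1 ?_
    filter_upwards [Ioo_mem_nhdsLT hR] with x hx
    obtain ⟨y, hy, -, -, hxy⟩ := H.moment_uInv_ofReal hx.2
    have h2 := H.hasSum_moment_uInv hc (z := (x : ℂ))
      (by rw [Complex.norm_real, norm_of_nonneg hx.1.le]; exact hx.2)
    rw [hxy] at h2
    have h3 : HasSum (fun n => c n * x ^ n) (m 0 y) := by
      rw [← Complex.hasSum_ofReal]; push_cast; exact h2
    refine (sum_le_hasSum s (fun n _ => mul_nonneg (hc0 n) (pow_nonneg hx.1.le n)) h3).trans ?_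
    exact H.monotone_le 0 hy.le H.u₀_lt
  have hsum : Summable fun n => c n * R ^ n :=
    summable_of_sum_le (fun n => mul_nonneg (hc0 n) (pow_nonneg hR.le n)) hbound
  have hcont : ContinuousOn (fun z : ℂ => ∑' n, (c n : ℂ) * z ^ n) (Metric.closedBall 0 R) := by
    refine continuousOn_tsum (fun n => by fun_prop) hsum fun n z hz => ?_
    rw [norm_mul, norm_pow, Complex.norm_real, norm_of_nonneg (hc0 n)]
    have : ‖z‖ ≤ R := by simpa using hz
    exact mul_le_mul_of_nonneg_left (pow_le_pow_left₀ (norm_nonneg z) this n) (hc0 n)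
  have hmaps : Tendsto (fun x : ℝ => (x : ℂ)) (𝓝[<] R) (𝓝[Metric.closedBall 0 R] (R : ℂ)) := by
    refine tendsto_nhdsWithin_iff.2
      ⟨(Complex.continuous_ofReal.tendsto R).mono_left nhdsWithin_le_nhds, ?_⟩
    filter_upwards [Ioo_mem_nhdsLT hR] with x hx
    rw [mem_closedBall_zero_iff, Complex.norm_real, norm_of_nonneg hx.1.le]; exact hx.2.le
  have hlim := (hcont (R : ℂ) (by simp [abs_of_pos hR])).tendsto.comp hmaps
  have hu₀ : ((u₀ : ℂ)).re < A := by simpa using H.u₀_lt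
  have hlim' : Tendsto (fun x : ℝ => M 0 (uInv M a b u₀ x)) (𝓝[<] R) (𝓝 (M 0 u₀)) :=
    ((H.hasDerivAt 0 u₀ hu₀).continuousAt.tendsto.comp H.tendsto_uInv).comp
      (tendsto_ofReal_nhdsLT R)
  rw [H.ofReal 0 u₀ H.u₀_lt] at hlim'
  refine tendsto_nhds_unique (hlim.congr' ?_) hlim'
  filter_upwards [Ioo_mem_nhdsLT hR] with x hx
  exact (H.hasSum_moment_uInv hc
    (by rw [Complex.norm_real, norm_of_nonneg hx.1.le]; exact hx.2)).tsum_eq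

end IsRetrialModel

/-! ### Zeros of `h(z) - z` and the continuation of `f₁` -/

/-- The denominator `1 - (a + b) (M₀ u - 1) / u`, with its removable singularity removed. -/
noncomputable def kap (M : ℕ → ℂ → ℂ) (a b : ℝ) (u : ℂ) : ℂ := 1 - (a + b) * dslope (M 0) 0 u

/-- The continuation of `f₁`, as a function of `u`. -/
noncomputable def f₁U (M : ℕ → ℂ → ℂ) (a b : ℝ) (u : ℂ) : ℂ :=
  b * dslope (M 0) 0 u / kap M a b u

namespace IsRetrialModel

variable {M : ℕ → ℂ → ℂ} {m : ℕ → ℝ → ℝ} {A a b u₀ us : ℝ}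

lemma moment_zero_eq (H : IsRetrialModel M m A a b u₀ us) (u : ℂ) :
    M 0 u = 1 + u * dslope (M 0) 0 u := by
  have := sub_smul_dslope (M 0) 0 u
  rw [H.zero_eq_one, sub_zero, smul_eq_mul] at this
  rw [this]; ring

lemma strictConvexOn_moment (H : IsRetrialModel M m A a b u₀ us) :
    StrictConvexOn ℝ (Iio A) (m 0) := by
  refine StrictMonoOn.strictConvexOn_of_deriv (convex_Iio A) (H.continuousOn_real 0) ?_
  rw [interior_Iio]
  intro x hx y hy hxy
  rw [(H.hasDerivAt_real 0 hx).deriv, (H.hasDerivAt_real 0 hy).deriv]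
  exact H.strictMonoOn 1 hx hy hxy

/-- The secant slopes of the strictly convex `m₀` from `0` increase, and equal `1 / (a + b)` at
`us`. -/
lemma star_lt (H : IsRetrialModel M m A a b u₀ us) {x : ℝ} (hx0 : 0 < x) (hx : x < us) :
    (a + b) * (m 0 x - 1) < x := by
  have h1 := H.strictConvexOn_moment.secant_strict_mono (a := 0) (x := x) (y := us) H.pos_bound
    (hx.trans H.us_lt) H.us_lt hx0.ne' H.us_pos.ne' hx
  rw [H.zero, sub_zero, sub_zero, div_lt_div_iff₀ hx0 H.us_pos] at h1
  have hab := add_pos H.ha H.hb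
  have h2 := H.star
  have h3 := H.us_pos
  have h4 : (a + b) * ((m 0 x - 1) * us) < (a + b) * ((m 0 us - 1) * x) :=
    mul_lt_mul_of_pos_left h1 hab
  have h5 : (a + b) * (m 0 x - 1) * us < x * us := by
    calc (a + b) * (m 0 x - 1) * us = (a + b) * ((m 0 x - 1) * us) := by ring
      _ < (a + b) * ((m 0 us - 1) * x) := h4
      _ = x * ((a + b) * (m 0 us - 1)) := by ring
      _ = x * us := by rw [h2]
  exact lt_of_mul_lt_mul_right h5 h3.le

lemma star_unique (H : IsRetrialModel M m A a b u₀ us) {x : ℝ} (hx0 : 0 < x) (hxA : x < A)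
    (hx : (a + b) * (m 0 x - 1) = x) : x = us := by
  rcases lt_trichotomy x us with h | h | h
  · exact absurd hx (H.star_lt hx0 h).ne
  · exact h
  -- A root beyond `us` could itself play the role of `us`, and then `us` would not be a root.
  · have H' : IsRetrialModel M m A a b u₀ x := { H with us_pos := hx0, us_lt := hxA, star := hx }
    exact absurd H.star (H'.star_lt H.us_pos h).ne

/-- The derivative equals the secant slope `1 / (a + b)` at a point before `us` and increases
strictly. This makes the zero of `kap` at `us` simple. -/
lemma one_lt_moment_us (H : IsRetrialModel M m A a b u₀ us) : 1 < (a + b) * m 1 us := by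
  have hsub : Icc 0 us ⊆ Iio A := fun x hx => hx.2.trans_lt H.us_lt
  obtain ⟨ξ, hξ, hξ'⟩ := exists_hasDerivAt_eq_slope (m 0) (m 1) H.us_pos
    ((H.continuousOn_real 0).mono hsub) fun x hx => H.hasDerivAt_real 0 (hx.2.trans H.us_lt)
  have hab := add_pos H.ha H.hb
  have h1 := H.strictMonoOn 1 (hξ.2.trans H.us_lt) H.us_lt hξ.2
  have h2 : (a + b) * m 1 ξ = 1 := by
    rw [hξ', H.zero, sub_zero, mul_div_assoc', H.star, div_self H.us_pos.ne']
  nlinarith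

lemma differentiableOn_dslope (H : IsRetrialModel M m A a b u₀ us) :
    DifferentiableOn ℂ (dslope (M 0) 0) {u | u.re < A} :=
  (Complex.differentiableOn_dslope ((isOpen_re_lt A).mem_nhds (by simpa using H.pos_bound))).2
    (H.differentiableOn 0)

lemma differentiableOn_kap (H : IsRetrialModel M m A a b u₀ us) :
    DifferentiableOn ℂ (kap M a b) {u | u.re < A} :=
  (H.differentiableOn_dslope.const_mul _).const_sub _

lemma mul_kap (H : IsRetrialModel M m A a b u₀ us) (u : ℂ) :
    u * kap M a b u = u - (a + b) * (M 0 u - 1) := by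
  rw [H.moment_zero_eq u, kap]; ring

/-- A zero `u ≠ 0` would satisfy `u = (a + b) (M₀(u) - 1)`. For `Re u > 0`, real parts give `Re u ≤
(a + b) (m₀(Re u) - 1) < Re u`; for `Re u ≤ 0`, the Lipschitz bound gives `|u| ≤ ρ |u|`. At `u = 0`
the value is `1 - ρ`. -/
lemma kap_ne_zero (H : IsRetrialModel M m A a b u₀ us) {u : ℂ} (hu : u.re < us) :
    kap M a b u ≠ 0 := by
  intro h0
  have huA := hu.trans H.us_lt
  have hab := add_pos H.ha H.hb
  have h1 := H.mul_kap u
  rw [h0, mul_zero, eq_comm, sub_eq_zero] at h1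
  rcases lt_or_ge 0 u.re with hpos | hneg
  · have h2 : u.re = (a + b) * ((M 0 u).re - 1) := by
      have := congrArg Complex.re h1
      rw [← Complex.ofReal_add, Complex.re_ofReal_mul] at this
      simpa using this
    have h3 := (Complex.re_le_norm _).trans (H.norm_le 0 u huA)
    have h4 := H.star_lt hpos hu
    nlinarith
  · rcases eq_or_ne u 0 with rfl | hne
    · have h2 : M 1 0 = (m 1 0 : ℝ) := by
        have := H.ofReal 1 0 H.pos_bound
        simpa using this
      have h3 : deriv (M 0) 0 = M 1 0 := (H.hasDerivAt 0 0 huA).deriv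
      rw [kap, dslope_same, h3, h2, sub_eq_zero] at h0
      have h4 : (a + b) * m 1 0 = 1 := by exact_mod_cast h0.symm
      linarith [H.subcritical]
    · have h2 := H.norm_sub_le 0 (c := 0) H.pos_bound hneg (v := 0) (by simp)
      rw [H.zero_eq_one, sub_zero, zero_add] at h2
      have h3 : ‖u‖ = (a + b) * ‖M 0 u - 1‖ := by
        conv_lhs => rw [h1]
        rw [← Complex.ofReal_add, norm_mul, Complex.norm_real, norm_of_nonneg hab.le]
      have h4 : 0 < ‖u‖ := norm_pos_iff.2 hne
      have h5 := H.subcritical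
      nlinarith [mul_le_mul_of_nonneg_left h2 hab.le]

lemma kap_us (H : IsRetrialModel M m A a b u₀ us) : kap M a b us = 0 := by
  have h1 := H.mul_kap us
  have hne : (us : ℂ) ≠ 0 := by exact_mod_cast H.us_pos.ne'
  have h2 : ((a : ℂ) + b) * (m 0 us - 1) = us := by exact_mod_cast H.star
  rw [H.ofReal 0 us H.us_lt, h2, sub_self] at h1
  exact (mul_eq_zero.1 h1).resolve_left hne

lemma dslope_us (H : IsRetrialModel M m A a b u₀ us) : dslope (M 0) 0 us = 1 / (a + b) := by
  have h := H.kap_us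
  have hab : (a : ℂ) + b ≠ 0 := by exact_mod_cast (add_pos H.ha H.hb).ne'
  rw [kap, sub_eq_zero] at h
  rw [eq_div_iff hab, mul_comm]; exact h.symm

/-- Differentiating `u κ(u) = u - (a + b) (M₀(u) - 1)` at `us`, where `κ` vanishes, leaves `us
κ'(us)` on the left. -/
lemma hasDerivAt_kap_us (H : IsRetrialModel M m A a b u₀ us) :
    HasDerivAt (kap M a b) (-(((a + b) * m 1 us - 1) / us : ℝ)) us := by
  have hus : ((us : ℂ)).re < A := by simpa using H.us_lt
  have hne : (us : ℂ) ≠ 0 := by exact_mod_cast H.us_pos.ne'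
  have hd := (H.differentiableOn_kap.differentiableAt
    ((isOpen_re_lt A).mem_nhds hus)).hasDerivAt
  have h1 : HasDerivAt (fun u => u * kap M a b u) (1 - (a + b) * M 1 us) us := by
    rw [funext H.mul_kap]
    exact (hasDerivAt_id _).sub (((H.hasDerivAt 0 us hus).sub_const 1).const_mul _)
  have h2 := ((hasDerivAt_id _).mul hd).unique h1
  rw [H.kap_us, H.ofReal 1 us H.us_lt] at h2
  have h3 : deriv (kap M a b) us = -(((a + b) * m 1 us - 1) / us : ℝ) := by
    push_cast
    field_simp
    linear_combination h2
  rw [← h3]; exact hd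

lemma kap_ofReal_ne_zero (H : IsRetrialModel M m A a b u₀ us) {x : ℝ} (hx0 : 0 < x) (hxA : x < A)
    (hx : x ≠ us) : kap M a b x ≠ 0 := by
  intro h0
  have h1 := H.mul_kap x
  rw [h0, mul_zero, eq_comm, sub_eq_zero, H.ofReal 0 x hxA] at h1
  exact hx (H.star_unique hx0 hxA (by exact_mod_cast h1.symm))

/-- The difference of the continuation of `h` and the identity. -/
lemma moment_sub_zMap (H : IsRetrialModel M m A a b u₀ us) (u : ℂ) :
    M 0 u - zMap M a b u = -(u * kap M a b u) / b := by
  have hbne : (b : ℂ) ≠ 0 := by exact_mod_cast H.hb.ne'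
  rw [H.mul_kap, zMap]; field_simp; ring

lemma f₁U_mul (H : IsRetrialModel M m A a b u₀ us) {u : ℂ} (hu : kap M a b u ≠ 0) :
    f₁U M a b u * (M 0 u - zMap M a b u) = 1 - M 0 u := by
  have hbne : (b : ℂ) ≠ 0 := by exact_mod_cast H.hb.ne'
  rw [H.moment_sub_zMap, H.moment_zero_eq u, f₁U]; field_simp; ring

lemma f₁U_eq (H : IsRetrialModel M m A a b u₀ us) {u : ℂ} (hu : u ≠ 0) :
    (1 - M 0 u) / (M 0 u - zMap M a b u) = f₁U M a b u := by
  have hbne : (b : ℂ) ≠ 0 := by exact_mod_cast H.hb.ne'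
  rw [H.moment_sub_zMap, H.moment_zero_eq u, f₁U]
  -- If `kap` vanishes, both sides are quotients with denominator zero, hence `0`. The identity thus
  -- remains usable at `u₀ = us`.
  rcases eq_or_ne (kap M a b u) 0 with h | h
  · simp [h]
  · field_simp; ring

lemma differentiableAt_f₁U (H : IsRetrialModel M m A a b u₀ us) {u : ℂ} (hu : u.re < A)
    (hk : kap M a b u ≠ 0) : DifferentiableAt ℂ (f₁U M a b) u :=
  ((H.differentiableOn_dslope.differentiableAt ((isOpen_re_lt A).mem_nhds hu)).const_mul _).div
    (H.differentiableOn_kap.differentiableAt ((isOpen_re_lt A).mem_nhds hu)) hk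

/-- At `us` the values of `M₀` and `Z` agree. In the constants this turns the argument `λ (1 - R*)`
of the transform into `-us`. -/
lemma mul_zMapReal_us_sub_one (H : IsRetrialModel M m A a b u₀ us) :
    (a + b) * (zMapReal m a b us - 1) = us := by
  have hbne := H.hb.ne'
  have h1 := H.star
  have h2 : b * (zMapReal m a b us - 1) = us + a * (1 - m 0 us) := by
    rw [zMapReal]; field_simp; ring
  have h3 : b * ((a + b) * (zMapReal m a b us - 1) - us) = 0 := by
    linear_combination (a + b) * h2 - a * h1
  exact sub_eq_zero.1 ((mul_eq_zero.1 h3).resolve_left hbne)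

lemma zMapReal_min_le (H : IsRetrialModel M m A a b u₀ us) :
    zMapReal m a b (min u₀ us) ≤ zMapReal m a b u₀ :=
  H.strictMonoOn_zMapReal.monotoneOn (mem_Iic.2 (min_le_left _ _)) (mem_Iic.2 le_rfl)
    (min_le_left _ _)

lemma one_lt_zMapReal_min (H : IsRetrialModel M m A a b u₀ us) :
    1 < zMapReal m a b (min u₀ us) := by
  rw [← H.zMapReal_zero]
  exact H.strictMonoOn_zMapReal (mem_Iic.2 H.u₀_pos.le) (mem_Iic.2 (min_le_left _ _))
    (lt_min H.u₀_pos H.us_pos)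

lemma kap_uInv_ne_zero (H : IsRetrialModel M m A a b u₀ us) {z : ℂ}
    (hz : z.re < zMapReal m a b (min u₀ us)) : kap M a b (uInv M a b u₀ z) ≠ 0 :=
  H.kap_ne_zero ((H.uInv_re_lt (min_le_left _ _) hz).trans_le (min_le_right _ _))

lemma differentiableOn_f₁U_uInv (H : IsRetrialModel M m A a b u₀ us) :
    DifferentiableOn ℂ (fun z => f₁U M a b (uInv M a b u₀ z))
      {z | z.re < zMapReal m a b (min u₀ us)} := by
  intro z hz
  have hz' := lt_of_lt_of_le (show z.re < _ from hz) H.zMapReal_min_le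
  exact ((H.differentiableAt_f₁U ((H.uInv_spec hz').1.trans H.u₀_lt)
    (H.kap_uInv_ne_zero hz)).comp z (H.hasDerivAt_uInv hz').differentiableAt).differentiableWithinAt

lemma exists_primitive (H : IsRetrialModel M m A a b u₀ us) :
    ∃ F : ℂ → ℂ, F 1 = 0 ∧ ∀ z : ℂ, z.re < zMapReal m a b (min u₀ us) →
      HasDerivAt F (f₁U M a b (uInv M a b u₀ z)) z := by
  obtain ⟨F, hF⟩ := (convex_re_lt _).exists_forall_hasDerivWithinAt H.differentiableOn_f₁U_uInv
  exact ⟨fun z => F z - F 1, sub_self _, fun z hz =>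
    ((hF z hz).hasDerivAt ((isOpen_re_lt _).mem_nhds hz)).sub_const _⟩

lemma tendsto_uInv_of_le (H : IsRetrialModel M m A a b u₀ us) {c : ℝ} (hc : c ≤ u₀) :
    Tendsto (uInv M a b u₀) (𝓝[{z : ℂ | z.re < zMapReal m a b c}] (zMapReal m a b c : ℂ))
      (𝓝 c) := by
  rcases hc.eq_or_lt with rfl | hlt
  · exact H.tendsto_uInv
  · have h1 : ((zMapReal m a b c : ℂ)).re < zMapReal m a b u₀ := by
      rw [Complex.ofReal_re]
      exact H.strictMonoOn_zMapReal (mem_Iic.2 hc) (mem_Iic.2 le_rfl) hlt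
    have := (H.continuousAt_uInv h1).tendsto
    rw [H.uInv_ofReal hlt] at this
    exact this.mono_left nhdsWithin_le_nhds

/-- On the real axis to the right of `1` the continuation of `f₁` is real and nonnegative. -/
lemma f₁U_real_nonneg (H : IsRetrialModel M m A a b u₀ us) {x : ℝ} (hx1 : 1 < x)
    (hx : x < zMapReal m a b (min u₀ us)) :
    ∃ r : ℝ, 0 ≤ r ∧ f₁U M a b (uInv M a b u₀ x) = r := by
  obtain ⟨y, hy, hyx, huy, hM⟩ := H.moment_uInv_ofReal (hx.trans_le H.zMapReal_min_le)
  have hymin : y < min u₀ us := by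
    rw [← hyx] at hx
    exact (H.strictMonoOn_zMapReal.lt_iff_lt (mem_Iic.2 hy.le) (mem_Iic.2 (min_le_left _ _))).1 hx
  have hy0 : 0 < y := by
    rw [← hyx, ← H.zMapReal_zero] at hx1
    exact (H.strictMonoOn_zMapReal.lt_iff_lt (mem_Iic.2 H.u₀_pos.le) (mem_Iic.2 hy.le)).1 hx1
  have hyA := hy.trans H.u₀_lt
  refine ⟨(1 - m 0 y) / (m 0 y - zMapReal m a b y), ?_, ?_⟩
  · have h1 : 1 < m 0 y := by
      rw [← H.zero]; exact H.strictMonoOn 0 H.pos_bound hyA hy0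
    have h2 := H.star_lt hy0 (hymin.trans_le (min_le_right _ _))
    refine div_nonneg_of_nonpos (by linarith) ?_
    have h3 : m 0 y - 1 ≤ (y + a * (1 - m 0 y)) / b := by
      rw [le_div_iff₀ H.hb]; linarith
    simp only [zMapReal]; linarith
  · rw [huy, ← H.f₁U_eq (by exact_mod_cast hy0.ne'), H.zMap_ofReal hyA, H.ofReal 0 y hyA]
    push_cast; rfl

end IsRetrialModel

/-! ### Continuation to Delta-domains -/

lemma exists_eq_add_const {s : Set ℂ} (hs : Convex ℝ s) {F L f : ℂ → ℂ}
    (hF : ∀ z ∈ s, HasDerivAt F (f z) z) (hL : ∀ z ∈ s, HasDerivAt L (f z) z) :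
    ∃ k, ∀ z ∈ s, F z = L z + k := by
  rcases s.eq_empty_or_nonempty with rfl | ⟨w, hw⟩
  · exact ⟨0, fun z hz => hz.elim⟩
  refine ⟨F w - L w, fun z hz => ?_⟩
  have h := hs.norm_image_sub_le_of_norm_hasDerivWithin_le (f := fun z => F z - L z)
    (f' := fun z => f z - f z) (C := 0)
    (fun z hz => ((hF z hz).sub (hL z hz)).hasDerivWithinAt) (by simp) hw hz
  rw [zero_mul, norm_le_zero_iff, sub_eq_zero] at h
  linear_combination h

lemma sub_mem_slitPlane_of_mem_deltaDomain {R S φ : ℝ} (hφ : 0 < φ) {z : ℂ}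
    (hz : z ∈ DeltaDomain R S φ) : (R : ℂ) - z ∈ Complex.slitPlane := by
  by_contra h
  rw [Complex.mem_slitPlane_iff, not_or, not_lt, not_not] at h
  have h1 : z - (R : ℂ) = ((z.re - R : ℝ) : ℂ) := by
    apply Complex.ext
    · simp
    · have := h.2; simp at this; simp [this]
  have h2 : 0 ≤ z.re - R := by have := h.1; simp at this; linarith
  have h3 := hz.2.2
  rw [h1, Complex.arg_ofReal_of_nonneg h2, abs_zero] at h3
  linarith

/-- Use `F` on `Re z < R` and `L` on the slit ball. The points with `|z| < S` and `Re z ≥ R` shrink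
to `R` as `S ↓ R`, so they lie in the ball; the Delta-domain avoids the slit. -/
lemma exists_deltaDomain_extension {R δ : ℝ} (hR : 0 < R) (hδ : 0 < δ) {F L : ℂ → ℂ}
    (hF : DifferentiableOn ℂ F {z | z.re < R})
    (hL : ∀ z ∈ Metric.ball (R : ℂ) δ, (R : ℂ) - z ∈ Complex.slitPlane → DifferentiableAt ℂ L z)
    (hFL : ∀ z ∈ Metric.ball (R : ℂ) δ, z.re < R → F z = L z) :
    ∃ S, R < S ∧ ∃ G : ℂ → ℂ, AnalyticOnNhd ℂ G (DeltaDomain R S (π / 4)) ∧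
      (∀ z : ℂ, z.re < R → G z = F z) ∧
      ∀ᶠ z in 𝓝[DeltaDomain R S (π / 4)] (R : ℂ), G z = L z := by
  classical
  -- For `Re z ≥ R` and `|z| < R + ε`, `|z - R|² ≤ |z|² - R² < (2R + 1) ε`, which is below `δ²` for
  -- this `ε`.
  set ε := min 1 (δ ^ 2 / (4 * (R + 1))) with hε
  have hε0 : 0 < ε := lt_min one_pos (by positivity)
  have hε1 : ε ≤ 1 := min_le_left _ _
  have hε2 : 4 * (R + 1) * ε ≤ δ ^ 2 := by
    have : ε ≤ δ ^ 2 / (4 * (R + 1)) := min_le_right _ _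
    rwa [le_div_iff₀' (by positivity)] at this
  have hπ : 0 < π / 4 := by positivity
  set G : ℂ → ℂ := fun z => if z.re < R then F z else L z with hG
  have hGF : ∀ z : ℂ, z.re < R → G z = F z := fun z hz => if_pos hz
  have hGL : ∀ z ∈ Metric.ball (R : ℂ) δ, G z = L z := fun z hz => by
    by_cases h : z.re < R
    · rw [hGF z h, hFL z hz h]
    · exact if_neg h
  refine ⟨R + ε, by linarith, G, fun z hz => ?_, hGF,
    eventually_nhdsWithin_of_eventually_nhds
      (mem_of_superset (Metric.ball_mem_nhds _ hδ) fun z hz => hGL z hz)⟩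
  by_cases h : z.re < R
  · refine (hF.analyticAt ((isOpen_re_lt R).mem_nhds h)).congr ?_
    filter_upwards [(isOpen_re_lt R).mem_nhds h] with w hw using (hGF w hw).symm
  · have hzδ : z ∈ Metric.ball (R : ℂ) δ := by
      rw [mem_ball_iff_norm]
      refine lt_of_pow_lt_pow_left₀ 2 hδ.le ?_
      have h1 : ‖z‖ ^ 2 < (R + ε) ^ 2 := pow_lt_pow_left₀ hz.1 (norm_nonneg z) two_ne_zero
      rw [← Complex.normSq_eq_norm_sq, Complex.normSq_apply] at h1 ⊢
      simp only [Complex.sub_re, Complex.ofReal_re, Complex.sub_im, Complex.ofReal_im, sub_zero]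
      have h2 : R ≤ z.re := not_lt.1 h
      nlinarith
    have hslit := sub_mem_slitPlane_of_mem_deltaDomain hπ hz
    have hopen : IsOpen {w : ℂ | (R : ℂ) - w ∈ Complex.slitPlane} :=
      Complex.isOpen_slitPlane.preimage (by fun_prop)
    have hev : ∀ᶠ w in 𝓝 z, w ∈ Metric.ball (R : ℂ) δ ∧ (R : ℂ) - w ∈ Complex.slitPlane :=
      (Metric.isOpen_ball.eventually_mem hzδ).and (hopen.eventually_mem hslit)
    refine (Complex.analyticAt_iff_eventually_differentiableAt.2
      (hev.mono fun w hw => hL w hw.1 hw.2)).congr ?_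
    filter_upwards [hev] with w hw using (hGL w hw.1).symm

/-! ### Singularities -/

/-- The circle `|z| = R` leaves the half-plane `Re z < R` only at `R`, so only that point can
obstruct continuation. -/
lemma isDominantSingularity_of_re_lt {f g : ℂ → ℂ} {R : ℝ} (hR : 0 < R)
    (hg : DifferentiableOn ℂ g {z | z.re < R}) (hfg : g =ᶠ[𝓝 0] f)
    (hn : ¬ ContinuableAt g (Metric.ball 0 R) R) : IsDominantSingularity f R := by
  have hsub : Metric.ball (0 : ℂ) R ⊆ {z | z.re < R} := fun z hz =>
    (Complex.re_le_norm z).trans_lt (by simpa using hz)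
  have hga := hg.analyticOnNhd (isOpen_re_lt R)
  refine ⟨hR, g, hga.mono hsub, hfg, fun ζ hζ => ⟨?_, fun hne => ?_⟩⟩
  · rintro h rfl
    exact hn h
  · refine ⟨g, hga ζ ?_, EventuallyEq.rfl⟩
    have h1 : ‖ζ‖ = R := by simpa using hζ
    refine lt_of_le_of_ne (h1 ▸ Complex.re_le_norm ζ) fun h2 => hne ?_
    have h3 : ‖ζ‖ ^ 2 = ζ.re ^ 2 + ζ.im ^ 2 := by
      rw [← Complex.normSq_eq_norm_sq, Complex.normSq_apply]; ring
    rw [h1, h2] at h3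
    have h4 : ζ.im = 0 := by nlinarith
    exact Complex.ext (by simpa using h2) (by simpa using h4)

lemma tendsto_ofReal_ball {R : ℝ} (hR : 0 < R) :
    Tendsto (fun x : ℝ => (x : ℂ)) (𝓝[<] R) (𝓝[Metric.ball 0 R] (R : ℂ)) := by
  refine tendsto_nhdsWithin_iff.2
    ⟨(Complex.continuous_ofReal.tendsto R).mono_left nhdsWithin_le_nhds, ?_⟩
  filter_upwards [Ioo_mem_nhdsLT hR] with x hx
  rw [mem_ball_zero_iff, Complex.norm_real, norm_of_nonneg hx.1.le]; exact hx.2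

lemma neBot_nhdsWithin_ball {R : ℝ} (hR : 0 < R) : (𝓝[Metric.ball 0 R] (R : ℂ)).NeBot :=
  (tendsto_ofReal_ball hR).neBot

/-- An equality on a neighbourhood within an open set passes to the derivatives. -/
lemma eventually_hasDerivAt_of_eventuallyEq {U : Set ℂ} (hU : IsOpen U) {ζ : ℂ} {k g g' : ℂ → ℂ}
    (hkg : k =ᶠ[𝓝[U] ζ] g) (hg : ∀ z ∈ U, HasDerivAt g (g' z) z) :
    ∀ᶠ z in 𝓝[U] ζ, HasDerivAt k (g' z) z := by
  filter_upwards [eventually_eventually_nhdsWithin.2 hkg, self_mem_nhdsWithin] with z hz hzU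
  rw [hU.nhdsWithin_eq hzU] at hz
  exact (hg z hzU).congr_of_eventuallyEq hz

/-- The logarithmic derivative of a continuable function with nonzero limit is continuable. -/
lemma continuableAt_of_exp {R : ℝ} {F f : ℂ → ℂ} {C κ ℓ : ℂ} (hC : C ≠ 0) (hκ : κ ≠ 0)
    (hR : 0 < R) (hF : ∀ z ∈ Metric.ball (0 : ℂ) R, HasDerivAt F (f z) z)
    (hlim : Tendsto F (𝓝[Metric.ball 0 R] (R : ℂ)) (𝓝 ℓ))
    (h : ContinuableAt (fun z => C * Complex.exp (κ * F z)) (Metric.ball 0 R) R) :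
    ContinuableAt f (Metric.ball 0 R) R := by
  obtain ⟨k, hk, hkg⟩ := h
  have := neBot_nhdsWithin_ball hR
  have hkR : k R = C * Complex.exp (κ * ℓ) := by
    refine tendsto_nhds_unique ((hk.continuousAt.tendsto.mono_left nhdsWithin_le_nhds).congr' hkg)
      (Tendsto.const_mul _ ?_)
    exact (Complex.continuous_exp.tendsto _).comp (hlim.const_mul _)
  have hkne : k R ≠ 0 := by rw [hkR]; exact mul_ne_zero hC (Complex.exp_ne_zero _)
  refine ⟨fun z => κ⁻¹ * (deriv k z / k z),
    analyticAt_const.mul (hk.deriv.div hk hkne), ?_⟩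
  have hd := eventually_hasDerivAt_of_eventuallyEq Metric.isOpen_ball hkg
    (g' := fun z => C * (Complex.exp (κ * F z) * (κ * f z)))
    fun z hz => (((hF z hz).const_mul κ).cexp.const_mul C)
  filter_upwards [hd, hkg] with z h1 h2
  rw [h1.deriv, h2]
  have := Complex.exp_ne_zero (κ * F z)
  field_simp

/-! ### Asymptotics -/

/-- The mean value inequality on the disc of radius `|t|` gains one power of `t`. -/
lemma isLittleO_pow_succ_of_hasDerivAt {g g' : ℂ → ℂ} {n : ℕ} (h0 : g 0 = 0)
    (hg : ∀ᶠ t in 𝓝 0, HasDerivAt g (g' t) t) (hg' : g' =o[𝓝 0] fun t => t ^ n) :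
    g =o[𝓝 0] fun t => t ^ (n + 1) := by
  refine isLittleO_iff.2 fun ε hε => ?_
  obtain ⟨δ, hδ, hball⟩ := Metric.eventually_nhds_iff_ball.1 (hg.and (hg'.def hε))
  filter_upwards [Metric.ball_mem_nhds _ hδ] with t ht
  have ht' : ‖t‖ < δ := by simpa using ht
  have hsub : Metric.closedBall (0 : ℂ) ‖t‖ ⊆ Metric.ball 0 δ := fun s hs => by
    have : ‖s‖ ≤ ‖t‖ := by simpa using hs
    simpa using this.trans_lt ht'
  have h := (convex_closedBall (0 : ℂ) ‖t‖).norm_image_sub_le_of_norm_hasDerivWithin_le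
    (f := g) (f' := g') (C := ε * ‖t‖ ^ n) (x := 0) (y := t)
    (fun s hs => (hball s (hsub hs)).1.hasDerivWithinAt) (fun s hs => ?_) (by simp) (by simp)
  · rw [h0, sub_zero, sub_zero] at h
    rw [norm_pow, pow_succ, ← mul_assoc]; exact h
  · refine (hball s (hsub hs)).2.trans ?_
    rw [norm_pow]
    have : ‖s‖ ≤ ‖t‖ := by simpa using hs
    gcongr

/-- Integration in the variable `t = (R - z) ^ (1 / 2)`. -/
lemma exists_sqrt_primitive {R : ℝ} {F f e : ℂ → ℂ}
    (hF : ∀ z : ℂ, z.re < R → HasDerivAt F (f z) z) (he : AnalyticAt ℂ e 0)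
    (hfe : ∀ᶠ z in 𝓝[{z : ℂ | z.re < R}] (R : ℂ),
      f z * (-2 * ((R : ℂ) - z) ^ (1 / 2 : ℂ)) = e (((R : ℂ) - z) ^ (1 / 2 : ℂ))) :
    ∃ B : ℂ → ℂ, (∀ᶠ t in 𝓝 0, HasDerivAt B (e t) t) ∧ ∃ δ > 0,
      (∀ z ∈ Metric.ball (R : ℂ) δ, (R : ℂ) - z ∈ Complex.slitPlane →
        DifferentiableAt ℂ (fun z => B (((R : ℂ) - z) ^ (1 / 2 : ℂ))) z) ∧
      ∀ z ∈ Metric.ball (R : ℂ) δ, z.re < R → F z = B (((R : ℂ) - z) ^ (1 / 2 : ℂ)) := by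
  obtain ⟨s, hs, hes⟩ := he.exists_mem_nhds_analyticOnNhd
  obtain ⟨η, hη, hηs⟩ := Metric.mem_nhds_iff.1 hs
  obtain ⟨B, hB⟩ := (hes.differentiableOn.mono hηs).isExactOn_ball
  -- As `t = (R - z)^{1/2}` has derivative `-1 / (2t)`, a primitive `B` of `e = -2 t f` in `t` gives
  -- a primitive of `f` in `z`; it differs from `F` by a constant on the left part of the ball.
  have hcomp : ∀ z : ℂ, (R : ℂ) - z ∈ Complex.slitPlane →
      ((R : ℂ) - z) ^ (1 / 2 : ℂ) ∈ Metric.ball (0 : ℂ) η →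
      HasDerivAt (fun z => B (((R : ℂ) - z) ^ (1 / 2 : ℂ)))
        (e (((R : ℂ) - z) ^ (1 / 2 : ℂ)) * (-1 / (2 * ((R : ℂ) - z) ^ (1 / 2 : ℂ)))) z :=
    fun z h1 h2 => (hB _ h2).comp z (hasDerivAt_cpow_half_sub h1)
  have hev := eventually_nhdsWithin_iff.1 hfe
  have hev' := (tendsto_cpow_half_sub (R : ℂ)).eventually (Metric.ball_mem_nhds 0 hη)
  obtain ⟨δ, hδ, hball⟩ := Metric.eventually_nhds_iff_ball.1 (hev.and hev')
  have hslit : ∀ z : ℂ, z.re < R → (R : ℂ) - z ∈ Complex.slitPlane := fun z hz =>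
    Or.inl (by simpa using hz)
  obtain ⟨k, hk⟩ := exists_eq_add_const
    ((convex_ball (R : ℂ) δ).inter (convex_re_lt R)) (F := F)
    (L := fun z => B (((R : ℂ) - z) ^ (1 / 2 : ℂ))) (f := f) (fun z hz => hF z hz.2) fun z hz => by
      have h1 := (hball z hz.1).1 hz.2
      refine (hcomp z (hslit z hz.2) (hball z hz.1).2).congr_deriv ?_
      have hne : ((R : ℂ) - z) ^ (1 / 2 : ℂ) ≠ 0 := fun h0 => by
        have := re_cpow_half_pos (hslit z hz.2)
        rw [h0] at this; simp at this
      rw [← h1]; field_simp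
  refine ⟨fun t => B t + k, ?_, δ, hδ, fun z hz h => ?_, fun z hz h => hk z ⟨hz, h⟩⟩
  · filter_upwards [Metric.ball_mem_nhds _ hη] with t ht using (hB t ht).add_const k
  · exact ((hcomp z h (hball z hz).2).add_const k).differentiableAt

/-! ### Expansions at a square-root singularity -/

/-- The primitive of a function that is nonnegative on the real segment from `1` to `R`. -/
lemma integral_eq_of_real_nonneg {R : ℝ} (hR : 1 < R) {F f : ℂ → ℂ} {ℓ : ℂ} (hF1 : F 1 = 0)
    (hF : ∀ z : ℂ, z.re < R → HasDerivAt F (f z) z)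
    (hr : ∀ x : ℝ, 1 < x → x < R → ∃ r : ℝ, 0 ≤ r ∧ f x = r)
    (hlim : Tendsto F (𝓝[{z : ℂ | z.re < R}] (R : ℂ)) (𝓝 ℓ)) :
    ∃ β : ℝ, ℓ = β ∧ ∫ x in (1 : ℝ)..R, f x = β := by
  classical
  set g : ℝ → ℂ := fun x => if x < R then F x else ℓ with hg
  have hgF : ∀ x < R, HasDerivAt g (f x) x := fun x hx => by
    refine HasDerivAt.congr_of_eventuallyEq ((hF x (by simpa using hx)).comp_ofReal) ?_
    filter_upwards [isOpen_Iio.mem_nhds hx] with y hy using if_pos hy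
  have hgR : g R = ℓ := if_neg (lt_irrefl R)
  have hcont : ContinuousOn g (Icc 1 R) := fun x hx => by
    rcases hx.2.lt_or_eq with h | rfl
    · exact (hgF x h).continuousAt.continuousWithinAt
    · have h1 : ContinuousWithinAt g (Iio x) x := by
        rw [ContinuousWithinAt, hgR]
        refine (hlim.comp (IsRetrialModel.tendsto_ofReal_nhdsLT x)).congr' ?_
        filter_upwards [self_mem_nhdsWithin] with y hy using (if_pos hy).symm
      refine (continuousWithinAt_insert_self.2 h1).mono fun y hy => ?_
      rcases hy.2.lt_or_eq with h | h
      · exact Or.inr h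
      · exact Or.inl h
  -- The integrand may be unbounded at `R`. Integrability follows from its sign and the continuity
  -- of the primitive up to `R`.
  have hre : IntervalIntegrable (fun x : ℝ => (f x).re) volume 1 R := by
    refine intervalIntegral.intervalIntegrable_deriv_of_nonneg (g := fun x => (g x).re) ?_ ?_ ?_
    · rw [uIcc_of_le hR.le]; exact Complex.continuous_re.comp_continuousOn hcont
    · rw [min_eq_left hR.le, max_eq_right hR.le]
      intro x hx
      exact (Complex.reCLM.hasFDerivAt.comp_hasDerivAt x (hgF x hx.2))
    · rw [min_eq_left hR.le, max_eq_right hR.le]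
      intro x hx
      obtain ⟨r, hr0, hfr⟩ := hr x hx.1 hx.2
      simp [hfr, hr0]
  have hcongr : ∀ x ∈ Ioo 1 R, (((f x).re : ℝ) : ℂ) = f x := fun x hx => by
    obtain ⟨r, -, hfr⟩ := hr x hx.1 hx.2
    simp [hfr]
  have hae : ∀ᵐ x ∂volume, x ∈ Set.uIoc 1 R → (((f x).re : ℝ) : ℂ) = f x := by
    have : ∀ᵐ x : ℝ ∂volume, x ≠ R := by simp [ae_iff]
    filter_upwards [this] with x hxR hx
    rw [uIoc_of_le hR.le] at hx
    exact hcongr x ⟨hx.1, lt_of_le_of_ne hx.2 hxR⟩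
  have hint : IntervalIntegrable (fun x : ℝ => f x) volume 1 R :=
    IntervalIntegrable.congr_ae (f := fun x : ℝ => (((f x).re : ℝ) : ℂ))
      ⟨hre.1.ofReal, hre.2.ofReal⟩ ((ae_restrict_iff' measurableSet_uIoc).2 hae)
  have hFTC := intervalIntegral.integral_eq_sub_of_hasDerivAt_of_le hR.le hcont
    (fun x hx => hgF x hx.2) hint
  have hg1 : g 1 = 0 := by rw [hg]; simp only [if_pos hR, Complex.ofReal_one, hF1]
  rw [hgR, hg1, sub_zero] at hFTC
  have h2 : ∫ x in (1 : ℝ)..R, f x = ((∫ x in (1 : ℝ)..R, (f x).re : ℝ) : ℂ) := by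
    rw [← intervalIntegral.integral_ofReal]
    exact (intervalIntegral.integral_congr_ae hae).symm
  exact ⟨_, hFTC.symm.trans h2, h2⟩

/-- First-order expansion of `C exp (κ B)` in `t = (R - z) ^ (1 / 2)`. -/
lemma isEquivalent_sqrt {l : Filter ℂ} {R : ℂ} (hl : l ≤ 𝓝 R) {B e G : ℂ → ℂ} {C κ : ℂ}
    (hB : HasDerivAt B (e 0) 0) (hne : C * Complex.exp (κ * B 0) * κ * e 0 ≠ 0)
    (hG : ∀ᶠ z in l, G z = B ((R - z) ^ (1 / 2 : ℂ))) :
    (fun z => C * Complex.exp (κ * G z) - C * Complex.exp (κ * B 0)) ~[l]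
      fun z => C * Complex.exp (κ * B 0) * κ * e 0 * (R - z) ^ (1 / 2 : ℂ) := by
  have ht : Tendsto (fun z => (R - z) ^ (1 / 2 : ℂ)) l (𝓝 0) :=
    (tendsto_cpow_half_sub R).mono_left hl
  have hq := (hasDerivAt_iff_isLittleO.1 ((hB.const_mul κ).cexp.const_mul C)).comp_tendsto ht
  rw [IsEquivalent]
  refine IsLittleO.congr' ((isLittleO_const_mul_right_iff hne).2 hq) ?_ ?_
  · filter_upwards [hG] with z hz
    simp only [Pi.sub_apply, Function.comp, hz, sub_zero, smul_eq_mul]; ring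
  · filter_upwards with z
    simp [Function.comp]

/-- Third-order expansion of `C exp (κ B)` in `t = (R - z) ^ (1 / 2)`, when `B' = -2 t p`. -/
lemma isEquivalent_sqrt_cubed {l : Filter ℂ} {R : ℂ} (hl : l ≤ 𝓝 R) {B p G : ℂ → ℂ}
    {C κ p' : ℂ} (hB : ∀ᶠ t in 𝓝 0, HasDerivAt B (-2 * t * p t) t) (hp : HasDerivAt p p' 0)
    (hne : C * Complex.exp (κ * B 0) * κ * p' ≠ 0)
    (hG : ∀ᶠ z in l, G z = B ((R - z) ^ (1 / 2 : ℂ))) :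
    (fun z => C * Complex.exp (κ * G z) -
        (C * Complex.exp (κ * B 0) - C * Complex.exp (κ * B 0) * κ * p 0 * (R - z))) ~[l]
      fun z => -(2 / 3) * (C * Complex.exp (κ * B 0) * κ * p') * (R - z) ^ (3 / 2 : ℂ) := by
  have ht : Tendsto (fun z => (R - z) ^ (1 / 2 : ℂ)) l (𝓝 0) :=
    (tendsto_cpow_half_sub R).mono_left hl
  set q : ℂ → ℂ := fun t => C * Complex.exp (κ * B t) with hq
  -- Here `q' = t r(t)`, so the linear term in `t` is absent. Integrating `t (r(0) + r₁ t + o(t))`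
  -- gives the terms `r(0) t² / 2` and `r₁ t³ / 3`, where `t² = R - z`.
  set r : ℂ → ℂ := fun t => -2 * κ * q t * p t with hr
  set r₁ : ℂ := -2 * κ * q 0 * p' with hr₁
  have hqd : ∀ᶠ t in 𝓝 0, HasDerivAt q (t * r t) t := by
    filter_upwards [hB] with t ht
    refine ((ht.const_mul κ).cexp.const_mul C).congr_deriv ?_
    simp only [hr, hq]; ring
  have hrd : HasDerivAt r r₁ 0 := by
    refine ((hqd.self_of_nhds.const_mul (-2 * κ)).mul hp).congr_deriv ?_
    simp only [hr₁]; ring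
  have hT := isLittleO_pow_succ_of_hasDerivAt (n := 2)
    (g := fun t => q t - q 0 - (r 0 / 2 * t ^ 2 + r₁ / 3 * t ^ 3))
    (g' := fun t => t * (r t - r 0 - r₁ * t)) (by simp)
    (by
      filter_upwards [hqd] with t ht
      refine ((ht.sub_const (q 0)).sub ((((hasDerivAt_id t).pow 2).const_mul (r 0 / 2)).add
        (((hasDerivAt_id t).pow 3).const_mul (r₁ / 3)))).congr_deriv ?_
      simp; ring)
    (by
      have h1 := hasDerivAt_iff_isLittleO.1 hrd
      have h2 := (isBigO_refl (fun t : ℂ => t) (𝓝 0)).mul_isLittleO h1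
      refine h2.congr (fun t => ?_) fun t => ?_
      · simp only [sub_zero, smul_eq_mul]; ring
      · simp only [sub_zero]; ring)
  have hT' := hT.comp_tendsto ht
  have hcube : ∀ z : ℂ, (R - z) ^ (3 / 2 : ℂ) = ((R - z) ^ (1 / 2 : ℂ)) ^ 3 := fun z => by
    rw [← Complex.cpow_nat_mul]; norm_num
  rw [IsEquivalent]
  have hne' : -(2 / 3) * (C * Complex.exp (κ * B 0) * κ * p') ≠ 0 :=
    mul_ne_zero (by norm_num) hne
  refine IsLittleO.congr' ((isLittleO_const_mul_right_iff hne').2 hT') ?_ ?_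
  · filter_upwards [hG] with z hz
    have hsq := cpow_half_sq (R - z)
    simp only [Pi.sub_apply, Function.comp, hz, hcube]
    set t := (R - z) ^ (1 / 2 : ℂ)
    rw [← hsq]
    simp only [hr, hr₁, hq]; ring
  · filter_upwards with z
    simp only [Function.comp, hcube]

namespace IsRetrialModel

variable {M : ℕ → ℂ → ℂ} {m : ℕ → ℝ → ℝ} {A a b u₀ us : ℝ}

/-! ### Noncontinuability -/

/-- A continuation of `h` would continue `uInv = a (h - 1) + b (z - 1)` with a finite derivative at
`R`. But that derivative times `1 - a M₁(uInv)` is `b ≠ 0`, while the second factor tends to `0`. -/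
lemma not_continuableAt_moment_uInv (H : IsRetrialModel M m A a b u₀ us) :
    ¬ ContinuableAt (fun z => M 0 (uInv M a b u₀ z)) (Metric.ball 0 (zMapReal m a b u₀))
      (zMapReal m a b u₀) := by
  rintro ⟨k, hk, hkg⟩
  set R := zMapReal m a b u₀
  have hR : 0 < R := one_pos.trans H.one_lt_zMapReal
  have := neBot_nhdsWithin_ball hR
  have hu₀ : ((u₀ : ℂ)).re < A := by simpa using H.u₀_lt
  have hbne : (b : ℂ) ≠ 0 := by exact_mod_cast H.hb.ne'
  have hev : (fun z => a * (k z - 1) + b * (z - 1)) =ᶠ[𝓝[Metric.ball 0 R] (R : ℂ)]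
      uInv M a b u₀ := by
    filter_upwards [hkg, self_mem_nhdsWithin] with z hz hzb
    have h1 := (H.uInv_spec (ball_subset_re_lt R hzb)).2
    rw [zMap] at h1
    simp only [hz]
    set u := uInv M a b u₀ z
    have h2 : (b : ℂ) * (z - 1) = u + a * (1 - M 0 u) := by
      rw [← h1]; field_simp; ring
    rw [h2]; ring
  have hlimu : Tendsto (uInv M a b u₀) (𝓝[Metric.ball 0 R] (R : ℂ)) (𝓝 u₀) :=
    H.tendsto_uInv.mono_left (nhdsWithin_mono _ (ball_subset_re_lt R))
  have hd := eventually_hasDerivAt_of_eventuallyEq Metric.isOpen_ball hev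
    fun z hz => H.hasDerivAt_uInv (ball_subset_re_lt R hz)
  have hka : AnalyticAt ℂ (fun z => a * (k z - 1) + b * (z - 1)) R := by fun_prop
  have h1 : ∀ᶠ z in 𝓝[Metric.ball 0 R] (R : ℂ),
      deriv (fun z => a * (k z - 1) + b * (z - 1)) z * (1 - a * M 1 (uInv M a b u₀ z)) = b := by
    filter_upwards [hd, self_mem_nhdsWithin] with z hz hzb
    rw [hz.deriv]
    exact div_mul_cancel₀ _
      (H.one_sub_moment_ne_zero (H.uInv_spec (ball_subset_re_lt R hzb)).1)
  have h2 := ((hka.deriv.continuousAt.tendsto.mono_left nhdsWithin_le_nhds).mul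
    (((((H.hasDerivAt 1 u₀ hu₀).continuousAt.tendsto.comp hlimu).const_mul (a : ℂ)).const_sub 1)))
  have h3 := tendsto_nhds_unique (h2.congr' h1) tendsto_const_nhds
  have h4 : (a : ℂ) * m 1 u₀ = 1 := by exact_mod_cast H.crit
  rw [H.ofReal 1 u₀ H.u₀_lt, h4, sub_self, mul_zero] at h3
  exact hbne h3.symm

lemma tendsto_uInv_ball (H : IsRetrialModel M m A a b u₀ us) :
    Tendsto (uInv M a b u₀) (𝓝[Metric.ball 0 (zMapReal m a b (min u₀ us))]
      (zMapReal m a b (min u₀ us) : ℂ)) (𝓝 (min u₀ us : ℝ)) :=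
  (H.tendsto_uInv_of_le (min_le_left _ _)).mono_left (nhdsWithin_mono _ (ball_subset_re_lt _))

/-- If `us ≤ u₀`, the denominator of `f₁` tends to `0` while the numerator tends to `b / (a + b)`.
If `u₀ < us`, solving for `h = (1 + z f₁) / (1 + f₁)` would continue `h` as well. -/
lemma not_continuableAt_f₁U_uInv (H : IsRetrialModel M m A a b u₀ us) :
    ¬ ContinuableAt (fun z => f₁U M a b (uInv M a b u₀ z))
      (Metric.ball 0 (zMapReal m a b (min u₀ us))) (zMapReal m a b (min u₀ us)) := by
  rintro ⟨k, hk, hkg⟩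
  set R := zMapReal m a b (min u₀ us) with hRdef
  have hR : 0 < R := one_pos.trans H.one_lt_zMapReal_min
  have := neBot_nhdsWithin_ball hR
  have hklim := hk.continuousAt.tendsto.mono_left
    (nhdsWithin_le_nhds (s := Metric.ball (0 : ℂ) R))
  have hlimu := H.tendsto_uInv_ball
  have hbne : (b : ℂ) ≠ 0 := by exact_mod_cast H.hb.ne'
  have hmA : min u₀ us < A := (min_le_left _ _).trans_lt H.u₀_lt
  have hmA' : ((min u₀ us : ℝ) : ℂ).re < A := by simpa only [Complex.ofReal_re] using hmA
  have hmem : ∀ z ∈ Metric.ball (0 : ℂ) R, z.re < R := ball_subset_re_lt R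
  rcases le_or_gt us u₀ with hle | hlt
  · have hev : ∀ᶠ z in 𝓝[Metric.ball 0 R] (R : ℂ), k z * kap M a b (uInv M a b u₀ z) =
        b * dslope (M 0) 0 (uInv M a b u₀ z) := by
      filter_upwards [hkg, self_mem_nhdsWithin] with z hz hzb
      rw [hz]
      exact div_mul_cancel₀ _ (H.kap_uInv_ne_zero (hmem z hzb))
    rw [min_eq_right hle] at hlimu hmA'
    have hN := (H.differentiableOn_dslope.differentiableAt
      ((isOpen_re_lt A).mem_nhds hmA')).continuousAt.tendsto.comp hlimu
    have hK := (H.differentiableOn_kap.differentiableAt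
      ((isOpen_re_lt A).mem_nhds hmA')).continuousAt.tendsto.comp hlimu
    rw [hRdef, min_eq_right hle] at hklim hev this
    have h1 := tendsto_nhds_unique ((hklim.mul hK).congr' hev) (hN.const_mul (b : ℂ))
    rw [H.kap_us, H.dslope_us, mul_zero] at h1
    have hab : (a : ℂ) + b ≠ 0 := by exact_mod_cast (add_pos H.ha H.hb).ne'
    exact mul_ne_zero hbne (one_div_ne_zero hab) h1.symm
  · rw [hRdef] at hkg hklim this hmem hR
    rw [min_eq_left hlt.le] at *
    refine H.not_continuableAt_moment_uInv ?_
    have hid : ∀ᶠ z in 𝓝[Metric.ball 0 (zMapReal m a b u₀)] (zMapReal m a b u₀ : ℂ),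
        k z * (M 0 (uInv M a b u₀ z) - z) = 1 - M 0 (uInv M a b u₀ z) := by
      filter_upwards [hkg, self_mem_nhdsWithin] with z hz hzb
      have h1 := H.f₁U_mul (H.kap_uInv_ne_zero (z := z)
        (by rw [min_eq_left hlt.le]; exact hmem z hzb))
      rw [(H.uInv_spec (hmem z hzb)).2] at h1
      rw [hz]; exact h1
    have hM := (H.hasDerivAt 0 _ hmA').continuousAt.tendsto.comp hlimu
    have hidz : Tendsto (fun z : ℂ => z) (𝓝[Metric.ball 0 (zMapReal m a b u₀)]
      (zMapReal m a b u₀ : ℂ)) (𝓝 (zMapReal m a b u₀ : ℂ)) := nhdsWithin_le_nhds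
    have hlim := tendsto_nhds_unique ((hklim.mul (hM.sub hidz)).congr' hid) (hM.const_sub 1)
    -- The value `-1` of `f₁` would turn `f₁ (h - z) = 1 - h` into `R = 1`.
    have hne : 1 + k (zMapReal m a b u₀) ≠ 0 := by
      intro h0
      have h1 : (zMapReal m a b u₀ : ℂ) = 1 := by
        linear_combination hlim - (M 0 u₀ - (zMapReal m a b u₀ : ℂ)) * h0
      exact H.one_lt_zMapReal.ne' (by exact_mod_cast h1)
    have hk' : AnalyticAt ℂ k (zMapReal m a b u₀ : ℂ) := by rw [← hRdef]; exact hk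
    refine ⟨fun z => (1 + k z * z) / (1 + k z), (analyticAt_const.add
      (hk'.mul analyticAt_id)).div (analyticAt_const.add hk') hne, ?_⟩
    have hne' : ∀ᶠ z in 𝓝[Metric.ball 0 (zMapReal m a b u₀)] (zMapReal m a b u₀ : ℂ),
        1 + k z ≠ 0 := (hklim.const_add 1).eventually_ne hne
    filter_upwards [hid, hne'] with z h1 h2
    rw [div_eq_iff h2]; linear_combination -h1

end IsRetrialModel
namespace IsRetrialModel

variable {M : ℕ → ℂ → ℂ} {m : ℕ → ℝ → ℝ} {A a b u₀ us : ℝ}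

/-! ### Local form at the singularity -/

/-- Translates the slope `-1 / √g` of the parametrization `ψ` into the constant `c_h = 1 / (a √g)`.
-/
lemma sqrt_mul_sqrt (H : IsRetrialModel M m A a b u₀ us) :
    a * √(a * m 2 u₀ / (2 * b)) * √(2 * b / (a ^ 3 * m 2 u₀)) = 1 := by
  have ha := H.ha
  have hb := H.hb
  have hm := H.pos 2 u₀ H.u₀_lt
  rw [mul_assoc, ← Real.sqrt_mul (by positivity)]
  have : a * m 2 u₀ / (2 * b) * (2 * b / (a ^ 3 * m 2 u₀)) = (1 / a) ^ 2 := by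
    field_simp
  rw [this, Real.sqrt_sq (by positivity)]
  field_simp

lemma eventually_sqrt_param_ne_zero (R : ℝ) :
    ∀ᶠ z in 𝓝[{z : ℂ | z.re < R}] (R : ℂ), ((R : ℂ) - z) ^ (1 / 2 : ℂ) ≠ 0 := by
  filter_upwards [self_mem_nhdsWithin] with z hz h0
  have hz : z.re < R := hz
  have := re_cpow_half_pos (z := (R : ℂ) - z) (Or.inl (by simpa using hz))
  rw [h0] at this; simp at this

/-- The continuation of `f₁` at a square-root singularity at which it is finite. -/
lemma exists_local_form_of_lt (H : IsRetrialModel M m A a b u₀ us) (hlt : u₀ < us) {F : ℂ → ℂ}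
    (hF : ∀ z : ℂ, z.re < zMapReal m a b u₀ → HasDerivAt F (f₁U M a b (uInv M a b u₀ z)) z) :
    ∃ B p : ℂ → ℂ, (∀ᶠ t in 𝓝 0, HasDerivAt B (-2 * t * p t) t) ∧ p 0 = f₁U M a b u₀ ∧
      HasDerivAt p (-((zMapReal m a b u₀ - 1) / (m 0 u₀ - zMapReal m a b u₀) ^ 2 *
        √(2 * b / (a ^ 3 * m 2 u₀)) : ℝ)) 0 ∧ ∃ δ > 0,
      (∀ z ∈ Metric.ball (zMapReal m a b u₀ : ℂ) δ,
        (zMapReal m a b u₀ : ℂ) - z ∈ Complex.slitPlane → DifferentiableAt ℂ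
          (fun z => B (((zMapReal m a b u₀ : ℂ) - z) ^ (1 / 2 : ℂ))) z) ∧
      ∀ z ∈ Metric.ball (zMapReal m a b u₀ : ℂ) δ, z.re < zMapReal m a b u₀ →
        F z = B (((zMapReal m a b u₀ : ℂ) - z) ^ (1 / 2 : ℂ)) := by
  obtain ⟨ψ, hψa, hψ0, hψd, -, hψ⟩ := H.exists_sqrt_param
  set R := zMapReal m a b u₀ with hRdef
  have hu₀ : ((u₀ : ℂ)).re < A := by simpa using H.u₀_lt
  have hk := H.kap_ofReal_ne_zero H.u₀_pos H.u₀_lt hlt.ne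
  have hu₀ne : (u₀ : ℂ) ≠ 0 := by exact_mod_cast H.u₀_pos.ne'
  have hmR : m 0 u₀ - R ≠ 0 := by
    intro h0
    have h1 := H.moment_sub_zMap u₀
    rw [H.zMap_ofReal H.u₀_lt, H.ofReal 0 u₀ H.u₀_lt, ← hRdef, ← Complex.ofReal_sub, h0] at h1
    have hbne : (b : ℂ) ≠ 0 := by exact_mod_cast H.hb.ne'
    have := div_ne_zero (neg_ne_zero.2 (mul_ne_zero hu₀ne hk)) hbne
    exact this (by rw [← h1]; simp)
  have hf : AnalyticAt ℂ (f₁U M a b) u₀ := by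
    have hNa : AnalyticAt ℂ (dslope (M 0) 0) u₀ :=
      H.differentiableOn_dslope.analyticAt ((isOpen_re_lt A).mem_nhds hu₀)
    have hKa : AnalyticAt ℂ (kap M a b) u₀ :=
      H.differentiableOn_kap.analyticAt ((isOpen_re_lt A).mem_nhds hu₀)
    exact (analyticAt_const.mul hNa).div hKa hk
  -- At `u₀` the derivative of `Z` vanishes and that of `M₀` is `1 / a`, so the quotient rule
  -- reduces to `M₀' (R - 1) / (M₀ - R)²`.
  have hfd : HasDerivAt (f₁U M a b) ((R - 1) / (a * (m 0 u₀ - R) ^ 2) : ℝ) u₀ := by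
    have hZ := H.hasDerivAt_zMap hu₀
    have hM := H.hasDerivAt 0 u₀ hu₀
    have h1 : (a : ℂ) * m 1 u₀ = 1 := by exact_mod_cast H.crit
    have hane : (a : ℂ) ≠ 0 := by exact_mod_cast H.ha.ne'
    have hden : M 0 u₀ - zMap M a b u₀ ≠ 0 := by
      rw [H.zMap_ofReal H.u₀_lt, H.ofReal 0 u₀ H.u₀_lt, ← hRdef]; exact_mod_cast hmR
    have hquot := (hM.const_sub 1).div (hM.sub hZ) hden
    have hev : f₁U M a b =ᶠ[𝓝 (u₀ : ℂ)] fun u => (1 - M 0 u) / (M 0 u - zMap M a b u) := by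
      filter_upwards [isOpen_ne.mem_nhds hu₀ne] with u hu using (H.f₁U_eq hu).symm
    refine (hquot.congr_of_eventuallyEq hev).congr_deriv ?_
    have hmRc : (m 0 u₀ : ℂ) - R ≠ 0 := by exact_mod_cast hmR
    simp only [zero_add, Pi.sub_apply]
    rw [H.zMap_ofReal H.u₀_lt, H.ofReal 0 u₀ H.u₀_lt, H.ofReal 1 u₀ H.u₀_lt, ← hRdef, h1]
    have h2 : (m 1 u₀ : ℂ) = 1 / a := by rw [eq_div_iff hane, mul_comm]; exact h1
    rw [h2]
    push_cast
    field_simp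
    ring
  have hpa : AnalyticAt ℂ (fun t => f₁U M a b (ψ t)) 0 :=
    AnalyticAt.comp (g := f₁U M a b) (by rw [hψ0]; exact hf) hψa
  have he : AnalyticAt ℂ (fun t => -2 * t * f₁U M a b (ψ t)) 0 :=
    (analyticAt_const.mul analyticAt_id).mul hpa
  obtain ⟨B, hB, hδ⟩ := exists_sqrt_primitive hF he (by
    filter_upwards [hψ] with z hz
    rw [hz]; ring)
  refine ⟨B, fun t => f₁U M a b (ψ t), hB, by simp only [hψ0], ?_, hδ⟩
  have hcomp := HasDerivAt.comp (h₂ := f₁U M a b) 0 (by rw [hψ0]; exact hfd) hψd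
  refine hcomp.congr_deriv ?_
  have hs := H.sqrt_mul_sqrt
  have hg : √(a * m 2 u₀ / (2 * b)) ≠ 0 := fun h0 => by rw [h0] at hs; simp at hs
  have hane := H.ha.ne'
  have h3 : √(2 * b / (a ^ 3 * m 2 u₀)) = 1 / (a * √(a * m 2 u₀ / (2 * b))) := by
    rw [eq_div_iff (mul_ne_zero hane hg)]; linarith
  rw [h3]
  have hmRc : (m 0 u₀ : ℂ) - R ≠ 0 := by exact_mod_cast hmR
  have hgc : (√(a * m 2 u₀ / (2 * b)) : ℂ) ≠ 0 := by exact_mod_cast hg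
  have hanec : (a : ℂ) ≠ 0 := by exact_mod_cast hane
  push_cast
  field_simp

/-- The continuation of `f₁` at a square-root singularity that is a root of `h(z) = z`. -/
lemma exists_local_form_of_eq (H : IsRetrialModel M m A a b u₀ us) (heq : u₀ = us) {F : ℂ → ℂ}
    (hF : ∀ z : ℂ, z.re < zMapReal m a b u₀ → HasDerivAt F (f₁U M a b (uInv M a b u₀ z)) z) :
    ∃ B e : ℂ → ℂ, (∀ᶠ t in 𝓝 0, HasDerivAt B (e t) t) ∧
      e 0 = (-2 * ((zMapReal m a b u₀ - 1) / √(2 * b / (a ^ 3 * m 2 u₀))) : ℝ) ∧ ∃ δ > 0,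
      (∀ z ∈ Metric.ball (zMapReal m a b u₀ : ℂ) δ,
        (zMapReal m a b u₀ : ℂ) - z ∈ Complex.slitPlane → DifferentiableAt ℂ
          (fun z => B (((zMapReal m a b u₀ : ℂ) - z) ^ (1 / 2 : ℂ))) z) ∧
      ∀ z ∈ Metric.ball (zMapReal m a b u₀ : ℂ) δ, z.re < zMapReal m a b u₀ →
        F z = B (((zMapReal m a b u₀ : ℂ) - z) ^ (1 / 2 : ℂ)) := by
  obtain ⟨ψ, hψa, hψ0, hψd, -, hψ⟩ := H.exists_sqrt_param
  set R := zMapReal m a b u₀ with hRdef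
  have hu₀ : ((u₀ : ℂ)).re < A := by simpa using H.u₀_lt
  have hane := H.ha.ne'
  have hbne := H.hb.ne'
  have hune := H.u₀_pos.ne'
  have hs := H.sqrt_mul_sqrt
  have hg : √(a * m 2 u₀ / (2 * b)) ≠ 0 := fun h0 => by rw [h0] at hs; simp at hs
  have hc : √(2 * b / (a ^ 3 * m 2 u₀)) ≠ 0 := fun h0 => by rw [h0] at hs; simp at hs
  have hNa : AnalyticAt ℂ (dslope (M 0) 0) u₀ :=
    H.differentiableOn_dslope.analyticAt ((isOpen_re_lt A).mem_nhds hu₀)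
  have hKa : AnalyticAt ℂ (kap M a b) u₀ :=
    H.differentiableOn_kap.analyticAt ((isOpen_re_lt A).mem_nhds hu₀)
  have hKψ : AnalyticAt ℂ (fun t => kap M a b (ψ t)) 0 :=
    AnalyticAt.comp (g := kap M a b) (by rw [hψ0]; exact hKa) hψa
  have hNψ : AnalyticAt ℂ (fun t => dslope (M 0) 0 (ψ t)) 0 :=
    AnalyticAt.comp (g := dslope (M 0) 0) (by rw [hψ0]; exact hNa) hψa
  -- Along `ψ` the function `kap` is `t k₁(t)` with `k₁(0) ≠ 0`. This `t` cancels the one in `dz =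
  -- -2t dt`, leaving an analytic integrand.
  set k₁ := dslope (fun t => kap M a b (ψ t)) 0 with hk₁
  have hk₁a : AnalyticAt ℂ k₁ 0 := analyticAt_dslope hKψ
  have hk0 : kap M a b (ψ 0) = 0 := by rw [hψ0, heq]; exact H.kap_us
  have hkt : ∀ t, kap M a b (ψ t) = t * k₁ t := fun t => by
    have := sub_smul_dslope (fun t => kap M a b (ψ t)) 0 t
    rw [sub_zero, hk0, sub_zero, smul_eq_mul] at this
    exact this.symm
  have hd := H.hasDerivAt_kap_us
  rw [← heq] at hd
  have hk₁0 : k₁ 0 = (b / (a * u₀ * √(a * m 2 u₀ / (2 * b))) : ℝ) := by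
    have hcomp := HasDerivAt.comp (h₂ := kap M a b) 0 (by rw [hψ0]; exact hd) hψd
    rw [hk₁, dslope_same]
    refine hcomp.deriv.trans ?_
    have h1 : m 1 u₀ = 1 / a := by rw [eq_div_iff hane, mul_comm]; exact H.crit
    rw [h1]
    have h2 : ((a + b) * (1 / a) - 1) / u₀ = b / (a * u₀) := by field_simp; ring
    rw [h2]
    have hgc : (√(a * m 2 u₀ / (2 * b)) : ℂ) ≠ 0 := by exact_mod_cast hg
    have hanec : (a : ℂ) ≠ 0 := by exact_mod_cast hane
    have hunec : (u₀ : ℂ) ≠ 0 := by exact_mod_cast hune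
    push_cast
    field_simp
  have hk₁ne : k₁ 0 ≠ 0 := by
    rw [hk₁0]
    exact_mod_cast div_ne_zero hbne (mul_ne_zero (mul_ne_zero hane hune) hg)
  have he : AnalyticAt ℂ (fun t => -2 * (b * dslope (M 0) 0 (ψ t)) / k₁ t) 0 :=
    (analyticAt_const.mul (analyticAt_const.mul hNψ)).div hk₁a hk₁ne
  obtain ⟨B, hB, hδ⟩ := exists_sqrt_primitive hF he (by
    filter_upwards [hψ, eventually_sqrt_param_ne_zero R] with z hz hne
    rw [hz, f₁U, hkt]
    set t := ((R : ℂ) - z) ^ (1 / 2 : ℂ)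
    rcases eq_or_ne (k₁ t) 0 with h0 | h0
    · simp [h0]
    · field_simp)
  refine ⟨B, _, hB, ?_, hδ⟩
  have hRu : u₀ = (a + b) * (R - 1) := by
    have h1 := H.mul_zMapReal_us_sub_one
    rw [← heq] at h1; exact h1.symm
  have h4 : √(2 * b / (a ^ 3 * m 2 u₀)) = 1 / (a * √(a * m 2 u₀ / (2 * b))) := by
    rw [eq_div_iff (mul_ne_zero hane hg)]; linarith
  have hN : dslope (M 0) 0 (u₀ : ℂ) = 1 / (a + b) := by rw [heq]; exact H.dslope_us
  rw [hk₁0, hψ0, hN, h4]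
  have hR1 : R - 1 ≠ 0 := fun h0 => hune (by rw [hRu, h0, mul_zero])
  have hab := (add_pos H.ha H.hb).ne'
  have h5 : -2 * (b * (1 / (a + b))) / (b / (a * u₀ * √(a * m 2 u₀ / (2 * b)))) =
      -2 * ((R - 1) / (1 / (a * √(a * m 2 u₀ / (2 * b))))) := by
    have h6 : R - 1 = u₀ / (a + b) := by rw [eq_div_iff hab, hRu]; ring
    rw [h6]; field_simp
  rw [← h5]
  push_cast
  rfl

/-- The continuation of `f₁` at a simple pole. -/
lemma exists_local_form_of_gt (H : IsRetrialModel M m A a b u₀ us) (hgt : us < u₀) :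
    ∃ reg P : ℂ → ℂ, ∃ δ > 0,
      (∀ z ∈ Metric.ball (zMapReal m a b us : ℂ) δ, HasDerivAt P (reg z) z) ∧
      (∀ z : ℂ, z.re < zMapReal m a b us → ContinuousAt reg z) ∧
      ContinuousAt reg (zMapReal m a b us) ∧
      ∀ z : ℂ, z.re < zMapReal m a b us → f₁U M a b (uInv M a b u₀ z) = reg z +
        ((zMapReal m a b us - 1) * (1 - a * m 1 us) / ((a + b) * m 1 us - 1) : ℝ) /
          ((zMapReal m a b us : ℂ) - z) := by
  set R := zMapReal m a b us with hRdef
  set W : Set ℂ := {z | z.re < zMapReal m a b u₀} with hW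
  have hWo : IsOpen W := isOpen_re_lt _
  have hRlt : R < zMapReal m a b u₀ :=
    H.strictMonoOn_zMapReal (mem_Iic.2 hgt.le) (mem_Iic.2 le_rfl) hgt
  have hRW : (R : ℂ) ∈ W := by simpa [hW] using hRlt
  have huA : ∀ z ∈ W, (uInv M a b u₀ z).re < A := fun z hz =>
    (H.uInv_spec hz).1.trans H.u₀_lt
  have hus : uInv M a b u₀ R = us := H.uInv_ofReal hgt
  have hud : DifferentiableOn ℂ (uInv M a b u₀) W := H.differentiableOn_uInv
  have hK : DifferentiableOn ℂ (fun z => kap M a b (uInv M a b u₀ z)) W :=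
    H.differentiableOn_kap.comp hud huA
  have hN : DifferentiableOn ℂ (fun z => dslope (M 0) 0 (uInv M a b u₀ z)) W :=
    H.differentiableOn_dslope.comp hud huA
  set K₁ := dslope (fun z => kap M a b (uInv M a b u₀ z)) R with hK₁
  have hK₁d : DifferentiableOn ℂ K₁ W := (Complex.differentiableOn_dslope (hWo.mem_nhds hRW)).2 hK
  have hKz : ∀ z : ℂ, kap M a b (uInv M a b u₀ z) = (z - R) * K₁ z := fun z => by
    have := sub_smul_dslope (fun z => kap M a b (uInv M a b u₀ z)) (R : ℂ) z
    rw [hus, H.kap_us, sub_zero, smul_eq_mul] at this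
    exact this.symm
  have ha1 : a * m 1 us < 1 := H.mul_moment_lt_one hgt
  have hab1 := H.one_lt_moment_us
  have hK₁R : K₁ R = (-(((a + b) * m 1 us - 1) / us) * (b / (1 - a * m 1 us)) : ℝ) := by
    have h1 := HasDerivAt.comp (h₂ := kap M a b) (R : ℂ)
      (by rw [hus]; exact H.hasDerivAt_kap_us) (H.hasDerivAt_uInv hRW)
    rw [hK₁, dslope_same]
    refine h1.deriv.trans ?_
    rw [hus, H.ofReal 1 us H.us_lt]
    push_cast; rfl
  have hK₁R0 : K₁ R ≠ 0 := by
    rw [hK₁R]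
    have h1 : ((a + b) * m 1 us - 1) / us ≠ 0 := (div_pos (by linarith) H.us_pos).ne'
    have h2 : b / (1 - a * m 1 us) ≠ 0 := (div_pos H.hb (by linarith)).ne'
    exact_mod_cast mul_ne_zero (neg_ne_zero.2 h1) h2
  -- The part of the half-plane free of further zeros of `kap`. On it `p = (R - z) f₁` is analytic,
  -- with `p(R)` the coefficient of the pole.
  set V : Set ℂ := W ∩ K₁ ⁻¹' {0}ᶜ with hV
  have hVo : IsOpen V := hK₁d.continuousOn.isOpen_inter_preimage hWo isOpen_compl_singleton
  have hRV : (R : ℂ) ∈ V := ⟨hRW, hK₁R0⟩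
  set p : ℂ → ℂ := fun z => -(b * dslope (M 0) 0 (uInv M a b u₀ z)) / K₁ z with hp
  have hpd : DifferentiableOn ℂ p V :=
    ((hN.mono inter_subset_left).const_mul _).neg.div (hK₁d.mono inter_subset_left)
      fun z hz => hz.2
  have hpR : p R = ((R - 1) * (1 - a * m 1 us) / ((a + b) * m 1 us - 1) : ℝ) := by
    have hRu : R - 1 = us / (a + b) := by
      rw [eq_div_iff (add_pos H.ha H.hb).ne', mul_comm]
      exact H.mul_zMapReal_us_sub_one
    simp only [hp]
    rw [hus, H.dslope_us, hK₁R, hRu]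
    have e1 : (1 - a * m 1 us) ≠ 0 := by linarith
    have e2 : ((a + b) * m 1 us - 1) ≠ 0 := by linarith
    have e3 := H.us_pos.ne'
    have e4 := (add_pos H.ha H.hb).ne'
    have e5 := H.hb.ne'
    have h7 : us / (a + b) * (1 - a * m 1 us) / ((a + b) * m 1 us - 1) =
        -(b * (1 / (a + b))) / (-(((a + b) * m 1 us - 1) / us) * (b / (1 - a * m 1 us))) := by
      field_simp
    rw [h7]; push_cast; rfl
  -- From `p(z) = p(R) + (z - R) dslope p R z`, division by `R - z` yields the pole and this regular
  -- part.
  set reg : ℂ → ℂ := fun z => -dslope p R z with hreg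
  have hregd : DifferentiableOn ℂ reg V :=
    ((Complex.differentiableOn_dslope (hVo.mem_nhds hRV)).2 hpd).neg
  have hregc : ∀ z ∈ V, ContinuousAt reg z := fun z hz =>
    (hregd.differentiableAt (hVo.mem_nhds hz)).continuousAt
  have hleft : ∀ z : ℂ, z.re < R → z ∈ V := fun z hz => by
    refine ⟨lt_trans hz hRlt, fun h0 => ?_⟩
    have h1 := H.kap_uInv_ne_zero (z := z) (by rw [min_eq_right hgt.le]; exact hz)
    rw [hKz, h0, mul_zero] at h1
    exact h1 rfl
  obtain ⟨δ, hδ, hball⟩ := Metric.isOpen_iff.1 hVo _ hRV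
  obtain ⟨P, hP⟩ := (hregd.mono hball).isExactOn_ball
  refine ⟨reg, P, δ, hδ, hP, fun z hz => hregc z (hleft z hz), hregc _ hRV, fun z hz => ?_⟩
  have hzV := hleft z hz
  have hne : (R : ℂ) - z ≠ 0 := fun h0 => by
    rw [← sub_eq_zero.1 h0, Complex.ofReal_re] at hz; exact lt_irrefl _ hz
  have hne' : z - (R : ℂ) ≠ 0 := fun h0 => hne (by linear_combination -h0)
  have h1 := sub_smul_dslope p (R : ℂ) z
  rw [smul_eq_mul, hpR] at h1
  have hK₁z : K₁ z ≠ 0 := hzV.2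
  have h2 : f₁U M a b (uInv M a b u₀ z) * ((R : ℂ) - z) = p z := by
    rw [f₁U, hKz]; simp only [hp]; field_simp; ring
  rw [eq_comm, ← eq_sub_iff_add_eq', div_eq_iff hne]
  simp only [hreg]
  linear_combination h1 - h2

end IsRetrialModel
namespace IsRetrialModel

variable {μ : Measure ℝ} {A a b u₀ us ν : ℝ}

/-! ### The functions `h`, `f₁`, `f₂` in terms of the inverse function -/

/-- A root with `|w| < 1` gives `u = a (w - 1) + b (z - 1)` with negative real part and `Z(u) = z`,
hence `u = uInv z`. Conversely `Re z < 1` forces `Re (uInv z) < 0`, hence `|M₀| < 1` there. -/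
lemma isRoot_iff (H : IsRetrialModel (cMoment μ) (rMoment μ) A a b u₀ us) {z w : ℂ}
    (hz : ‖z‖ < 1) :
    IsRoot μ a b z w ↔ w = cMoment μ 0 (uInv (cMoment μ) a b u₀ z) := by
  have hbne : (b : ℂ) ≠ 0 := by exact_mod_cast H.hb.ne'
  have hz1 : z.re < 1 := (Complex.re_le_norm z).trans_lt hz
  have hz0 : z.re < zMapReal (rMoment μ) a b u₀ := hz1.trans H.one_lt_zMapReal
  constructor
  · rintro ⟨hw, hwz⟩
    rw [LST_eq_cMoment] at hwz
    set u := -((a : ℂ) * (1 - w) + b * (1 - z)) with hu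
    have hw1 : w.re < 1 := (Complex.re_le_norm w).trans_lt hw
    have hure : u.re < u₀ := by
      have : u.re = -(a * (1 - w.re) + b * (1 - z.re)) := by simp [hu]
      rw [this]
      nlinarith [mul_pos H.ha (sub_pos.2 hw1), mul_pos H.hb (sub_pos.2 hz1), H.u₀_pos]
    have hZ : zMap (cMoment μ) a b u = z := by
      rw [zMap, ← hwz, hu]; field_simp; ring
    rw [H.uInv_eq hure hZ]; exact hwz
  · intro hw
    have hs := H.uInv_spec hz0
    set u := uInv (cMoment μ) a b u₀ z
    have hu0 : u.re < 0 := H.uInv_re_lt H.u₀_pos.le (by rw [H.zMapReal_zero]; exact hz1)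
    have huA := hu0.trans H.pos_bound
    refine ⟨?_, ?_⟩
    · rw [hw, ← H.zero]
      exact (H.norm_le 0 u huA).trans_lt (H.strictMonoOn 0 huA H.pos_bound hu0)
    · have h1 : -((a : ℂ) * (1 - w) + b * (1 - z)) = u := by
        rw [← hs.2, zMap, hw]; field_simp; ring
      rw [LST_eq_cMoment, h1]; exact hw

lemma iteratedDeriv_hRoot (H : IsRetrialModel (cMoment μ) (rMoment μ) A a b u₀ us) (n : ℕ) :
    iteratedDeriv n (hRoot μ a b) 0 =
      iteratedDeriv n (fun z => cMoment μ 0 (uInv (cMoment μ) a b u₀ z)) 0 := by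
  refine Filter.EventuallyEq.iteratedDeriv_eq n ?_
  filter_upwards [Metric.ball_mem_nhds (0 : ℂ) one_pos] with z hz
  have hz : ‖z‖ < 1 := by simpa using hz
  exact (H.isRoot_iff hz).1 (Classical.epsilon_spec (p := IsRoot μ a b z)
    ⟨_, (H.isRoot_iff hz).2 rfl⟩)

lemma h_eq (H : IsRetrialModel (cMoment μ) (rMoment μ) A a b u₀ us) {z : ℂ}
    (hz : ‖z‖ < zMapReal (rMoment μ) a b u₀) :
    PriorityRetrial.h μ a b z = cMoment μ 0 (uInv (cMoment μ) a b u₀ z) := by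
  obtain ⟨c, -, hc⟩ := H.exists_taylor_coeff
  rw [← (H.hasSum_moment_uInv hc hz).tsum_eq, PriorityRetrial.h]
  exact tsum_congr fun n => by rw [H.iteratedDeriv_hRoot, hc]

/-- The value at the singularity is the sum of the Taylor series on its circle of convergence, so it
requires the Abel-type limit `tsum_taylor_coeff`. -/
lemma h_critical (H : IsRetrialModel (cMoment μ) (rMoment μ) A a b u₀ us) :
    PriorityRetrial.h μ a b (zMapReal (rMoment μ) a b u₀ : ℂ) = rMoment μ 0 u₀ := by
  obtain ⟨c, hc0, hc⟩ := H.exists_taylor_coeff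
  rw [← H.tsum_taylor_coeff hc0 hc, PriorityRetrial.h]
  exact tsum_congr fun n => by rw [H.iteratedDeriv_hRoot, hc]

lemma h_zMapReal (H : IsRetrialModel (cMoment μ) (rMoment μ) A a b u₀ us) {y : ℝ} (hy0 : 0 ≤ y)
    (hy : y ≤ u₀) : PriorityRetrial.h μ a b (zMapReal (rMoment μ) a b y : ℂ) = rMoment μ 0 y := by
  rcases hy.eq_or_lt with rfl | hlt
  · exact H.h_critical
  · have h1 : 1 ≤ zMapReal (rMoment μ) a b y := by
      rw [← H.zMapReal_zero]
      exact H.strictMonoOn_zMapReal.monotoneOn (mem_Iic.2 H.u₀_pos.le) (mem_Iic.2 hy) hy0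
    have h2 := H.strictMonoOn_zMapReal (mem_Iic.2 hy) (mem_Iic.2 le_rfl) hlt
    rw [H.h_eq (by rwa [Complex.norm_real, norm_of_nonneg (by linarith)]), H.uInv_ofReal hlt,
      H.ofReal 0 y (hlt.trans H.u₀_lt)]

/-- The point `1` is excluded because `h(1) = 1` makes the defining quotient `0 / 0`. -/
lemma f₁_eq (H : IsRetrialModel (cMoment μ) (rMoment μ) A a b u₀ us) {z : ℂ}
    (hz : ‖z‖ < zMapReal (rMoment μ) a b u₀) (hz1 : z ≠ 1) :
    f₁ μ a b z = f₁U (cMoment μ) a b (uInv (cMoment μ) a b u₀ z) := by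
  have hs := H.uInv_spec ((Complex.re_le_norm z).trans_lt hz)
  have hne : uInv (cMoment μ) a b u₀ z ≠ 0 := by
    intro h0
    refine hz1 ?_
    rw [← hs.2, h0, zMap, H.zero_eq_one]; simp
  rw [← H.f₁U_eq hne, hs.2, f₁, H.h_eq hz]

lemma f₁_critical (H : IsRetrialModel (cMoment μ) (rMoment μ) A a b u₀ us) :
    f₁ μ a b (zMapReal (rMoment μ) a b u₀ : ℂ) = f₁U (cMoment μ) a b u₀ := by
  rw [← H.f₁U_eq (by exact_mod_cast H.u₀_pos.ne'), H.zMap_ofReal H.u₀_lt, f₁, H.h_critical,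
    H.ofReal 0 u₀ H.u₀_lt]

/-- With `x = Z(y)`, `0 < y ≤ u₀`, the equation `h(x) = x` reads `(a + b) (M₀(y) - 1) = y`, whose
only positive root is `us`. The set of zeros is therefore empty or a singleton. -/
lemma isRstar_iff (H : IsRetrialModel (cMoment μ) (rMoment μ) A a b u₀ us) {r : ℝ} :
    IsRstar μ a b (zMapReal (rMoment μ) a b u₀) r ↔
      us ≤ u₀ ∧ r = zMapReal (rMoment μ) a b us := by
  have key : ∀ x : ℝ, (1 < x ∧ x ≤ zMapReal (rMoment μ) a b u₀ ∧
      PriorityRetrial.h μ a b (x : ℂ) = x) ↔ us ≤ u₀ ∧ x = zMapReal (rMoment μ) a b us := by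
    intro x
    constructor
    · rintro ⟨h1, h2, h3⟩
      obtain ⟨y, hy, rfl⟩ : ∃ y ≤ u₀, zMapReal (rMoment μ) a b y = x := by
        rcases h2.eq_or_lt with rfl | hlt
        · exact ⟨u₀, le_rfl, rfl⟩
        · obtain ⟨y, hy, hyx⟩ := H.exists_zMapReal_eq hlt
          exact ⟨y, hy.le, hyx⟩
      have hy0 : 0 < y := by
        rw [← H.zMapReal_zero] at h1
        exact (H.strictMonoOn_zMapReal.lt_iff_lt (mem_Iic.2 H.u₀_pos.le) (mem_Iic.2 hy)).1 h1
      rw [H.h_zMapReal hy0.le hy] at h3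
      have h4 : rMoment μ 0 y = zMapReal (rMoment μ) a b y := by exact_mod_cast h3
      have hyA := hy.trans_lt H.u₀_lt
      have hbne := H.hb.ne'
      have h5 : y = us := by
        refine H.star_unique hy0 hyA ?_
        rw [zMapReal] at h4
        have h6 : b * (rMoment μ 0 y - 1) = y + a * (1 - rMoment μ 0 y) := by
          have h7 : rMoment μ 0 y - 1 = (y + a * (1 - rMoment μ 0 y)) / b := by linarith
          rw [h7]; field_simp
        linarith
      exact ⟨h5 ▸ hy, by rw [h5]⟩
    · rintro ⟨hle, rfl⟩
      refine ⟨?_, ?_, ?_⟩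
      · rw [← H.zMapReal_zero]
        exact H.strictMonoOn_zMapReal (mem_Iic.2 H.u₀_pos.le) (mem_Iic.2 hle) H.us_pos
      · exact H.strictMonoOn_zMapReal.monotoneOn (mem_Iic.2 hle) (mem_Iic.2 le_rfl) hle
      · rw [H.h_zMapReal H.us_pos.le hle]
        have h1 := H.mul_zMapReal_us_sub_one
        have h2 := H.star
        have hab := (add_pos H.ha H.hb).ne'
        have h3 := mul_left_cancel₀ hab (h1.trans h2.symm)
        norm_cast; linarith
  have hset : {x : ℝ | 1 < x ∧ x ≤ zMapReal (rMoment μ) a b u₀ ∧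
      PriorityRetrial.h μ a b (x : ℂ) = x} =
      {x | us ≤ u₀ ∧ x = zMapReal (rMoment μ) a b us} := Set.ext key
  rw [IsRstar, hset]
  constructor
  · exact fun h => h.1
  · exact fun h => ⟨h, fun x hx => by rw [h.2, hx.2]⟩

lemma f₂_eq (H : IsRetrialModel (cMoment μ) (rMoment μ) A a b u₀ us) {F : ℂ → ℂ} (hF1 : F 1 = 0)
    (hF : ∀ z : ℂ, z.re < zMapReal (rMoment μ) a b (min u₀ us) →
      HasDerivAt F (f₁U (cMoment μ) a b (uInv (cMoment μ) a b u₀ z)) z) {z : ℂ}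
    (hz : ‖z‖ < zMapReal (rMoment μ) a b (min u₀ us)) :
    f₂ μ a b ν z = (((a + b) / ν : ℝ) : ℂ) * F z := by
  rcases eq_or_ne z 1 with rfl | hz1
  · simp [f₂, hF1]
  set R := zMapReal (rMoment μ) a b (min u₀ us)
  have hR1 : 1 < R := H.one_lt_zMapReal_min
  have hmem : ∀ t ∈ Set.Icc (0 : ℝ) 1, ‖z + (t : ℂ) * (1 - z)‖ < R := fun t ht => by
    have := (convex_ball (0 : ℂ) R).add_smul_sub_mem (x := z) (y := 1) (by simpa using hz)
      (by simpa using hR1) ht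
    simpa using this
  have hder : ∀ t ∈ Set.uIcc (0 : ℝ) 1, HasDerivAt (fun t : ℝ => F (z + (t : ℂ) * (1 - z)))
      (f₁U (cMoment μ) a b (uInv (cMoment μ) a b u₀ (z + (t : ℂ) * (1 - z))) * (1 - z)) t := by
    intro t ht
    rw [uIcc_of_le zero_le_one] at ht
    have h1 : HasDerivAt (fun t : ℂ => z + t * (1 - z)) (1 - z) (t : ℂ) := by
      simpa using ((hasDerivAt_id (t : ℂ)).mul_const (1 - z)).const_add z
    exact ((hF _ ((Complex.re_le_norm _).trans_lt (hmem t ht))).comp (t : ℂ) h1).comp_ofReal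
  have hcont : ContinuousOn (fun t : ℝ => f₁U (cMoment μ) a b
      (uInv (cMoment μ) a b u₀ (z + (t : ℂ) * (1 - z))) * (1 - z)) (Set.uIcc (0 : ℝ) 1) := by
    refine ContinuousOn.mul ?_ continuousOn_const
    refine H.differentiableOn_f₁U_uInv.continuousOn.comp (by fun_prop) fun t ht => ?_
    rw [uIcc_of_le zero_le_one] at ht
    exact (Complex.re_le_norm _).trans_lt (hmem t ht)
  have hint := intervalIntegral.integral_eq_sub_of_hasDerivAt hder hcont.intervalIntegrable
  have hcongr : ∫ t in (0 : ℝ)..1, f₁ μ a b (z + (t : ℂ) * (1 - z)) = ∫ t in (0 : ℝ)..1,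
      f₁U (cMoment μ) a b (uInv (cMoment μ) a b u₀ (z + (t : ℂ) * (1 - z))) := by
    -- Only the endpoint `t = 1`, where the segment reaches `1`, has to be discarded.
    refine intervalIntegral.integral_congr_ae ?_
    have : ∀ᵐ t : ℝ ∂volume, t ≠ 1 := by simp [ae_iff]
    filter_upwards [this] with t ht1 ht
    rw [uIoc_of_le zero_le_one] at ht
    refine H.f₁_eq ((hmem t ⟨ht.1.le, ht.2⟩).trans_le H.zMapReal_min_le) fun h0 => ?_
    have h2 : (1 - (t : ℂ)) * (1 - z) = 0 := by linear_combination -h0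
    rcases mul_eq_zero.1 h2 with h3 | h3
    · exact ht1 (by exact_mod_cast (sub_eq_zero.1 h3).symm)
    · exact hz1 (sub_eq_zero.1 h3).symm
  rw [intervalIntegral.integral_mul_const] at hint
  rw [f₂, hcongr, mul_comm (1 - z), hint]
  simp [hF1]

/-- At the singularity the integral is improper; positivity of `f₁` between `1` and `R` makes it
converge to the limit of the primitive. -/
lemma f₂_singularity (H : IsRetrialModel (cMoment μ) (rMoment μ) A a b u₀ us) {F : ℂ → ℂ}
    {ℓ : ℂ} (hF1 : F 1 = 0)
    (hF : ∀ z : ℂ, z.re < zMapReal (rMoment μ) a b (min u₀ us) →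
      HasDerivAt F (f₁U (cMoment μ) a b (uInv (cMoment μ) a b u₀ z)) z)
    (hlim : Tendsto F (𝓝[{z : ℂ | z.re < zMapReal (rMoment μ) a b (min u₀ us)}]
      (zMapReal (rMoment μ) a b (min u₀ us) : ℂ)) (𝓝 ℓ)) :
    f₂ μ a b ν (zMapReal (rMoment μ) a b (min u₀ us) : ℂ) = (((a + b) / ν : ℝ) : ℂ) * ℓ ∧
      ∃ β : ℝ, ℓ = β := by
  set R := zMapReal (rMoment μ) a b (min u₀ us)
  have hR1 : 1 < R := H.one_lt_zMapReal_min
  obtain ⟨β, hβ, hint⟩ := integral_eq_of_real_nonneg hR1 hF1 hF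
    (fun x h1 h2 => H.f₁U_real_nonneg h1 h2) hlim
  refine ⟨?_, β, hβ⟩
  have hsub := intervalIntegral.smul_integral_comp_add_mul (a := 0) (b := 1)
    (fun x : ℝ => f₁ μ a b (x : ℂ)) (1 - R) R
  have hcongr : ∫ x in (1 : ℝ)..R, f₁ μ a b (x : ℂ) = ∫ x in (1 : ℝ)..R,
      f₁U (cMoment μ) a b (uInv (cMoment μ) a b u₀ (x : ℂ)) := by
    refine intervalIntegral.integral_congr_ae ?_
    have : ∀ᵐ t : ℝ ∂volume, t ≠ R := by simp [ae_iff]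
    filter_upwards [this] with t htR ht
    rw [uIoc_of_le hR1.le] at ht
    refine H.f₁_eq ?_ fun h0 => ?_
    · rw [Complex.norm_real, norm_of_nonneg (by linarith [ht.1])]
      exact (lt_of_le_of_ne ht.2 htR).trans_le H.zMapReal_min_le
    · exact ht.1.ne' (by exact_mod_cast h0)
  have h1 : ((1 : ℂ) - R) * ∫ t in (0 : ℝ)..1, f₁ μ a b (R + (t : ℂ) * (1 - R)) = -ℓ := by
    rw [hβ, ← hint, ← hcongr, ← intervalIntegral.integral_symm]
    have h2 : R + (1 - R) * 1 = 1 := by ring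
    rw [mul_zero, add_zero, h2] at hsub
    rw [← hsub, Complex.real_smul]
    push_cast
    congr 1
    refine intervalIntegral.integral_congr fun t _ => ?_
    simp only [mul_comm]
  rw [f₂, h1]; ring

/-- A local form of the continuation of `f₂` gives the continuation of `Q` to a Delta-domain. -/
lemma exists_Q_continuation (H : IsRetrialModel (cMoment μ) (rMoment μ) A a b u₀ us)
    {F L : ℂ → ℂ} {δ : ℝ} (hδ : 0 < δ) (hF1 : F 1 = 0)
    (hF : ∀ z : ℂ, z.re < zMapReal (rMoment μ) a b (min u₀ us) →
      HasDerivAt F (f₁U (cMoment μ) a b (uInv (cMoment μ) a b u₀ z)) z)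
    (hL : ∀ z ∈ Metric.ball (zMapReal (rMoment μ) a b (min u₀ us) : ℂ) δ,
      (zMapReal (rMoment μ) a b (min u₀ us) : ℂ) - z ∈ Complex.slitPlane → DifferentiableAt ℂ L z)
    (hFL : ∀ z ∈ Metric.ball (zMapReal (rMoment μ) a b (min u₀ us) : ℂ) δ,
      z.re < zMapReal (rMoment μ) a b (min u₀ us) → F z = L z) :
    ∃ S, zMapReal (rMoment μ) a b (min u₀ us) < S ∧ ∃ G : ℂ → ℂ,
      AnalyticOnNhd ℂ (fun z => ((1 - load μ a b : ℝ) : ℂ) *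
        Complex.exp ((((a + b) / ν : ℝ) : ℂ) * G z))
        (DeltaDomain (zMapReal (rMoment μ) a b (min u₀ us)) S (π / 4)) ∧
      EqOn (fun z => ((1 - load μ a b : ℝ) : ℂ) * Complex.exp ((((a + b) / ν : ℝ) : ℂ) * G z))
        (Q μ a b ν) (Metric.ball 0 (zMapReal (rMoment μ) a b (min u₀ us))) ∧
      ∀ᶠ z in 𝓝[DeltaDomain (zMapReal (rMoment μ) a b (min u₀ us)) S (π / 4)]
        (zMapReal (rMoment μ) a b (min u₀ us) : ℂ), G z = L z := by
  obtain ⟨S, hS, G, hG, hGF, hGL⟩ := exists_deltaDomain_extension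
    (one_pos.trans H.one_lt_zMapReal_min) hδ
    (fun z hz => (hF z hz).differentiableAt.differentiableWithinAt) hL hFL
  refine ⟨S, hS, G, fun z hz => analyticAt_const.mul (analyticAt_const.mul (hG z hz)).cexp,
    fun z hz => ?_, hGL⟩
  simp only [Q]
  rw [H.f₂_eq hF1 hF (by simpa using hz), hGF z (ball_subset_re_lt _ hz)]

lemma isDominantSingularity_h (H : IsRetrialModel (cMoment μ) (rMoment μ) A a b u₀ us) :
    IsDominantSingularity (PriorityRetrial.h μ a b) (zMapReal (rMoment μ) a b u₀) := by
  have hR := one_pos.trans H.one_lt_zMapReal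
  refine isDominantSingularity_of_re_lt hR (H.differentiableOn_moment_uInv 0) ?_
    H.not_continuableAt_moment_uInv
  filter_upwards [Metric.ball_mem_nhds (0 : ℂ) hR] with z hz
  exact (H.h_eq (by simpa using hz)).symm

lemma isDominantSingularity_f₁ (H : IsRetrialModel (cMoment μ) (rMoment μ) A a b u₀ us) :
    IsDominantSingularity (f₁ μ a b) (zMapReal (rMoment μ) a b (min u₀ us)) := by
  refine isDominantSingularity_of_re_lt (one_pos.trans H.one_lt_zMapReal_min)
    H.differentiableOn_f₁U_uInv ?_ H.not_continuableAt_f₁U_uInv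
  filter_upwards [Metric.ball_mem_nhds (0 : ℂ) one_pos] with z hz
  have hz : ‖z‖ < 1 := by simpa using hz
  refine (H.f₁_eq (hz.trans H.one_lt_zMapReal) ?_).symm
  rintro rfl
  simp at hz

lemma isDominantSingularity_Q (H : IsRetrialModel (cMoment μ) (rMoment μ) A a b u₀ us)
    {F : ℂ → ℂ} (hF1 : F 1 = 0)
    (hF : ∀ z : ℂ, z.re < zMapReal (rMoment μ) a b (min u₀ us) →
      HasDerivAt F (f₁U (cMoment μ) a b (uInv (cMoment μ) a b u₀ z)) z)
    (hn : ¬ ContinuableAt (fun z => ((1 - load μ a b : ℝ) : ℂ) *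
        Complex.exp ((((a + b) / ν : ℝ) : ℂ) * F z))
      (Metric.ball 0 (zMapReal (rMoment μ) a b (min u₀ us)))
      (zMapReal (rMoment μ) a b (min u₀ us))) :
    IsDominantSingularity (Q μ a b ν) (zMapReal (rMoment μ) a b (min u₀ us)) := by
  have hR := one_pos.trans H.one_lt_zMapReal_min
  refine isDominantSingularity_of_re_lt hR (fun z hz => ?_) ?_ hn
  · exact (((hF z hz).const_mul _).cexp.const_mul _).differentiableAt.differentiableWithinAt
  · filter_upwards [Metric.ball_mem_nhds (0 : ℂ) hR] with z hz
    rw [Q, H.f₂_eq hF1 hF (by simpa using hz)]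

end IsRetrialModel
namespace IsRetrialModel

variable {μ : Measure ℝ} {A a b u₀ us ν : ℝ}

/-! ### The three cases -/

lemma cF1_eq (H : IsRetrialModel (cMoment μ) (rMoment μ) A a b u₀ us) :
    cF1 μ a b (zMapReal (rMoment μ) a b us) = (zMapReal (rMoment μ) a b us - 1) *
      (1 - a * rMoment μ 1 us) / ((a + b) * rMoment μ 1 us - 1) := by
  have h1 : (a + b) * (1 - zMapReal (rMoment μ) a b us) = -us := by
    linarith [H.mul_zMapReal_us_sub_one]
  rw [cF1, h1, deriv_realLST H.toIsMomentFamily H.us_lt]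
  rw [← neg_div_neg_eq]
  congr 1 <;> ring

lemma cH_eq (H : IsRetrialModel (cMoment μ) (rMoment μ) A a b u₀ us) :
    cH μ a b (zMapReal (rMoment μ) a b u₀) = √(2 * b / (a ^ 3 * rMoment μ 2 u₀)) := by
  have hbne := H.hb.ne'
  have h1 : a * (1 - rMoment μ 0 u₀) + b * (1 - zMapReal (rMoment μ) a b u₀) = -u₀ := by
    rw [zMapReal]; field_simp; ring
  rw [cH, H.h_critical, Complex.ofReal_re, h1, iteratedDeriv_two_realLST H.toIsMomentFamily H.u₀_lt]

lemma cH_pos (H : IsRetrialModel (cMoment μ) (rMoment μ) A a b u₀ us) :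
    0 < cH μ a b (zMapReal (rMoment μ) a b u₀) := by
  have h1 := H.pos 2 u₀ H.u₀_lt
  have ha := H.ha
  have hb := H.hb
  rw [H.cH_eq]; positivity

lemma tendsto_of_sqrt_form {R δ : ℝ} (hδ : 0 < δ) {F B : ℂ → ℂ} (hB : ContinuousAt B 0)
    (hFB : ∀ z ∈ Metric.ball (R : ℂ) δ, z.re < R → F z = B (((R : ℂ) - z) ^ (1 / 2 : ℂ))) :
    Tendsto F (𝓝[{z : ℂ | z.re < R}] (R : ℂ)) (𝓝 (B 0)) := by
  have h := (hB.tendsto.comp (tendsto_cpow_half_sub (R : ℂ))).mono_left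
    (nhdsWithin_le_nhds (s := {z : ℂ | z.re < R}))
  refine h.congr' ?_
  filter_upwards [self_mem_nhdsWithin, mem_nhdsWithin_of_mem_nhds (Metric.ball_mem_nhds _ hδ)]
    with z h1 h2 using (hFB z h2 h1).symm

/-- The continuation of `Q` at a square-root singularity of `f₁`. -/
lemma Q_at_critical (H : IsRetrialModel (cMoment μ) (rMoment μ) A a b u₀ us) (hν : 0 < ν)
    (hload : PriorityRetrial.load μ a b < 1) (hmin : min u₀ us = u₀) {F B : ℂ → ℂ} {δ : ℝ}
    (hδ : 0 < δ) (hF1 : F 1 = 0)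
    (hF : ∀ z : ℂ, z.re < zMapReal (rMoment μ) a b u₀ →
      HasDerivAt F (f₁U (cMoment μ) a b (uInv (cMoment μ) a b u₀ z)) z)
    (hB : ContinuousAt B 0)
    (hL : ∀ z ∈ Metric.ball (zMapReal (rMoment μ) a b u₀ : ℂ) δ,
        (zMapReal (rMoment μ) a b u₀ : ℂ) - z ∈ Complex.slitPlane → DifferentiableAt ℂ
          (fun z => B (((zMapReal (rMoment μ) a b u₀ : ℂ) - z) ^ (1 / 2 : ℂ))) z)
    (hFB : ∀ z ∈ Metric.ball (zMapReal (rMoment μ) a b u₀ : ℂ) δ,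
      z.re < zMapReal (rMoment μ) a b u₀ →
        F z = B (((zMapReal (rMoment μ) a b u₀ : ℂ) - z) ^ (1 / 2 : ℂ))) :
    IsDominantSingularity (Q μ a b ν) (zMapReal (rMoment μ) a b u₀) ∧
      Q μ a b ν (zMapReal (rMoment μ) a b u₀ : ℂ) = ((1 - PriorityRetrial.load μ a b : ℝ) : ℂ) *
        Complex.exp ((((a + b) / ν : ℝ) : ℂ) * B 0) ∧
      Complex.exp ((((a + b) / ν : ℝ) : ℂ) * B 0) =
        (Real.exp (f₂ μ a b ν (zMapReal (rMoment μ) a b u₀ : ℂ)).re : ℝ) ∧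
      ∃ S, zMapReal (rMoment μ) a b u₀ < S ∧ ∃ G : ℂ → ℂ,
        AnalyticOnNhd ℂ (fun z => ((1 - PriorityRetrial.load μ a b : ℝ) : ℂ) *
          Complex.exp ((((a + b) / ν : ℝ) : ℂ) * G z))
          (DeltaDomain (zMapReal (rMoment μ) a b u₀) S (π / 4)) ∧
        EqOn (fun z => ((1 - PriorityRetrial.load μ a b : ℝ) : ℂ) *
          Complex.exp ((((a + b) / ν : ℝ) : ℂ) * G z))
          (Q μ a b ν) (Metric.ball 0 (zMapReal (rMoment μ) a b u₀)) ∧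
        ∀ᶠ z in 𝓝[DeltaDomain (zMapReal (rMoment μ) a b u₀) S (π / 4)]
          (zMapReal (rMoment μ) a b u₀ : ℂ),
          G z = B (((zMapReal (rMoment μ) a b u₀ : ℂ) - z) ^ (1 / 2 : ℂ)) := by
  have hlim := tendsto_of_sqrt_form hδ hB hFB
  have hC : ((1 - PriorityRetrial.load μ a b : ℝ) : ℂ) ≠ 0 := by
    exact_mod_cast (sub_pos.2 hload).ne'
  have hκ : (((a + b) / ν : ℝ) : ℂ) ≠ 0 := by
    exact_mod_cast (div_pos (add_pos H.ha H.hb) hν).ne'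
  have hR := one_pos.trans H.one_lt_zMapReal
  have hn := H.not_continuableAt_f₁U_uInv
  have hdom := H.isDominantSingularity_Q (ν := ν) hF1
  have hsing := H.f₂_singularity (ν := ν) (ℓ := B 0) hF1
  have hcont := H.exists_Q_continuation (ν := ν) hδ hF1 (L := fun z =>
    B (((zMapReal (rMoment μ) a b u₀ : ℂ) - z) ^ (1 / 2 : ℂ)))
  rw [hmin] at hn hdom hsing hcont
  obtain ⟨hf₂, β, hβ⟩ := hsing hF hlim
  refine ⟨hdom hF fun hcon => hn ?_, by rw [Q, hf₂], ?_, hcont hF hL hFB⟩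
  · exact continuableAt_of_exp hC hκ hR (fun z hz => hF z (ball_subset_re_lt _ hz))
      (hlim.mono_left (nhdsWithin_mono _ (ball_subset_re_lt _))) hcon
  · rw [hf₂, hβ, ← Complex.ofReal_mul, Complex.ofReal_re, Complex.ofReal_exp]

/-- Here `B' = -2 t p` with `p(0) = f₁(R)` and `p'(0) = -c_{f₁}^{(2)}`: the former gives the linear
term in `R - z`, the latter the power `3/2`. -/
lemma Q_of_lt (H : IsRetrialModel (cMoment μ) (rMoment μ) A a b u₀ us) (hν : 0 < ν)
    (hload : PriorityRetrial.load μ a b < 1) (hlt : u₀ < us) :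
    IsDominantSingularity (Q μ a b ν) (zMapReal (rMoment μ) a b u₀) ∧
      ∃ S, zMapReal (rMoment μ) a b u₀ < S ∧ ∃ Qc : ℂ → ℂ,
        AnalyticOnNhd ℂ Qc (DeltaDomain (zMapReal (rMoment μ) a b u₀) S (π / 4)) ∧
        EqOn Qc (Q μ a b ν) (Metric.ball 0 (zMapReal (rMoment μ) a b u₀)) ∧
        (fun z : ℂ => Qc z - (Q μ a b ν (zMapReal (rMoment μ) a b u₀ : ℂ) -
            (cQlin μ a b ν (zMapReal (rMoment μ) a b u₀) : ℂ) *
              ((zMapReal (rMoment μ) a b u₀ : ℂ) - z)))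
          ~[𝓝[DeltaDomain (zMapReal (rMoment μ) a b u₀) S (π / 4)]
            (zMapReal (rMoment μ) a b u₀ : ℂ)] fun z : ℂ =>
            (cQ2 μ a b ν (zMapReal (rMoment μ) a b u₀) : ℂ) *
              ((zMapReal (rMoment μ) a b u₀ : ℂ) - z) ^ (3 / 2 : ℂ) := by
  obtain ⟨F, hF1, hF⟩ := H.exists_primitive
  have hmin : min u₀ us = u₀ := min_eq_left hlt.le
  rw [hmin] at hF
  obtain ⟨B, p, hB, hp0, hp, δ, hδ, hL, hFB⟩ := H.exists_local_form_of_lt hlt hF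
  obtain ⟨hdom, hQR, hexp, S, hS, G, hG, hGQ, hGL⟩ := H.Q_at_critical hν hload hmin hδ hF1 hF
    hB.self_of_nhds.continuousAt hL hFB
  have hcH := H.cH_eq
  have hcH0 := H.cH_pos
  have hf₁R := H.f₁_critical
  have hhR := H.h_critical
  have hR1 := H.one_lt_zMapReal
  set R := zMapReal (rMoment μ) a b u₀ with hRdef
  have hf₁re : ((f₁ μ a b (R : ℂ)).re : ℂ) = f₁ μ a b (R : ℂ) := by
    rw [f₁, hhR]
    norm_cast
  have hmR : rMoment μ 0 u₀ - R ≠ 0 := by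
    intro h0
    have h1 := H.moment_sub_zMap u₀
    rw [H.zMap_ofReal H.u₀_lt, H.ofReal 0 u₀ H.u₀_lt, ← hRdef, ← Complex.ofReal_sub, h0] at h1
    have hbne : (b : ℂ) ≠ 0 := by exact_mod_cast H.hb.ne'
    have hune : (u₀ : ℂ) ≠ 0 := by exact_mod_cast H.u₀_pos.ne'
    exact div_ne_zero (neg_ne_zero.2 (mul_ne_zero hune
      (H.kap_ofReal_ne_zero H.u₀_pos H.u₀_lt hlt.ne))) hbne (by rw [← h1]; simp)
  have hcF2 : cF2 μ a b R = (R - 1) / (rMoment μ 0 u₀ - R) ^ 2 *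
      √(2 * b / (a ^ 3 * rMoment μ 2 u₀)) := by
    rw [cF2, hhR, Complex.ofReal_re, hcH]
  have hcF20 : cF2 μ a b R ≠ 0 := by
    rw [cF2, hhR, Complex.ofReal_re]
    exact mul_ne_zero (div_ne_zero (by linarith) (pow_ne_zero 2 hmR)) hcH0.ne'
  rw [← hcF2] at hp
  have hC : ((1 - PriorityRetrial.load μ a b : ℝ) : ℂ) ≠ 0 := by
    exact_mod_cast (sub_pos.2 hload).ne'
  have hκ : (((a + b) / ν : ℝ) : ℂ) ≠ 0 := by
    exact_mod_cast (div_pos (add_pos H.ha H.hb) hν).ne'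
  have key := isEquivalent_sqrt_cubed (l := 𝓝[DeltaDomain R S (π / 4)] (R : ℂ))
    nhdsWithin_le_nhds hB hp (mul_ne_zero (mul_ne_zero (mul_ne_zero hC (Complex.exp_ne_zero _)) hκ)
      (by exact_mod_cast neg_ne_zero.2 hcF20)) hGL
  refine ⟨hdom, S, hS, _, hG, hGQ, ?_⟩
  have e1 : ((1 - PriorityRetrial.load μ a b : ℝ) : ℂ) *
      Complex.exp ((((a + b) / ν : ℝ) : ℂ) * B 0) * (((a + b) / ν : ℝ) : ℂ) * p 0 =
      (cQlin μ a b ν R : ℂ) := by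
    rw [hexp, hp0, ← hf₁R, ← hf₁re, cQlin]; push_cast; rfl
  have e2 : -(2 / 3) * (((1 - PriorityRetrial.load μ a b : ℝ) : ℂ) *
      Complex.exp ((((a + b) / ν : ℝ) : ℂ) * B 0) * (((a + b) / ν : ℝ) : ℂ) *
        (-(cF2 μ a b R : ℂ))) = (cQ2 μ a b ν R : ℂ) := by
    have hνc : (ν : ℂ) ≠ 0 := by exact_mod_cast hν.ne'
    rw [hexp, cQ2]; push_cast; field_simp
  rw [e1, e2] at key
  rw [hQR]
  exact key

/-- The primitive has slope `-2 c_{f₁}^{(3)}` in `t`, so the square root already appears to first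
order. -/
lemma Q_of_eq (H : IsRetrialModel (cMoment μ) (rMoment μ) A a b u₀ us) (hν : 0 < ν)
    (hload : PriorityRetrial.load μ a b < 1) (heq : u₀ = us) :
    IsDominantSingularity (Q μ a b ν) (zMapReal (rMoment μ) a b u₀) ∧
      ∃ S, zMapReal (rMoment μ) a b u₀ < S ∧ ∃ Qc : ℂ → ℂ,
        AnalyticOnNhd ℂ Qc (DeltaDomain (zMapReal (rMoment μ) a b u₀) S (π / 4)) ∧
        EqOn Qc (Q μ a b ν) (Metric.ball 0 (zMapReal (rMoment μ) a b u₀)) ∧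
        (fun z : ℂ => Qc z - Q μ a b ν (zMapReal (rMoment μ) a b u₀ : ℂ))
          ~[𝓝[DeltaDomain (zMapReal (rMoment μ) a b u₀) S (π / 4)]
            (zMapReal (rMoment μ) a b u₀ : ℂ)] fun z : ℂ =>
            -((cQ3 μ a b ν (zMapReal (rMoment μ) a b u₀) : ℂ) *
              ((zMapReal (rMoment μ) a b u₀ : ℂ) - z) ^ (1 / 2 : ℂ)) := by
  obtain ⟨F, hF1, hF⟩ := H.exists_primitive
  have hmin : min u₀ us = u₀ := min_eq_left heq.le
  rw [hmin] at hF
  obtain ⟨B, e, hB, he0, δ, hδ, hL, hFB⟩ := H.exists_local_form_of_eq heq hF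
  obtain ⟨hdom, hQR, hexp, S, hS, G, hG, hGQ, hGL⟩ := H.Q_at_critical hν hload hmin hδ hF1 hF
    hB.self_of_nhds.continuousAt hL hFB
  have hcH := H.cH_eq
  have hcH0 := H.cH_pos
  have hR1 := H.one_lt_zMapReal
  set R := zMapReal (rMoment μ) a b u₀ with hRdef
  have hcF3 : (R - 1) / √(2 * b / (a ^ 3 * rMoment μ 2 u₀)) = cF3 μ a b R := by
    rw [cF3, hcH]
  rw [hcF3] at he0
  have hcF30 : cF3 μ a b R ≠ 0 := by
    rw [cF3]; exact div_ne_zero (by linarith) hcH0.ne'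
  have hC : ((1 - PriorityRetrial.load μ a b : ℝ) : ℂ) ≠ 0 := by
    exact_mod_cast (sub_pos.2 hload).ne'
  have hκ : (((a + b) / ν : ℝ) : ℂ) ≠ 0 := by
    exact_mod_cast (div_pos (add_pos H.ha H.hb) hν).ne'
  have hne : e 0 ≠ 0 := by
    rw [he0]; exact_mod_cast mul_ne_zero (by norm_num) hcF30
  have key := isEquivalent_sqrt (l := 𝓝[DeltaDomain R S (π / 4)] (R : ℂ))
    nhdsWithin_le_nhds hB.self_of_nhds
    (mul_ne_zero (mul_ne_zero (mul_ne_zero hC (Complex.exp_ne_zero _)) hκ) hne) hGL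
  refine ⟨hdom, S, hS, _, hG, hGQ, ?_⟩
  have e1 : ((1 - PriorityRetrial.load μ a b : ℝ) : ℂ) *
      Complex.exp ((((a + b) / ν : ℝ) : ℂ) * B 0) * (((a + b) / ν : ℝ) : ℂ) * e 0 =
      -(cQ3 μ a b ν R : ℂ) := by
    have hνc : (ν : ℂ) ≠ 0 := by exact_mod_cast hν.ne'
    rw [hexp, he0, cQ3]; push_cast; field_simp
  rw [e1] at key
  rw [hQR]
  simpa only [neg_mul] using key

/-- Near the pole the primitive is `P - c log (R - z)`, and its exponential is an analytic nonzero
factor times a power. The exponent is negative because `a m₁(us) < 1 < (a + b) m₁(us)`, so `Q` is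
unbounded and cannot be continued. -/
lemma Q_of_gt (H : IsRetrialModel (cMoment μ) (rMoment μ) A a b u₀ us) (hν : 0 < ν)
    (hload : PriorityRetrial.load μ a b < 1) (hgt : us < u₀) :
    IsDominantSingularity (Q μ a b ν) (zMapReal (rMoment μ) a b us) ∧
      ∃ S, zMapReal (rMoment μ) a b us < S ∧ ∃ Qc : ℂ → ℂ,
        AnalyticOnNhd ℂ Qc (DeltaDomain (zMapReal (rMoment μ) a b us) S (π / 4)) ∧
        EqOn Qc (Q μ a b ν) (Metric.ball 0 (zMapReal (rMoment μ) a b us)) ∧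
        Qc ~[𝓝[DeltaDomain (zMapReal (rMoment μ) a b us) S (π / 4)]
            (zMapReal (rMoment μ) a b us : ℂ)] fun z : ℂ =>
            (cQ1 μ a b ν (zMapReal (rMoment μ) a b us) : ℂ) *
              ((zMapReal (rMoment μ) a b us : ℂ) - z) ^
                (-(((a + b) / ν * cF1 μ a b (zMapReal (rMoment μ) a b us) : ℝ) : ℂ)) := by
  obtain ⟨F, hF1, hF⟩ := H.exists_primitive
  have hmin : min u₀ us = us := min_eq_right hgt.le
  obtain ⟨reg, P₀, δ, hδ, hP₀, hregc, hregR, hreg⟩ := H.exists_local_form_of_gt hgt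
  have hR1 := H.one_lt_zMapReal_min
  have hreal := fun x => H.f₁U_real_nonneg (x := x)
  have hRle := H.zMapReal_min_le
  have hdom := H.isDominantSingularity_Q (ν := ν) hF1
  have hcont := fun L => H.exists_Q_continuation (ν := ν) hδ hF1 (L := L)
  have hcF1 := H.cF1_eq
  rw [hmin] at hF hR1 hreal hRle hdom hcont
  rw [← hcF1] at hreg
  set R := zMapReal (rMoment μ) a b us with hRdef
  set c := cF1 μ a b R with hc
  set κ := (a + b) / ν with hκ
  have hκ0 : 0 < κ := div_pos (add_pos H.ha H.hb) hν
  have hc0 : 0 < c := by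
    rw [hcF1]
    exact div_pos (mul_pos (by linarith) (by linarith [H.mul_moment_lt_one hgt]))
      (by linarith [H.one_lt_moment_us])
  have hC0 : 0 < 1 - PriorityRetrial.load μ a b := sub_pos.2 hload
  have hslit : ∀ z : ℂ, z.re < R → (R : ℂ) - z ∈ Complex.slitPlane := fun z hz =>
    Or.inl (by simpa using hz)
  have hlog : ∀ z : ℂ, (R : ℂ) - z ∈ Complex.slitPlane →
      HasDerivAt (fun z : ℂ => c * Complex.log ((R : ℂ) - z)) (-(c / ((R : ℂ) - z))) z := by
    intro z hz
    refine ((((hasDerivAt_id z).const_sub (R : ℂ)).clog hz).const_mul (c : ℂ)).congr_deriv ?_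
    simp only [id]; ring
  obtain ⟨k, hk⟩ := exists_eq_add_const
    ((convex_ball (R : ℂ) δ).inter (convex_re_lt R)) (F := F)
    (L := fun z => P₀ z - c * Complex.log ((R : ℂ) - z)) (fun z hz => hF z hz.2) fun z hz => by
      refine ((hP₀ z hz.1).sub (hlog z (hslit z hz.2))).congr_deriv ?_
      rw [hreg z hz.2]; ring
  set P : ℂ → ℂ := fun z => P₀ z + k with hPdef
  have hP : ∀ z ∈ Metric.ball (R : ℂ) δ, HasDerivAt P (reg z) z := fun z hz =>
    (hP₀ z hz).add_const k
  have hFP : ∀ z ∈ Metric.ball (R : ℂ) δ, z.re < R →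
      F z = P z - c * Complex.log ((R : ℂ) - z) := fun z hz hzR => by
    rw [hk z ⟨hz, hzR⟩]; simp only [hPdef]; ring
  have hRball : (R : ℂ) ∈ Metric.ball (R : ℂ) δ := Metric.mem_ball_self hδ
  -- the value of `P` at the pole, through the integral of the regular part
  have hPR : P R = ((κ⁻¹ * (κ * (c * Real.log (R - 1)) + -κ *
      ∫ x in R..1, ((f₁ μ a b (x : ℂ)).re - c / (R - x))) : ℝ) : ℂ) := by
    classical
    -- This is `F + c log (R - z)` extended across `R` by `P`: a primitive of the regular part along
    -- `[1, R]`, with value `c log (R - 1)` at `1` because `F(1) = 0`.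
    set T : ℂ → ℂ := fun z => if z ∈ Metric.ball (R : ℂ) δ then P z
      else F z + c * Complex.log ((R : ℂ) - z) with hT
    have hTleft : ∀ z : ℂ, z.re < R → T z = F z + c * Complex.log ((R : ℂ) - z) := by
      intro z hz
      by_cases hzb : z ∈ Metric.ball (R : ℂ) δ
      · rw [hT]; simp only [if_pos hzb]; rw [hFP z hzb hz]; ring
      · rw [hT]; simp only [if_neg hzb]
    have hTd : ∀ x ∈ Set.uIcc 1 R, HasDerivAt (fun x : ℝ => T x) (reg x) x := by
      intro x hx
      rw [uIcc_of_le hR1.le] at hx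
      refine HasDerivAt.comp_ofReal ?_
      rcases hx.2.lt_or_eq with h | h
      · have hxR : ((x : ℂ)).re < R := by simpa using h
        have h1 : T =ᶠ[𝓝 (x : ℂ)] fun z => F z + c * Complex.log ((R : ℂ) - z) := by
          filter_upwards [(isOpen_re_lt R).mem_nhds hxR] with z hz using hTleft z hz
        refine HasDerivAt.congr_of_eventuallyEq ?_ h1
        refine ((hF x hxR).add (hlog x (hslit x hxR))).congr_deriv ?_
        rw [hreg x hxR]; ring
      · have h1 : T =ᶠ[𝓝 (R : ℂ)] P := by
          filter_upwards [Metric.ball_mem_nhds _ hδ] with z hz using if_pos hz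
        rw [h]
        exact (hP R hRball).congr_of_eventuallyEq h1
    have hregcont : ContinuousOn (fun x : ℝ => reg x) (Set.uIcc 1 R) := by
      intro x hx
      rw [uIcc_of_le hR1.le] at hx
      refine ContinuousAt.continuousWithinAt
        (ContinuousAt.comp (g := reg) ?_ Complex.continuous_ofReal.continuousAt)
      rcases hx.2.lt_or_eq with h | h
      · exact hregc x (by simpa using h)
      · rw [h]; exact hregR
    have hFTC := intervalIntegral.integral_eq_sub_of_hasDerivAt hTd hregcont.intervalIntegrable
    have hTR : T R = P R := if_pos hRball
    have hT1 : T (1 : ℝ) = c * (Real.log (R - 1) : ℝ) := by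
      rw [Complex.ofReal_one, hTleft 1 (by simpa using hR1), hF1, zero_add,
        Complex.ofReal_log (by linarith)]
      push_cast; rfl
    have hcongr : ∫ x in (1 : ℝ)..R, reg x =
        ((∫ x in (1 : ℝ)..R, ((f₁ μ a b (x : ℂ)).re - c / (R - x)) : ℝ) : ℂ) := by
      rw [← intervalIntegral.integral_ofReal]
      refine intervalIntegral.integral_congr_ae ?_
      have : ∀ᵐ t : ℝ ∂volume, t ≠ R := by simp [ae_iff]
      filter_upwards [this] with x hxR hx
      rw [uIoc_of_le hR1.le] at hx
      have hxlt := lt_of_le_of_ne hx.2 hxR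
      obtain ⟨r, -, hr⟩ := hreal x hx.1 hxlt
      have h1 := hreg x (by simpa using hxlt)
      have h2 : f₁ μ a b (x : ℂ) = r := by
        rw [← hr]
        refine H.f₁_eq ?_ fun h0 => hx.1.ne' (by exact_mod_cast h0)
        rw [Complex.norm_real, norm_of_nonneg (by linarith [hx.1])]
        exact hxlt.trans_le hRle
      rw [h2, Complex.ofReal_re]
      rw [hr] at h1
      push_cast
      linear_combination -h1
    rw [hcongr, hTR, hT1] at hFTC
    rw [intervalIntegral.integral_symm]
    have h3 : P R = ((c * Real.log (R - 1) +
        ∫ x in (1 : ℝ)..R, ((f₁ μ a b (x : ℂ)).re - c / (R - x)) : ℝ) : ℂ) := by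
      push_cast at hFTC ⊢; linear_combination -hFTC
    rw [h3]
    congr 1
    field_simp
  have hexpP : ((1 - PriorityRetrial.load μ a b : ℝ) : ℂ) * Complex.exp ((κ : ℂ) * P R) =
      (cQ1 μ a b ν R : ℂ) := by
    have hpow : (R - 1) ^ (κ * c) = Real.exp (κ * (c * Real.log (R - 1))) := by
      rw [Real.rpow_def_of_pos (by linarith)]; congr 1; ring
    rw [hPR, cQ1, ← hκ, ← hc, hpow, mul_assoc, ← Real.exp_add, ← Complex.ofReal_mul,
      mul_inv_cancel_left₀ hκ0.ne', ← Complex.ofReal_exp, ← Complex.ofReal_mul]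
  obtain ⟨S, hS, G, hG, hGQ, hGL⟩ := hcont (fun z => P z - c * Complex.log ((R : ℂ) - z)) hF
    (fun z hz hzs => ((hP z hz).sub (hlog z hzs)).differentiableAt) hFP
  refine ⟨hdom hF ?_, S, hS, _, hG, hGQ, ?_⟩
  · rintro ⟨g, hg, hgQ⟩
    have hx := tendsto_ofReal_ball (one_pos.trans hR1)
    have hgx : ∀ᶠ x : ℝ in 𝓝[<] R, g x = ((1 - PriorityRetrial.load μ a b : ℝ) : ℂ) *
        Complex.exp ((κ : ℂ) * F x) := hx.eventually hgQ
    have hglim : Tendsto (fun x : ℝ => ‖g x‖) (𝓝[<] R) (𝓝 ‖g R‖) :=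
      ((hg.continuousAt.tendsto.mono_left nhdsWithin_le_nhds).comp hx).norm
    -- The modulus of `Q` along the reals diverges since `-c log (R - x) → ∞`, which a continuous
    -- extension to `R` forbids.
    have htop : Tendsto (fun x : ℝ => (1 - PriorityRetrial.load μ a b) *
        Real.exp (κ * ((P x).re + -c * Real.log (R - x)))) (𝓝[<] R) atTop := by
      refine Tendsto.const_mul_atTop hC0 (Real.tendsto_exp_atTop.comp
        (Tendsto.const_mul_atTop hκ0 ?_))
      have h1 : Tendsto (fun x : ℝ => R - x) (𝓝[<] R) (𝓝[>] 0) := by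
        refine tendsto_nhdsWithin_iff.2 ⟨?_, ?_⟩
        · have : Tendsto (fun x : ℝ => R - x) (𝓝 R) (𝓝 (R - R)) :=
            Continuous.tendsto (by fun_prop) R
          rw [sub_self] at this
          exact this.mono_left nhdsWithin_le_nhds
        · filter_upwards [self_mem_nhdsWithin] with x hx using sub_pos.2 (show x < R from hx)
      have h2 : Tendsto (fun x : ℝ => (P x).re) (𝓝[<] R) (𝓝 (P R).re) :=
        (Complex.continuous_re.tendsto _).comp
          (((hP R hRball).continuousAt.tendsto.mono_left nhdsWithin_le_nhds).comp hx)
      exact h2.add_atTop ((Real.tendsto_log_nhdsGT_zero.comp h1).const_mul_atBot_of_neg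
        (neg_lt_zero.2 hc0))
    refine not_tendsto_nhds_of_tendsto_atTop htop _ (hglim.congr' ?_)
    have hball : ∀ᶠ x : ℝ in 𝓝[<] R, (x : ℂ) ∈ Metric.ball (R : ℂ) δ :=
      (hx.mono_right nhdsWithin_le_nhds).eventually (Metric.ball_mem_nhds _ hδ)
    filter_upwards [hgx, hball, self_mem_nhdsWithin] with x h1 h2 h3
    have h3 : x < R := h3
    rw [h1, hFP x h2 (by simpa using h3), norm_mul, Complex.norm_exp, Complex.norm_real,
      norm_of_nonneg hC0.le, Complex.re_ofReal_mul]
    have h4 : Complex.log ((R : ℂ) - x) = (Real.log (R - x) : ℝ) := by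
      rw [Complex.ofReal_log (by linarith)]; push_cast; rfl
    rw [h4, ← Complex.ofReal_mul, Complex.sub_re, Complex.ofReal_re]
    congr 2; ring
  · have hne : (cQ1 μ a b ν R : ℂ) ≠ 0 := by
      rw [← hexpP]
      exact mul_ne_zero (by exact_mod_cast hC0.ne') (Complex.exp_ne_zero _)
    have h1 : (fun z => ((1 - PriorityRetrial.load μ a b : ℝ) : ℂ) *
        Complex.exp ((κ : ℂ) * P z)) ~[𝓝[DeltaDomain R S (π / 4)] (R : ℂ)]
        fun _ => (cQ1 μ a b ν R : ℂ) := by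
      refine (isEquivalent_const_iff_tendsto hne).2 ?_
      rw [← hexpP]
      refine Tendsto.mono_left ?_ nhdsWithin_le_nhds
      exact (((hP R hRball).continuousAt.const_mul (κ : ℂ)).cexp.const_mul _).tendsto
    have h2 := h1.mul (IsEquivalent.refl (u := fun z : ℂ =>
      ((R : ℂ) - z) ^ (-((κ * c : ℝ) : ℂ))) (l := 𝓝[DeltaDomain R S (π / 4)] (R : ℂ)))
    refine h2.congr_left ?_
    filter_upwards [hGL, self_mem_nhdsWithin] with z hz hzΔ
    have hz0 : (R : ℂ) - z ≠ 0 := Complex.slitPlane_ne_zero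
      (sub_mem_slitPlane_of_mem_deltaDomain (by positivity) hzΔ)
    simp only [Pi.mul_apply]
    rw [hz, Complex.cpow_def_of_ne_zero hz0, mul_assoc, ← Complex.exp_add]
    congr 2
    push_cast; ring

end IsRetrialModel
end PriorityRetrial

/-! ### The theorem -/

theorem mainTheorem2
    (μ : Measure ℝ) [IsProbabilityMeasure μ] (hμ : μ (Set.Iio 0) = 0) (hType : IsType1 μ)
    (lam₁ lam₂ ν : ℝ) (hlam₁ : 0 < lam₁) (hlam₂ : 0 < lam₂) (hν : 0 < ν)
    (hload : load μ lam₁ lam₂ < 1) :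
    -- `h` is well defined: it is the unique root in the open unit disc
    (∀ z : ℂ, ‖z‖ < 1 → ∀ w : ℂ, IsRoot μ lam₁ lam₂ z w ↔ w = PriorityRetrial.h μ lam₁ lam₂ z) ∧
    ∃ Rh Rf RQ : ℝ,
      IsDominantSingularity (PriorityRetrial.h μ lam₁ lam₂) Rh ∧
      IsDominantSingularity (f₁ μ lam₁ lam₂) Rf ∧
      IsDominantSingularity (Q μ lam₁ lam₂ ν) RQ ∧
      RQ = Rf ∧
      -- `Qc` is the analytic continuation of `Q` to a Delta-domain at `RQ`
      ∃ S φ : ℝ, RQ < S ∧ 0 < φ ∧ φ < π / 2 ∧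
      ∃ Qc : ℂ → ℂ, AnalyticOnNhd ℂ Qc (DeltaDomain RQ S φ) ∧
        Set.EqOn Qc (Q μ lam₁ lam₂ ν) (Metric.ball 0 RQ) ∧
        -- first case: `R*` exists and is smaller than `Rh`
        (∀ Rstar : ℝ, IsRstar μ lam₁ lam₂ Rh Rstar → Rstar < Rh →
          RQ = Rstar ∧
          Qc ~[𝓝[DeltaDomain RQ S φ] (RQ : ℂ)] fun z : ℂ =>
            (cQ1 μ lam₁ lam₂ ν RQ : ℂ) *
              ((RQ : ℂ) - z) ^ (-(((lam₁ + lam₂) / ν * cF1 μ lam₁ lam₂ RQ : ℝ) : ℂ))) ∧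
        -- second case: `R*` does not exist
        ((¬ ∃ Rstar : ℝ, IsRstar μ lam₁ lam₂ Rh Rstar) →
          RQ = Rh ∧
          (fun z : ℂ => Qc z -
              (Q μ lam₁ lam₂ ν (RQ : ℂ) - (cQlin μ lam₁ lam₂ ν RQ : ℂ) * ((RQ : ℂ) - z)))
            ~[𝓝[DeltaDomain RQ S φ] (RQ : ℂ)] fun z : ℂ =>
              (cQ2 μ lam₁ lam₂ ν RQ : ℂ) * ((RQ : ℂ) - z) ^ (3 / 2 : ℂ)) ∧
        -- third case: `R*` exists and equals `Rh`
        (∀ Rstar : ℝ, IsRstar μ lam₁ lam₂ Rh Rstar → Rstar = Rh →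
          RQ = Rstar ∧
          (fun z : ℂ => Qc z - Q μ lam₁ lam₂ ν (RQ : ℂ))
            ~[𝓝[DeltaDomain RQ S φ] (RQ : ℂ)] fun z : ℂ =>
              -((cQ3 μ lam₁ lam₂ ν RQ : ℂ) * ((RQ : ℂ) - z) ^ (1 / 2 : ℂ))) := by
  obtain ⟨A, u₀, us, hAR, hu₀, hu₀A, hus, husA, hcrit, hstar⟩ :=
    exists_critical_points hμ hType (lam := lam₁ + lam₂) hlam₁ (by linarith) hload
  have H : IsRetrialModel (cMoment μ) (rMoment μ) A lam₁ lam₂ u₀ us :=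
    { isMomentFamily_moments hμ hType (hu₀.trans hu₀A) hAR with
      ha := hlam₁, hb := hlam₂, u₀_pos := hu₀, u₀_lt := hu₀A, us_pos := hus, us_lt := husA,
      crit := hcrit, star := hstar
      subcritical := by simpa [rMoment, load] using hload }
  have hmono := H.strictMonoOn_zMapReal
  refine ⟨fun z hz w => ?_, zMapReal (rMoment μ) lam₁ lam₂ u₀,
    zMapReal (rMoment μ) lam₁ lam₂ (min u₀ us), zMapReal (rMoment μ) lam₁ lam₂ (min u₀ us),
    H.isDominantSingularity_h, H.isDominantSingularity_f₁, ?_⟩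
  · rw [H.isRoot_iff hz, H.h_eq (hz.trans H.one_lt_zMapReal)]
  -- By `isRstar_iff`, the order of `u₀` and `us` decides which of the three cases occurs; the other
  -- two become vacuous.
  rcases lt_trichotomy u₀ us with hlt | heq | hgt
  · obtain ⟨hdom, S, hS, Qc, hQc, hQQ, hasymp⟩ := H.Q_of_lt hν hload hlt
    rw [min_eq_left hlt.le]
    refine ⟨hdom, rfl, S, π / 4, hS, by positivity, by linarith [Real.pi_pos], Qc, hQc, hQQ,
      fun r hr _ => ?_, fun _ => ⟨rfl, hasymp⟩, fun r hr _ => ?_⟩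
    · exact absurd (H.isRstar_iff.1 hr).1 (not_le.2 hlt)
    · exact absurd (H.isRstar_iff.1 hr).1 (not_le.2 hlt)
  · obtain ⟨hdom, S, hS, Qc, hQc, hQQ, hasymp⟩ := H.Q_of_eq hν hload heq
    rw [min_eq_left heq.le]
    refine ⟨hdom, rfl, S, π / 4, hS, by positivity, by linarith [Real.pi_pos], Qc, hQc, hQQ,
      fun r hr hlt => ?_, fun hno => ?_, fun r hr hreq => ⟨hreq.symm, hasymp⟩⟩
    · rw [(H.isRstar_iff.1 hr).2, heq] at hlt
      exact absurd hlt (lt_irrefl _)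
    · exact absurd ⟨_, H.isRstar_iff.2 ⟨heq.ge, rfl⟩⟩ hno
  · obtain ⟨hdom, S, hS, Qc, hQc, hQQ, hasymp⟩ := H.Q_of_gt hν hload hgt
    rw [min_eq_right hgt.le]
    refine ⟨hdom, rfl, S, π / 4, hS, by positivity, by linarith [Real.pi_pos], Qc, hQc, hQQ,
      fun r hr _ => ⟨(H.isRstar_iff.1 hr).2.symm, hasymp⟩, fun hno => ?_, fun r hr hreq => ?_⟩
    · exact absurd ⟨_, H.isRstar_iff.2 ⟨hgt.le, rfl⟩⟩ hno
    · rw [(H.isRstar_iff.1 hr).2] at hreq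
      exact absurd hreq (hmono (mem_Iic.2 hgt.le) (mem_Iic.2 le_rfl) hgt).ne
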